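/- **Theorem 1 (Precise Bias–Variance Characterization).** Consider a sequence of problems indexed by $k$, with input dimension $T$, feature dimension $n$ and sample size $N$ (all depending on $k$; this dependence is suppressed), such that $N\to\infty$ and $n/N\to\gamma\in(0,\infty)$. Let $\mathbf u\in\mathbb R^T$ be a random input with $\mathbb E\|\mathbf u\|_2^2<\infty$, let $y=\boldsymbol\theta_*^\top\mathbf u+\epsilon$, where $\boldsymbol\theta_*\in\mathbb R^T$ and $\epsilon$ is a noise independent of $\mathbf u$ with mean $0$ and variance $\sigma^2$ (with $\sigma^2$ not depending on $k$), and let $\mathbf z=F(\mathbf u)\in\mathbb R^n$ for a fixed (deterministic, measurable) feature map $F$. Assume: (i) the features are $q$-exponentially concentrated: there are $q,C,s>0$, not depending on $k$, such that $\mathbb P(|\varphi(\mathbf z)-\mathbb E\varphi(\mathbf z)|\ge t)\le Ce^{-(t/s)^q}$ for all $t>0$ and all $1$-Lipschitz $\varphi:\mathbb R^n\to\mathbb R$; (ii) the squared noiseless outputs $(\boldsymbol\theta_*^\top\mathbf u)^2$ are uniformly integrable along the sequence. Fix $\lambda>0$. From $N$ i.i.d. pairs $(\mathbf u_i,y_i)$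 with $\mathbf Z=[F(\mathbf u_1),\dots,F(\mathbf u_N)]$, $\mathbf y=(y_1,\dots,y_N)^\top$, let $\hat{\mathbf w}=(\frac1N\mathbf Z\mathbf Z^\top+\lambda\mathbf I_n)^{-1}\frac1N\mathbf Z\mathbf y$. For an independent test pair $(\mathbf u',y')$ put $\hat y'=\hat{\mathbf w}^\top F(\mathbf u')$, and let $\mathcal R=\mathbb E[(\hat y'-y')^2]$, the expectation being over the training set and the test pair. With $\bar y'=\mathbb E[\hat y'\mid \mathbf u_1,\dots,\mathbf u_N,\mathbf u']$ (the average over the training noise only), let $\mathcal B^2=\mathbb E[(\bar y'-\boldsymbol\theta_*^\top\mathbf u')^2]$ and $\mathcal V=\mathbb E[(\hat y'-\bar y')^2]$. These quantities are finite and $$\mathcal R=\mathcal B^2+\mathcal V+\sigma^2 .$$ Let $\boldsymbol\Sigma_u=\mathbb E[\mathbf u\mathbf u^\top]$, $\boldsymbol\Sigma_z=\mathbb E[\mathbf z\mathbf z^\top]$, $\boldsymbol\Sigma_{uz}=\mathbb E[\mathbf u\mathbf z^\top]$. The fixed-point equation $$\delta=\tfrac1N\mathrm{Tr}(\boldsymbol\Sigma_z\bar{\mathbf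 Q}),\qquad \bar{\mathbf Q}=\Big(\frac{\boldsymbol\Sigma_z}{1+\delta}+\lambda\mathbf I_n\Big)^{-1},$$ has a unique solution $\delta\ge0$, and $\delta>0$ if $N\ge 1$ and $\boldsymbol\Sigma_z\neq0$. Put $\alpha=\frac1N\big\|\frac{\boldsymbol\Sigma_z}{1+\delta}\bar{\mathbf Q}\big\|_F^2$. Then $\alpha<1$ and, along the sequence, $$\mathcal B^2-\frac1{1-\alpha}\Big[\boldsymbol\theta_*^\top\boldsymbol\Sigma_u\boldsymbol\theta_*-\frac{2\,\boldsymbol\theta_*^\top\boldsymbol\Sigma_{uz}\bar{\mathbf Q}\boldsymbol\Sigma_{uz}^\top\boldsymbol\theta_*}{1+\delta}+\frac{\boldsymbol\theta_*^\top\boldsymbol\Sigma_{uz}\bar{\mathbf Q}\boldsymbol\Sigma_z\bar{\mathbf Q}\boldsymbol\Sigma_{uz}^\top\boldsymbol\theta_*}{(1+\delta)^2}\Big]\to0,\qquad \mathcal V-\frac{\sigma^2\alpha}{1-\alpha}\to0 .$$ -/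

import Mathlib

open MeasureTheory Filter Topology
open scoped Matrix

noncomputable section

namespace RidgeFeatures

/-- A law `P` on `ℝⁿ` (with the Euclidean norm) is `q`-exponentially concentrated with constants
`C` and `s`: every `1`-Lipschitz observation deviates from its mean by at least `t` with
probability at most `C exp (-(t / s) ^ q)`. If `φ` were not integrable, its Bochner integral would
be `0` and the tail bound would contradict non-integrability, so `∫ φ` is a true mean here. -/
def ExpConcentrated {n : ℕ} (q C s : ℝ) (P : Measure (EuclideanSpace ℝ (Fin n))) : Prop :=
  ∀ φ : EuclideanSpace ℝ (Fin n) → ℝ, LipschitzWith 1 φ → ∀ t : ℝ, 0 < t →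
    P.real {z | t ≤ |φ z - ∫ x, φ x ∂P|} ≤ C * Real.exp (-(t / s) ^ q)

/-! ### Ridge regression on features -/

section Training

variable {T n N : ℕ}

/-- The feature matrix `Z = [F(u₁), …, F(u_N)]`, of size `n × N`. -/
def featureMatrix (F : EuclideanSpace ℝ (Fin T) → EuclideanSpace ℝ (Fin n))
    (U : Fin N → EuclideanSpace ℝ (Fin T)) : Matrix (Fin n) (Fin N) ℝ :=
  Matrix.of fun i j => F (U j) i

/-- The noisy linear teacher: `yᵢ = θᵀ uᵢ + εᵢ`. -/
def labels (θ : EuclideanSpace ℝ (Fin T)) (U : Fin N → EuclideanSpace ℝ (Fin T))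
    (e : Fin N → ℝ) : Fin N → ℝ :=
  fun i => inner ℝ θ (U i) + e i

/-- The ridge readout `(Z Zᵀ / N + lam I)⁻¹ Z y / N`. -/
def readout (F : EuclideanSpace ℝ (Fin T) → EuclideanSpace ℝ (Fin n)) (lam : ℝ)
    (U : Fin N → EuclideanSpace ℝ (Fin T)) (y : Fin N → ℝ) : Fin n → ℝ :=
  ((N : ℝ)⁻¹ • (featureMatrix F U * (featureMatrix F U)ᵀ) + lam • (1 : Matrix (Fin n) (Fin n) ℝ))⁻¹
    *ᵥ ((N : ℝ)⁻¹ • (featureMatrix F U *ᵥ y))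

/-- The student's prediction at the input `x`, after training on the inputs `U` with the label
noise `e`. -/
def prediction (F : EuclideanSpace ℝ (Fin T) → EuclideanSpace ℝ (Fin n)) (lam : ℝ)
    (θ : EuclideanSpace ℝ (Fin T)) (U : Fin N → EuclideanSpace ℝ (Fin T)) (e : Fin N → ℝ)
    (x : EuclideanSpace ℝ (Fin T)) : ℝ :=
  readout F lam U (labels θ U e) ⬝ᵥ (F x).ofLp

/-- The prediction averaged over the label noise only, with the training inputs and the test
input held fixed. -/
def meanPrediction (F : EuclideanSpace ℝ (Fin T) → EuclideanSpace ℝ (Fin n)) (lam : ℝ)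
    (θ : EuclideanSpace ℝ (Fin T)) (ν : Measure ℝ) (U : Fin N → EuclideanSpace ℝ (Fin T))
    (x : EuclideanSpace ℝ (Fin T)) : ℝ :=
  ∫ e, prediction F lam θ U e x ∂(Measure.pi fun _ : Fin N => ν)

/-- The law of the `N` i.i.d. training inputs together with the `N` i.i.d. training noises, the
two families being independent. -/
def trainLaw (N : ℕ) (μ : Measure (EuclideanSpace ℝ (Fin T))) (ν : Measure ℝ) :
    Measure ((Fin N → EuclideanSpace ℝ (Fin T)) × (Fin N → ℝ)) :=
  (Measure.pi fun _ : Fin N => μ).prod (Measure.pi fun _ : Fin N => ν)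

/-- The test error `ŷ' - y'`, as a function of `((U, e), (u', ε'))`. -/
def testError (F : EuclideanSpace ℝ (Fin T) → EuclideanSpace ℝ (Fin n)) (lam : ℝ)
    (θ : EuclideanSpace ℝ (Fin T))
    (p : ((Fin N → EuclideanSpace ℝ (Fin T)) × (Fin N → ℝ)) × (EuclideanSpace ℝ (Fin T) × ℝ)) :
    ℝ :=
  prediction F lam θ p.1.1 p.1.2 p.2.1 - (inner ℝ θ p.2.1 + p.2.2)

/-- The bias error: noise-averaged prediction minus noiseless target, as a function of
`(U, u')`. -/
def biasError (F : EuclideanSpace ℝ (Fin T) → EuclideanSpace ℝ (Fin n)) (lam : ℝ)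
    (θ : EuclideanSpace ℝ (Fin T)) (ν : Measure ℝ)
    (p : (Fin N → EuclideanSpace ℝ (Fin T)) × EuclideanSpace ℝ (Fin T)) : ℝ :=
  meanPrediction F lam θ ν p.1 p.2 - inner ℝ θ p.2

/-- The deviation of the prediction from its noise average, as a function of `((U, e), u')`. -/
def varError (F : EuclideanSpace ℝ (Fin T) → EuclideanSpace ℝ (Fin n)) (lam : ℝ)
    (θ : EuclideanSpace ℝ (Fin T)) (ν : Measure ℝ)
    (p : ((Fin N → EuclideanSpace ℝ (Fin T)) × (Fin N → ℝ)) × EuclideanSpace ℝ (Fin T)) : ℝ :=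
  prediction F lam θ p.1.1 p.1.2 p.2 - meanPrediction F lam θ ν p.1.1 p.2

/-- The out-of-sample risk `𝓡 = 𝔼 (ŷ' - y')²`, the expectation being over the training set, the
test input and all noises. -/
def risk (N : ℕ) (μ : Measure (EuclideanSpace ℝ (Fin T))) (ν : Measure ℝ)
    (θ : EuclideanSpace ℝ (Fin T)) (F : EuclideanSpace ℝ (Fin T) → EuclideanSpace ℝ (Fin n))
    (lam : ℝ) : ℝ :=
  ∫ p, testError F lam θ p ^ 2 ∂((trainLaw N μ ν).prod (μ.prod ν))

/-- The squared bias `𝓑²`. -/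
def biasSq (N : ℕ) (μ : Measure (EuclideanSpace ℝ (Fin T))) (ν : Measure ℝ)
    (θ : EuclideanSpace ℝ (Fin T)) (F : EuclideanSpace ℝ (Fin T) → EuclideanSpace ℝ (Fin n))
    (lam : ℝ) : ℝ :=
  ∫ p, biasError F lam θ ν p ^ 2 ∂((Measure.pi fun _ : Fin N => μ).prod μ)

/-- The variance `𝓥`. -/
def variance (N : ℕ) (μ : Measure (EuclideanSpace ℝ (Fin T))) (ν : Measure ℝ)
    (θ : EuclideanSpace ℝ (Fin T)) (F : EuclideanSpace ℝ (Fin T) → EuclideanSpace ℝ (Fin n))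
    (lam : ℝ) : ℝ :=
  ∫ p, varError F lam θ ν p ^ 2 ∂((trainLaw N μ ν).prod μ)

end Training

/-! ### Deterministic equivalents -/

section Equivalents

variable {T n : ℕ}

/-- `Σ_u = 𝔼[u uᵀ]`. -/
def sigmaU (μ : Measure (EuclideanSpace ℝ (Fin T))) : Matrix (Fin T) (Fin T) ℝ :=
  Matrix.of fun i j => ∫ u, u i * u j ∂μ

/-- `Σ_z = 𝔼[z zᵀ]` with `z = F(u)`. -/
def sigmaZ (μ : Measure (EuclideanSpace ℝ (Fin T)))
    (F : EuclideanSpace ℝ (Fin T) → EuclideanSpace ℝ (Fin n)) : Matrix (Fin n) (Fin n) ℝ :=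
  Matrix.of fun i j => ∫ u, F u i * F u j ∂μ

/-- `Σ_uz = 𝔼[u zᵀ]` with `z = F(u)`. -/
def sigmaUZ (μ : Measure (EuclideanSpace ℝ (Fin T)))
    (F : EuclideanSpace ℝ (Fin T) → EuclideanSpace ℝ (Fin n)) : Matrix (Fin T) (Fin n) ℝ :=
  Matrix.of fun i j => ∫ u, u i * F u j ∂μ

/-- `Q̄ = (Σ_z / (1 + δ) + lam I)⁻¹`. -/
def qBar (S : Matrix (Fin n) (Fin n) ℝ) (lam δ : ℝ) : Matrix (Fin n) (Fin n) ℝ :=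
  ((1 + δ)⁻¹ • S + lam • (1 : Matrix (Fin n) (Fin n) ℝ))⁻¹

/-- `δ` is a nonnegative solution of `δ = Tr (Σ_z Q̄) / N`. -/
def IsDelta (N : ℕ) (S : Matrix (Fin n) (Fin n) ℝ) (lam δ : ℝ) : Prop :=
  0 ≤ δ ∧ δ = (N : ℝ)⁻¹ * (S * qBar S lam δ).trace

/-- The square of the Frobenius norm. -/
def frobeniusSq (A : Matrix (Fin n) (Fin n) ℝ) : ℝ :=
  ∑ i, ∑ j, A i j ^ 2

/-- `α = ‖Σ_z Q̄ / (1 + δ)‖_F² / N`. -/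
def alpha (N : ℕ) (S : Matrix (Fin n) (Fin n) ℝ) (lam δ : ℝ) : ℝ :=
  (N : ℝ)⁻¹ * frobeniusSq (((1 + δ)⁻¹ • S) * qBar S lam δ)

/-- The quadratic form `θᵀ A θ`. -/
def quad (θ : EuclideanSpace ℝ (Fin T)) (A : Matrix (Fin T) (Fin T) ℝ) : ℝ :=
  θ.ofLp ⬝ᵥ (A *ᵥ θ.ofLp)

/-- The asymptotic squared bias. -/
def biasEquiv (N : ℕ) (μ : Measure (EuclideanSpace ℝ (Fin T))) (θ : EuclideanSpace ℝ (Fin T))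
    (F : EuclideanSpace ℝ (Fin T) → EuclideanSpace ℝ (Fin n)) (lam δ : ℝ) : ℝ :=
  1 / (1 - alpha N (sigmaZ μ F) lam δ) *
    (quad θ (sigmaU μ)
      - 2 * quad θ (sigmaUZ μ F * qBar (sigmaZ μ F) lam δ * (sigmaUZ μ F)ᵀ) / (1 + δ)
      + quad θ (sigmaUZ μ F * qBar (sigmaZ μ F) lam δ * sigmaZ μ F * qBar (sigmaZ μ F) lam δ
          * (sigmaUZ μ F)ᵀ) / (1 + δ) ^ 2)

/-- The asymptotic variance `σ² α / (1 - α)`. -/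
def varEquiv (N : ℕ) (μ : Measure (EuclideanSpace ℝ (Fin T)))
    (F : EuclideanSpace ℝ (Fin T) → EuclideanSpace ℝ (Fin n)) (lam σ δ : ℝ) : ℝ :=
  σ ^ 2 * alpha N (sigmaZ μ F) lam δ / (1 - alpha N (sigmaZ μ F) lam δ)

end Equivalents

end RidgeFeatures

end

/-!
The weights of ridge regression depend linearly on the labels, so averaging the prediction over the
training noise leaves the ridge prediction for the noiseless labels `θᵀu`, and the variance involves
the noise only through `σ²`. For the variance the noise may therefore be replaced by signs `±σ`
which are independent of the inputs, and then the variance plus `σ²` is the error of ridge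
regression with such labels. Both limits are thus instances of one statement,
`tendsto_integral_ridgeError_sq`, about the mean square error of ridge regression with arbitrary
square integrable labels.

For bounded labels (`Concentrated.abs_integral_predRisk_sub_le`) the argument is a leave-one-out
analysis. By the Sherman–Morrison formula the residual of the `i`-th sample is `rᵢ / (1 + κᵢ)`, with
`rᵢ` its leave-one-out residual and `κᵢ` its leverage against the other samples.
* The leverage is a quadratic form in a feature vector which is independent of the resolvent.
  Such forms concentrate (`Concentrated.variance_form_le`), so the leverages are close to the
  normalized trace of the resolvent. The resolvent identity, expanded over the samples, says that
  this trace nearly solves the fixed-point equation, and the stability of that equation gives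
  `κᵢ ≈ δ` (`Concentrated.integral_shrink_sub_sq_le`).
* The normal equations read `lam w = N⁻¹ ∑ zᵢ rᵢ / (1 + κᵢ)`. In expectation they determine the
  linear functionals of the weights, `E w ≈ (1 + δ)⁻¹ Q̄ b` with `b` the cross moment of features and
  labels (`Concentrated.abs_integral_dotProduct_fullRidge_le`). Tested against `S Q̄ w`, with `S` the
  second moment of the features, they express the quadratic functionals through linear ones and
  `α E r²` (`Concentrated.abs_integral_form_fullRidge_le`). As `E r²` is the risk itself, `(1 - α)`
  times the risk is the bracket in the theorem, up to errors which vanish in the limit.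

The mean of the features need not be bounded, which would spoil the concentration of quadratic
forms; but the resolvent is small in the direction of the mean
(`Concentrated.integral_meanForm_sq_le`). General labels are reduced to bounded ones by truncation:
the ridge prediction is stable in mean square under perturbation of the labels
(`Concentrated.integral_ridgePrediction_sq_le`), and uniform integrability makes the truncation error
uniform along the sequence. The fixed-point equation has a solution by the intermediate value
theorem (`exists_isDelta`), a unique one by the resolvent identity (`IsDelta.eq`), and it satisfies
`α ≤ δ / (1 + δ) < 1` (`alpha_lt_one`).
-/

set_option linter.unusedSectionVars false

namespace RidgeFeatures

noncomputable section

/-! ### Positive semidefinite and coercive matrices -/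

section LinearAlgebra

variable {ι : Type*} [Fintype ι]

lemma dotProduct_mulVec_comm {A : Matrix ι ι ℝ} (hA : Aᵀ = A) (u v : ι → ℝ) :
    u ⬝ᵥ (A *ᵥ v) = v ⬝ᵥ (A *ᵥ u) := by
  rw [Matrix.dotProduct_mulVec, ← Matrix.mulVec_transpose, hA, dotProduct_comm]

lemma posSemidef_of_form {A : Matrix ι ι ℝ} (hA : Aᵀ = A) (h : ∀ v, 0 ≤ v ⬝ᵥ (A *ᵥ v)) :
    A.PosSemidef :=
  Matrix.PosSemidef.of_dotProduct_mulVec_nonneg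
    (by simpa [Matrix.IsHermitian, Matrix.conjTranspose_eq_transpose_of_trivial] using hA)
    (by simpa using h)

lemma _root_.Matrix.PosSemidef.form_nonneg {A : Matrix ι ι ℝ} (hA : A.PosSemidef) (v : ι → ℝ) :
    0 ≤ v ⬝ᵥ (A *ᵥ v) := by
  simpa using hA.dotProduct_mulVec_nonneg v

omit [Fintype ι] in
lemma _root_.Matrix.PosSemidef.transpose_eq {A : Matrix ι ι ℝ} (hA : A.PosSemidef) : Aᵀ = A := by
  simpa [Matrix.IsHermitian, Matrix.conjTranspose_eq_transpose_of_trivial] using hA.1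

lemma form_add_smul {A : Matrix ι ι ℝ} (hA : Aᵀ = A) (u v : ι → ℝ) (t : ℝ) :
    (u + t • v) ⬝ᵥ (A *ᵥ (u + t • v)) =
      u ⬝ᵥ (A *ᵥ u) + 2 * t * (u ⬝ᵥ (A *ᵥ v)) + t ^ 2 * (v ⬝ᵥ (A *ᵥ v)) := by
  simp only [Matrix.mulVec_add, Matrix.mulVec_smul, add_dotProduct, dotProduct_add,
    smul_dotProduct, dotProduct_smul, smul_eq_mul]
  rw [dotProduct_mulVec_comm hA v u]; ring

/-- The Cauchy–Schwarz inequality for a positive semidefinite form. -/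
lemma _root_.Matrix.PosSemidef.form_sq_le {A : Matrix ι ι ℝ} (hA : A.PosSemidef) (u v : ι → ℝ) :
    (u ⬝ᵥ (A *ᵥ v)) ^ 2 ≤ (u ⬝ᵥ (A *ᵥ u)) * (v ⬝ᵥ (A *ᵥ v)) := by
  have h : ∀ t : ℝ, 0 ≤ (v ⬝ᵥ (A *ᵥ v)) * (t * t) + (2 * (u ⬝ᵥ (A *ᵥ v))) * t +
      u ⬝ᵥ (A *ᵥ u) := fun t => by
    have := hA.form_nonneg (u + t • v)
    rw [form_add_smul hA.transpose_eq] at this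
    linarith
  have := discrim_le_zero h
  unfold discrim at this
  linarith

lemma dotProduct_sq_le (u v : ι → ℝ) : (u ⬝ᵥ v) ^ 2 ≤ (u ⬝ᵥ u) * (v ⬝ᵥ v) := by
  classical
  simpa using (Matrix.PosSemidef.one (n := ι) (R := ℝ)).form_sq_le u v

lemma dotProduct_self_nonneg' (u : ι → ℝ) : 0 ≤ u ⬝ᵥ u :=
  Finset.sum_nonneg fun i _ => mul_self_nonneg (u i)

/-- The triangle inequality, in squared form, for a positive semidefinite form. -/
lemma _root_.Matrix.PosSemidef.form_add_le {A : Matrix ι ι ℝ} (hA : A.PosSemidef) (u v : ι → ℝ) :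
    (u + v) ⬝ᵥ (A *ᵥ (u + v)) ≤ 2 * (u ⬝ᵥ (A *ᵥ u)) + 2 * (v ⬝ᵥ (A *ᵥ v)) := by
  have h1 := form_add_smul hA.transpose_eq u v 1
  have h2 := form_add_smul hA.transpose_eq u v (-1)
  have h3 := hA.form_nonneg (u + (-1 : ℝ) • v)
  rw [one_smul] at h1
  linarith

/-- The seminorm of a positive semidefinite form satisfies the triangle inequality. -/
lemma _root_.Matrix.PosSemidef.sqrt_form_sub_le {A : Matrix ι ι ℝ} (hA : A.PosSemidef)
    (u v : ι → ℝ) :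
    |√(u ⬝ᵥ (A *ᵥ u)) - √(v ⬝ᵥ (A *ᵥ v))| ≤ √((u - v) ⬝ᵥ (A *ᵥ (u - v))) := by
  have hu := hA.form_nonneg u
  have hv := hA.form_nonneg v
  apply Real.le_sqrt_of_sq_le
  rw [sq_abs, sub_sq, Real.sq_sqrt hu, Real.sq_sqrt hv]
  have h1 := form_add_smul hA.transpose_eq u v (-1)
  rw [neg_one_smul, ← sub_eq_add_neg] at h1
  have h2 : u ⬝ᵥ (A *ᵥ v) ≤ √(u ⬝ᵥ (A *ᵥ u)) * √(v ⬝ᵥ (A *ᵥ v)) := by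
    rw [← Real.sqrt_mul hu]
    exact Real.le_sqrt_of_sq_le (hA.form_sq_le u v)
  linarith

lemma trace_mul_vecMulVec (A : Matrix ι ι ℝ) (u v : ι → ℝ) :
    (A * Matrix.vecMulVec u v).trace = v ⬝ᵥ (A *ᵥ u) := by
  rw [Matrix.mul_vecMulVec, Matrix.trace_vecMulVec, dotProduct_comm]

lemma trace_mul_nonneg {A B : Matrix ι ι ℝ} (hA : A.PosSemidef) (hB : B.PosSemidef) :
    0 ≤ (A * B).trace := by
  obtain ⟨m, w, rfl⟩ := Matrix.posSemidef_iff_eq_sum_vecMulVec.mp hB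
  rw [Finset.mul_sum, Matrix.trace_sum]
  refine Finset.sum_nonneg fun i _ => ?_
  rw [trace_mul_vecMulVec]
  simpa using hA.form_nonneg (w i)

lemma vecMulVec_mulVec' (u v a : ι → ℝ) : Matrix.vecMulVec u v *ᵥ a = (v ⬝ᵥ a) • u := by
  ext i
  simp [Matrix.mulVec, Matrix.vecMulVec, dotProduct, Finset.mul_sum, mul_comm, mul_left_comm]

/-- A symmetric matrix whose quadratic form dominates `lam` times the squared Euclidean norm. -/
structure Coercive (lam : ℝ) (A : Matrix ι ι ℝ) : Prop where
  symm : Aᵀ = A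
  le : ∀ v, lam * (v ⬝ᵥ v) ≤ v ⬝ᵥ (A *ᵥ v)

variable [DecidableEq ι]

lemma coercive_add {lam : ℝ} {S : Matrix ι ι ℝ} (hS : S.PosSemidef) :
    Coercive lam (S + lam • (1 : Matrix ι ι ℝ)) where
  symm := by simp [hS.transpose_eq]
  le v := by
    have := hS.form_nonneg v
    simp only [Matrix.add_mulVec, Matrix.smul_mulVec, Matrix.one_mulVec, dotProduct_add,
      dotProduct_smul, smul_eq_mul]
    linarith

namespace Coercive

variable {lam : ℝ} {A : Matrix ι ι ℝ}

lemma isUnit (hA : Coercive lam A) (hlam : 0 < lam) : IsUnit A := by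
  rw [← Matrix.mulVec_injective_iff_isUnit]
  intro u v huv
  have h := hA.le (u - v)
  rw [Matrix.mulVec_sub, sub_eq_zero.2 huv, dotProduct_zero] at h
  have h0 : (u - v) ⬝ᵥ (u - v) = 0 :=
    le_antisymm (nonpos_of_mul_nonpos_right h hlam) (dotProduct_self_nonneg' _)
  exact sub_eq_zero.1 (dotProduct_self_eq_zero.1 h0)

lemma mul_inv (hA : Coercive lam A) (hlam : 0 < lam) : A * A⁻¹ = 1 :=
  Matrix.mul_nonsing_inv _ ((Matrix.isUnit_iff_isUnit_det _).1 (hA.isUnit hlam))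

lemma inv_mul (hA : Coercive lam A) (hlam : 0 < lam) : A⁻¹ * A = 1 :=
  Matrix.nonsing_inv_mul _ ((Matrix.isUnit_iff_isUnit_det _).1 (hA.isUnit hlam))

lemma inv_symm (hA : Coercive lam A) : A⁻¹ᵀ = A⁻¹ := by
  rw [Matrix.transpose_nonsing_inv, hA.symm]

lemma mulVec_inv (hA : Coercive lam A) (hlam : 0 < lam) (v : ι → ℝ) : A *ᵥ (A⁻¹ *ᵥ v) = v := by
  rw [Matrix.mulVec_mulVec, hA.mul_inv hlam, Matrix.one_mulVec]

lemma inv_mulVec (hA : Coercive lam A) (hlam : 0 < lam) (v : ι → ℝ) : A⁻¹ *ᵥ (A *ᵥ v) = v := by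
  rw [Matrix.mulVec_mulVec, hA.inv_mul hlam, Matrix.one_mulVec]

/-- `vᵀ A⁻¹ v` is the form of `A` at `A⁻¹ v`. -/
lemma form_inv (hA : Coercive lam A) (hlam : 0 < lam) (v : ι → ℝ) :
    (A⁻¹ *ᵥ v) ⬝ᵥ (A *ᵥ (A⁻¹ *ᵥ v)) = v ⬝ᵥ (A⁻¹ *ᵥ v) := by
  rw [hA.mulVec_inv hlam, dotProduct_comm]

lemma normSq_inv_le (hA : Coercive lam A) (hlam : 0 < lam) (v : ι → ℝ) :
    lam * ((A⁻¹ *ᵥ v) ⬝ᵥ (A⁻¹ *ᵥ v)) ≤ v ⬝ᵥ (A⁻¹ *ᵥ v) := by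
  rw [← hA.form_inv hlam]
  exact hA.le _

lemma inv_posSemidef (hA : Coercive lam A) (hlam : 0 < lam) : A⁻¹.PosSemidef :=
  posSemidef_of_form hA.inv_symm fun v =>
    (mul_nonneg hlam.le (dotProduct_self_nonneg' _)).trans (hA.normSq_inv_le hlam v)

lemma form_inv_le (hA : Coercive lam A) (hlam : 0 < lam) (v : ι → ℝ) :
    v ⬝ᵥ (A⁻¹ *ᵥ v) ≤ lam⁻¹ * (v ⬝ᵥ v) := by
  have h1 := hA.normSq_inv_le hlam v
  have h2 := dotProduct_sq_le v (A⁻¹ *ᵥ v)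
  have h3 := (hA.inv_posSemidef hlam).form_nonneg v
  set x := v ⬝ᵥ (A⁻¹ *ᵥ v)
  rcases h3.eq_or_lt with h | h
  · rw [← h]; exact mul_nonneg (inv_nonneg.2 hlam.le) (dotProduct_self_nonneg' _)
  · rw [inv_mul_eq_div, le_div_iff₀ hlam]
    have h4 : lam * x ^ 2 ≤ (v ⬝ᵥ v) * x := by
      have := mul_le_mul_of_nonneg_left h1 (dotProduct_self_nonneg' v)
      nlinarith
    nlinarith

/-- If the form of `A` dominates `t (vᵀ ·)²`, then `vᵀ A⁻¹ v ≤ 1 / t`. -/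
lemma form_inv_le_one (hA : Coercive lam A) (hlam : 0 < lam) {t : ℝ} (v : ι → ℝ)
    (h : ∀ a, t * (v ⬝ᵥ a) ^ 2 ≤ a ⬝ᵥ (A *ᵥ a)) : t * (v ⬝ᵥ (A⁻¹ *ᵥ v)) ≤ 1 := by
  have h1 := h (A⁻¹ *ᵥ v)
  rw [hA.form_inv hlam] at h1
  rcases ((hA.inv_posSemidef hlam).form_nonneg v).eq_or_lt with h | h
  · rw [← h]; simp
  · nlinarith

lemma inv_apply_abs_le (hA : Coercive lam A) (hlam : 0 < lam) (i j : ι) :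
    |A⁻¹ i j| ≤ lam⁻¹ := by
  have h := (hA.inv_posSemidef hlam).form_sq_le (Pi.single i 1) (Pi.single j 1)
  have hi := hA.form_inv_le hlam (Pi.single i 1)
  have hj := hA.form_inv_le hlam (Pi.single j 1)
  have hj0 := (hA.inv_posSemidef hlam).form_nonneg (Pi.single j 1)
  have hi0 := (hA.inv_posSemidef hlam).form_nonneg (Pi.single i 1)
  simp only [single_one_dotProduct, Matrix.mulVec_single_one, Matrix.col_apply, Pi.single_eq_same,
    mul_one] at *
  apply abs_le_of_sq_le_sq _ (inv_nonneg.2 hlam.le)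
  nlinarith

omit [DecidableEq ι] in
lemma add_rank_one (hA : Coercive lam A) {t : ℝ} (ht : 0 ≤ t) (z : ι → ℝ) :
    Coercive lam (A + t • Matrix.vecMulVec z z) where
  symm := by rw [Matrix.transpose_add, hA.symm, Matrix.transpose_smul,
    Matrix.transpose_vecMulVec]
  le v := by
    have := hA.le v
    simp only [Matrix.add_mulVec, Matrix.smul_mulVec, vecMulVec_mulVec', dotProduct_add,
      dotProduct_smul, smul_eq_mul]
    have : 0 ≤ t * ((z ⬝ᵥ v) * (v ⬝ᵥ z)) := by
      rw [dotProduct_comm v z]; exact mul_nonneg ht (mul_self_nonneg _)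
    linarith

/-- The Sherman–Morrison formula, in the form of its action on a vector. -/
lemma inv_add_rank_one_mulVec (hA : Coercive lam A) (hlam : 0 < lam) {t : ℝ} (ht : 0 ≤ t)
    (z v : ι → ℝ) :
    (A + t • Matrix.vecMulVec z z)⁻¹ *ᵥ v =
      A⁻¹ *ᵥ v - (t * (z ⬝ᵥ (A⁻¹ *ᵥ v)) / (1 + t * (z ⬝ᵥ (A⁻¹ *ᵥ z)))) • (A⁻¹ *ᵥ z) := by
  have hA' := hA.add_rank_one ht z
  have hpos : 0 < 1 + t * (z ⬝ᵥ (A⁻¹ *ᵥ z)) := by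
    have := mul_nonneg ht ((hA.inv_posSemidef hlam).form_nonneg z); linarith
  set x := A⁻¹ *ᵥ v - (t * (z ⬝ᵥ (A⁻¹ *ᵥ v)) / (1 + t * (z ⬝ᵥ (A⁻¹ *ᵥ z)))) • (A⁻¹ *ᵥ z) with hx
  have : (A + t • Matrix.vecMulVec z z) *ᵥ x = v := by
    rw [hx, Matrix.add_mulVec, Matrix.smul_mulVec, vecMulVec_mulVec', Matrix.mulVec_sub,
      Matrix.mulVec_smul, hA.mulVec_inv hlam, hA.mulVec_inv hlam, dotProduct_sub, dotProduct_smul,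
      smul_eq_mul, smul_smul, sub_add, ← sub_smul]
    rw [sub_eq_self]
    convert zero_smul ℝ z using 2
    field_simp
    ring
  rw [← this, hA'.inv_mulVec hlam]

lemma inv_add_rank_one_mulVec_self (hA : Coercive lam A) (hlam : 0 < lam) {t : ℝ} (ht : 0 ≤ t)
    (z : ι → ℝ) :
    (A + t • Matrix.vecMulVec z z)⁻¹ *ᵥ z =
      (1 + t * (z ⬝ᵥ (A⁻¹ *ᵥ z)))⁻¹ • (A⁻¹ *ᵥ z) := by
  have hpos : 0 < 1 + t * (z ⬝ᵥ (A⁻¹ *ᵥ z)) := by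
    have := mul_nonneg ht ((hA.inv_posSemidef hlam).form_nonneg z); linarith
  rw [hA.inv_add_rank_one_mulVec hlam ht]
  nth_rewrite 1 [← one_smul ℝ (A⁻¹ *ᵥ z)]
  rw [← sub_smul]
  congr 1
  field_simp
  ring

lemma form_inv_add_rank_one_le (hA : Coercive lam A) (hlam : 0 < lam) {t : ℝ} (ht : 0 ≤ t)
    (z v : ι → ℝ) :
    v ⬝ᵥ ((A + t • Matrix.vecMulVec z z)⁻¹ *ᵥ v) ≤ v ⬝ᵥ (A⁻¹ *ᵥ v) := by
  rw [hA.inv_add_rank_one_mulVec hlam ht, dotProduct_sub, dotProduct_smul, smul_eq_mul,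
    dotProduct_mulVec_comm hA.inv_symm v z]
  have hpos : 0 < 1 + t * (z ⬝ᵥ (A⁻¹ *ᵥ z)) := by
    have := mul_nonneg ht ((hA.inv_posSemidef hlam).form_nonneg z); linarith
  have : 0 ≤ t * (z ⬝ᵥ (A⁻¹ *ᵥ v)) / (1 + t * (z ⬝ᵥ (A⁻¹ *ᵥ z))) * (z ⬝ᵥ (A⁻¹ *ᵥ v)) := by
    rw [div_mul_eq_mul_div]
    apply div_nonneg _ hpos.le
    rw [mul_assoc]; exact mul_nonneg ht (mul_self_nonneg _)
  linarith

lemma inv_add_rank_one (hA : Coercive lam A) (hlam : 0 < lam) {t : ℝ} (ht : 0 ≤ t)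
    (z : ι → ℝ) :
    (A + t • Matrix.vecMulVec z z)⁻¹ = A⁻¹ -
      (t / (1 + t * (z ⬝ᵥ (A⁻¹ *ᵥ z)))) • Matrix.vecMulVec (A⁻¹ *ᵥ z) (A⁻¹ *ᵥ z) := by
  refine Matrix.ext_of_mulVec_single fun i => ?_
  rw [hA.inv_add_rank_one_mulVec hlam ht, Matrix.sub_mulVec, Matrix.smul_mulVec, vecMulVec_mulVec',
    smul_smul]
  congr 2
  rw [dotProduct_mulVec_comm hA.inv_symm, dotProduct_comm (A⁻¹ *ᵥ z)]
  ring

end Coercive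

/-- The resolvent identity. -/
lemma Coercive.inv_sub_inv {lam lam' : ℝ} {A B : Matrix ι ι ℝ} (hA : Coercive lam A)
    (hB : Coercive lam' B) (h : 0 < lam) (h' : 0 < lam') : A⁻¹ - B⁻¹ = B⁻¹ * (B - A) * A⁻¹ := by
  rw [Matrix.mul_sub, Matrix.sub_mul, hB.inv_mul h', Matrix.one_mul, Matrix.mul_assoc,
    hA.mul_inv h, Matrix.mul_one]

end LinearAlgebra

/-! ### Random variables with moments of all orders -/

section Moments

variable {Ω Ω' : Type*} [MeasurableSpace Ω] [MeasurableSpace Ω'] {P : Measure Ω} {P' : Measure Ω'}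

/-- The random variable `f` has finite absolute moments of all orders. -/
@[fun_prop]
def AllLp (f : Ω → ℝ) (P : Measure Ω) : Prop :=
  AEStronglyMeasurable f P ∧ ∀ p : ℕ, Integrable (fun ω => |f ω| ^ p) P

namespace AllLp

variable {f g : Ω → ℝ}

lemma mono (hg : AllLp g P) (hf : AEStronglyMeasurable f P) (h : ∀ ω, |f ω| ≤ |g ω|) :
    AllLp f P :=
  ⟨hf, fun p => (hg.2 p).mono (hf.norm.pow p) (.of_forall fun ω => by
    simpa using pow_le_pow_left₀ (abs_nonneg _) (h ω) p)⟩

lemma integrable (hf : AllLp f P) : Integrable f P :=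
  (hf.2 1).mono hf.1 (.of_forall fun ω => by simp)

lemma of_bounded [IsFiniteMeasure P] {C : ℝ} (hf : AEStronglyMeasurable f P)
    (h : ∀ ω, |f ω| ≤ C) : AllLp f P :=
  ⟨hf, fun p => Integrable.of_bound (hf.norm.pow p) (C ^ p) (.of_forall fun ω => by
    simpa using pow_le_pow_left₀ (abs_nonneg _) (h ω) p)⟩

@[fun_prop]
lemma const [IsFiniteMeasure P] (a : ℝ) : AllLp (fun _ : Ω => a) P :=
  of_bounded aestronglyMeasurable_const fun _ => le_rfl

@[fun_prop]
lemma add (hf : AllLp f P) (hg : AllLp g P) : AllLp (fun ω => f ω + g ω) P :=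
  ⟨hf.1.add hg.1, fun p => (((hf.2 p).add (hg.2 p)).const_mul (2 ^ p)).mono
    ((hf.1.add hg.1).norm.pow p) (.of_forall fun ω => by
      have h1 : |f ω + g ω| ^ p ≤ (|f ω| + |g ω|) ^ p :=
        pow_le_pow_left₀ (abs_nonneg _) (abs_add_le _ _) p
      have h2 : (|f ω| + |g ω|) ^ p ≤ 2 ^ p * (|f ω| ^ p + |g ω| ^ p) := by
        have h3 : (|f ω| + |g ω|) ≤ 2 * max |f ω| |g ω| := by
          linarith [le_max_left |f ω| |g ω|, le_max_right |f ω| |g ω|]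
        refine (pow_le_pow_left₀ (by positivity) h3 p).trans ?_
        rw [mul_pow]
        gcongr
        rcases max_cases |f ω| |g ω| with h | h <;> rw [h.1]
        · linarith [pow_nonneg (abs_nonneg (g ω)) p]
        · linarith [pow_nonneg (abs_nonneg (f ω)) p]
      rw [Pi.add_apply, Real.norm_of_nonneg (by positivity), Real.norm_of_nonneg (by positivity)]
      exact h1.trans h2)⟩

@[fun_prop]
lemma mul (hf : AllLp f P) (hg : AllLp g P) : AllLp (fun ω => f ω * g ω) P :=
  ⟨hf.1.mul hg.1, fun p => ((hf.2 (2 * p)).add (hg.2 (2 * p))).mono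
    ((hf.1.mul hg.1).norm.pow p) (.of_forall fun ω => by
      have h1 : |f ω * g ω| ^ p ≤ |f ω| ^ (2 * p) + |g ω| ^ (2 * p) := by
        rw [abs_mul, mul_pow, mul_comm 2 p, pow_mul, pow_mul]
        nlinarith [sq_nonneg (|f ω| ^ p - |g ω| ^ p), pow_nonneg (abs_nonneg (f ω)) p,
          pow_nonneg (abs_nonneg (g ω)) p]
      simpa using h1.trans (le_abs_self _))⟩

@[fun_prop]
lemma const_mul (hf : AllLp f P) (a : ℝ) : AllLp (fun ω => a * f ω) P :=
  ⟨hf.1.const_mul a, fun p => ((hf.2 p).const_mul (|a| ^ p)).congr (.of_forall fun ω => by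
    simp only [abs_mul, mul_pow])⟩

@[fun_prop]
lemma neg (hf : AllLp f P) : AllLp (fun ω => -f ω) P := by
  simpa using hf.const_mul (-1)

@[fun_prop]
lemma sub (hf : AllLp f P) (hg : AllLp g P) : AllLp (fun ω => f ω - g ω) P := by
  simpa [sub_eq_add_neg] using hf.add hg.neg

@[fun_prop]
lemma pow [IsFiniteMeasure P] (hf : AllLp f P) (k : ℕ) : AllLp (fun ω => f ω ^ k) P := by
  induction k with
  | zero => simpa using const 1
  | succ k ih => simpa [pow_succ] using ih.mul hf

@[fun_prop]
lemma abs (hf : AllLp f P) : AllLp (fun ω => |f ω|) P :=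
  hf.mono hf.1.norm fun ω => by simp

@[fun_prop]
lemma sum [IsFiniteMeasure P] {κ : Type*} {s : Finset κ} {f : κ → Ω → ℝ}
    (hf : ∀ i, AllLp (f i) P) : AllLp (fun ω => ∑ i ∈ s, f i ω) P := by
  classical
  induction s using Finset.induction_on with
  | empty => simpa using const 0
  | insert a s ha ih => simpa [Finset.sum_insert ha] using (hf a).add ih

@[fun_prop]
lemma sqrt [IsFiniteMeasure P] (hf : AllLp f P) : AllLp (fun ω => √(f ω)) P := by
  refine (((const (P := P) (1 : ℝ)).add hf.abs)).mono
    (Real.continuous_sqrt.comp_aestronglyMeasurable hf.1) fun ω => ?_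
  rw [abs_of_nonneg (Real.sqrt_nonneg _), abs_of_nonneg (by positivity)]
  refine Real.sqrt_le_iff.2 ⟨by positivity, ?_⟩
  nlinarith [abs_nonneg (f ω), le_abs_self (f ω)]

lemma inv_of_one_le [IsFiniteMeasure P] (hf : AEStronglyMeasurable f P) (h : ∀ ω, 1 ≤ f ω) :
    AllLp (fun ω => (f ω)⁻¹) P :=
  of_bounded (C := 1) (hf.aemeasurable.inv).aestronglyMeasurable fun ω => by
    rw [abs_of_nonneg (inv_nonneg.2 (by linarith [h ω]))]
    exact inv_le_one_of_one_le₀ (h ω)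

lemma comp {f : Ω' → ℝ} (hf : AllLp f P') {T : Ω → Ω'} (hT : MeasurePreserving T P P') :
    AllLp (fun ω => f (T ω)) P :=
  ⟨hf.1.comp_measurePreserving hT, fun p => hT.integrable_comp_of_integrable (hf.2 p)⟩

@[fun_prop]
lemma dotProduct [IsFiniteMeasure P] {ι : Type*} [Fintype ι] {u v : Ω → ι → ℝ}
    (hu : ∀ i, AllLp (fun ω => u ω i) P) (hv : ∀ i, AllLp (fun ω => v ω i) P) :
    AllLp (fun ω => u ω ⬝ᵥ v ω) P :=
  sum fun i => (hu i).mul (hv i)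

@[fun_prop]
lemma mulVec [IsFiniteMeasure P] {ι : Type*} [Fintype ι] {A : Ω → Matrix ι ι ℝ} {v : Ω → ι → ℝ}
    (hA : ∀ i j, AllLp (fun ω => A ω i j) P) (hv : ∀ i, AllLp (fun ω => v ω i) P) (i : ι) :
    AllLp (fun ω => (A ω *ᵥ v ω) i) P :=
  sum fun j => (hA i j).mul (hv j)

lemma integral_add {f g : Ω → ℝ} (hf : AllLp f P) (hg : AllLp g P) :
    ∫ ω, (f ω + g ω) ∂P = ∫ ω, f ω ∂P + ∫ ω, g ω ∂P :=
  MeasureTheory.integral_add hf.integrable hg.integrable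

lemma integral_sub {f g : Ω → ℝ} (hf : AllLp f P) (hg : AllLp g P) :
    ∫ ω, (f ω - g ω) ∂P = ∫ ω, f ω ∂P - ∫ ω, g ω ∂P :=
  MeasureTheory.integral_sub hf.integrable hg.integrable

lemma integral_sum {κ : Type*} {s : Finset κ} {f : κ → Ω → ℝ} (hf : ∀ i, AllLp (f i) P) :
    ∫ ω, ∑ i ∈ s, f i ω ∂P = ∑ i ∈ s, ∫ ω, f i ω ∂P :=
  integral_finsetSum s fun i _ => (hf i).integrable

lemma integral_mono {f g : Ω → ℝ} (hf : AllLp f P) (hg : AllLp g P) (h : ∀ ω, f ω ≤ g ω) :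
    ∫ ω, f ω ∂P ≤ ∫ ω, g ω ∂P :=
  MeasureTheory.integral_mono hf.integrable hg.integrable h

end AllLp

/-- The Cauchy–Schwarz inequality for expectations. -/
lemma integral_mul_sq_le {f g : Ω → ℝ} (hf : Integrable (fun ω => f ω ^ 2) P)
    (hg : Integrable (fun ω => g ω ^ 2) P) (hfg : Integrable (fun ω => f ω * g ω) P) :
    (∫ ω, f ω * g ω ∂P) ^ 2 ≤ (∫ ω, f ω ^ 2 ∂P) * ∫ ω, g ω ^ 2 ∂P := by
  have h : ∀ t : ℝ, 0 ≤ (∫ ω, g ω ^ 2 ∂P) * (t * t) + (2 * ∫ ω, f ω * g ω ∂P) * t +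
      ∫ ω, f ω ^ 2 ∂P := fun t => by
    have h1 : (∫ ω, g ω ^ 2 ∂P) * (t * t) + (2 * ∫ ω, f ω * g ω ∂P) * t + ∫ ω, f ω ^ 2 ∂P =
        ∫ ω, (f ω + t * g ω) ^ 2 ∂P := by
      rw [show (fun ω => (f ω + t * g ω) ^ 2) =
        fun ω => t * t * g ω ^ 2 + 2 * t * (f ω * g ω) + f ω ^ 2 by funext ω; ring,
        integral_add (f := fun ω => t * t * g ω ^ 2 + 2 * t * (f ω * g ω))
          ((hg.const_mul _).add (hfg.const_mul _)) hf,
        integral_add (hg.const_mul _) (hfg.const_mul _), integral_const_mul, integral_const_mul]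
      ring
    rw [h1]
    exact integral_nonneg fun ω => sq_nonneg _
  have := discrim_le_zero h
  unfold discrim at this
  linarith

lemma AllLp.integral_mul_sq_le [IsFiniteMeasure P] {f g : Ω → ℝ} (hf : AllLp f P)
    (hg : AllLp g P) : (∫ ω, f ω * g ω ∂P) ^ 2 ≤ (∫ ω, f ω ^ 2 ∂P) * ∫ ω, g ω ^ 2 ∂P :=
  RidgeFeatures.integral_mul_sq_le (hf.pow 2).integrable (hg.pow 2).integrable
    (hf.mul hg).integrable

lemma AllLp.sq_integral_le [IsProbabilityMeasure P] {f : Ω → ℝ} (hf : AllLp f P) :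
    (∫ ω, f ω ∂P) ^ 2 ≤ ∫ ω, f ω ^ 2 ∂P := by
  simpa using hf.integral_mul_sq_le (AllLp.const 1)

lemma integral_prod_le_of_inner {α β : Type*} [MeasurableSpace α] [MeasurableSpace β]
    {μ : Measure α} {ν : Measure β} [SFinite μ] [SFinite ν] {f : α × β → ℝ} {h : β → ℝ}
    (hf : Integrable f (μ.prod ν)) (hh : Integrable h ν)
    (hle : ∀ b, ∫ a, f (a, b) ∂μ ≤ h b) : ∫ p, f p ∂(μ.prod ν) ≤ ∫ b, h b ∂ν := by
  rw [integral_prod_symm f hf]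
  exact integral_mono hf.integral_prod_right hh hle

end Moments

/-! ### Concentrated features -/

lemma add_pow_four_le (a b : ℝ) : (a + b) ^ 4 ≤ 8 * a ^ 4 + 8 * b ^ 4 := by
  have h1 : (a + b) ^ 2 ≤ 2 * (a ^ 2 + b ^ 2) := by nlinarith [sq_nonneg (a - b)]
  have h2 : ((a + b) ^ 2) ^ 2 ≤ (2 * (a ^ 2 + b ^ 2)) ^ 2 := pow_le_pow_left₀ (sq_nonneg _) h1 2
  nlinarith [sq_nonneg (a ^ 2 - b ^ 2)]

lemma add_sq_le_two (a b : ℝ) : (a + b) ^ 2 ≤ 2 * a ^ 2 + 2 * b ^ 2 := by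
  nlinarith [sq_nonneg (a - b)]

section Features

variable {X : Type*} [MeasurableSpace X] {n : ℕ}

/-- The second moment matrix `𝔼[z zᵀ]`. -/
def secondMoment (μ : Measure X) (z : X → Fin n → ℝ) : Matrix (Fin n) (Fin n) ℝ :=
  Matrix.of fun i j => ∫ x, z x i * z x j ∂μ

/-- The mean `𝔼[z]`. -/
def meanVec (μ : Measure X) (z : X → Fin n → ℝ) : Fin n → ℝ := fun i => ∫ x, z x i ∂μ

/-- The cross moment `𝔼[g z]` of a scalar label `g` with the features. -/
def crossMoment (μ : Measure X) (g : X → ℝ) (z : X → Fin n → ℝ) : Fin n → ℝ :=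
  fun i => ∫ x, g x * z x i ∂μ

/-- Features with moments of all orders, all of whose observables that are `1`-Lipschitz for the
Euclidean norm have fourth central moment at most `c`. -/
structure Concentrated (c : ℝ) (μ : Measure X) (z : X → Fin n → ℝ) : Prop where
  one_le : 1 ≤ c
  allLp : ∀ i, AllLp (fun x => z x i) μ
  moment : ∀ φ : (Fin n → ℝ) → ℝ, (∀ a b, |φ a - φ b| ≤ √((a - b) ⬝ᵥ (a - b))) →
    ∫ x, (φ (z x) - ∫ y, φ (z y) ∂μ) ^ 4 ∂μ ≤ c

variable {μ : Measure X} {z : X → Fin n → ℝ}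

lemma integral_dotProduct_const (hz : ∀ i, AllLp (fun x => z x i) μ) (a : Fin n → ℝ) :
    ∫ x, a ⬝ᵥ z x ∂μ = a ⬝ᵥ meanVec μ z := by
  simp only [dotProduct, meanVec]
  rw [integral_finsetSum _ fun i _ => ((hz i).const_mul (a i)).integrable]
  simp only [integral_const_mul]

variable [IsProbabilityMeasure μ]

lemma integral_dotProduct_mul_dotProduct (hz : ∀ i, AllLp (fun x => z x i) μ)
    (a b : Fin n → ℝ) :
    ∫ x, (a ⬝ᵥ z x) * (b ⬝ᵥ z x) ∂μ = a ⬝ᵥ (secondMoment μ z *ᵥ b) := by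
  simp only [dotProduct, Matrix.mulVec, secondMoment, Matrix.of_apply, Finset.sum_mul_sum]
  rw [AllLp.integral_sum fun i => by fun_prop]
  refine Finset.sum_congr rfl fun i _ => ?_
  rw [AllLp.integral_sum fun j => by fun_prop, Finset.mul_sum]
  refine Finset.sum_congr rfl fun j _ => ?_
  rw [← integral_mul_const, ← integral_const_mul]
  congr 1; funext x; ring

lemma integral_dotProduct_sq (hz : ∀ i, AllLp (fun x => z x i) μ) (a : Fin n → ℝ) :
    ∫ x, (a ⬝ᵥ z x) ^ 2 ∂μ = a ⬝ᵥ (secondMoment μ z *ᵥ a) := by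
  simp_rw [sq]
  exact integral_dotProduct_mul_dotProduct hz a a

omit [IsProbabilityMeasure μ] in
lemma integral_label_mul_dotProduct {g : X → ℝ} (hgz : ∀ i, Integrable (fun x => g x * z x i) μ)
    (a : Fin n → ℝ) :
    ∫ x, g x * (a ⬝ᵥ z x) ∂μ = a ⬝ᵥ crossMoment μ g z := by
  simp only [dotProduct, crossMoment, Finset.mul_sum]
  rw [integral_finsetSum _ fun i _ => by
    simpa [mul_left_comm] using (hgz i).const_mul (a i)]
  refine Finset.sum_congr rfl fun i _ => ?_
  rw [← integral_const_mul]
  congr 1; funext x; ring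

lemma integral_form (hz : ∀ i, AllLp (fun x => z x i) μ) (B : Matrix (Fin n) (Fin n) ℝ) :
    ∫ x, z x ⬝ᵥ (B *ᵥ z x) ∂μ = (secondMoment μ z * B).trace := by
  have h : ∀ x, z x ⬝ᵥ (B *ᵥ z x) = ∑ i, ∑ j, B j i * (z x i * z x j) := fun x => by
    simp only [dotProduct, Matrix.mulVec, Finset.mul_sum]
    rw [Finset.sum_comm]
    refine Finset.sum_congr rfl fun i _ => Finset.sum_congr rfl fun j _ => ?_
    ring
  simp only [h, Matrix.trace, Matrix.diag, Matrix.mul_apply, secondMoment, Matrix.of_apply]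
  rw [AllLp.integral_sum fun i => by fun_prop]
  refine Finset.sum_congr rfl fun i _ => ?_
  rw [AllLp.integral_sum fun j => by fun_prop]
  refine Finset.sum_congr rfl fun j _ => ?_
  rw [integral_const_mul, mul_comm]

lemma secondMoment_posSemidef (hz : ∀ i, AllLp (fun x => z x i) μ) :
    (secondMoment μ z).PosSemidef := by
  refine posSemidef_of_form ?_ fun v => ?_
  · ext i j
    simp [secondMoment, mul_comm]
  · rw [← integral_dotProduct_sq hz]
    exact integral_nonneg fun x => sq_nonneg _

/-- Jensen: `(𝔼 aᵀz)² ≤ aᵀ 𝔼[z zᵀ] a`. -/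
lemma meanVec_sq_le (hz : ∀ i, AllLp (fun x => z x i) μ) (a : Fin n → ℝ) :
    (a ⬝ᵥ meanVec μ z) ^ 2 ≤ a ⬝ᵥ (secondMoment μ z *ᵥ a) := by
  rw [← integral_dotProduct_const hz, ← integral_dotProduct_sq hz]
  exact AllLp.sq_integral_le (by fun_prop)

namespace Concentrated

variable {c : ℝ} (hz : Concentrated c μ z)
include hz

omit [IsProbabilityMeasure μ] in
lemma pos : 0 < c := by linarith [hz.one_le]

lemma moment_four_le {φ : (Fin n → ℝ) → ℝ} {L : ℝ} (hL : 0 ≤ L)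
    (hφ : ∀ a b, |φ a - φ b| ≤ L * √((a - b) ⬝ᵥ (a - b))) :
    ∫ x, (φ (z x) - ∫ y, φ (z y) ∂μ) ^ 4 ∂μ ≤ c * L ^ 4 := by
  rcases hL.eq_or_lt with rfl | hL
  · have h : ∀ a, φ a = φ 0 := fun a => by
      have := hφ a 0
      rw [zero_mul] at this
      exact sub_eq_zero.1 (abs_nonpos_iff.1 this)
    simp [fun x => h (z x)]
  · have := hz.moment (fun a => L⁻¹ * φ a) fun a b => by
      rw [← mul_sub, abs_mul, abs_of_pos (inv_pos.2 hL), inv_mul_le_iff₀ hL]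
      exact hφ a b
    simp only [integral_const_mul, ← mul_sub, mul_pow, inv_pow] at this
    rwa [inv_mul_le_iff₀ (by positivity), mul_comm] at this

lemma moment_two_le {φ : (Fin n → ℝ) → ℝ} {L : ℝ} (hL : 0 ≤ L)
    (hφ : ∀ a b, |φ a - φ b| ≤ L * √((a - b) ⬝ᵥ (a - b)))
    (hint : AllLp (fun x => φ (z x)) μ) :
    ∫ x, (φ (z x) - ∫ y, φ (z y) ∂μ) ^ 2 ∂μ ≤ c * L ^ 2 := by
  have h4 := hz.moment_four_le hL hφ
  have h2 := AllLp.sq_integral_le (P := μ)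
    (f := fun x => (φ (z x) - ∫ y, φ (z y) ∂μ) ^ 2)
    ((hint.sub (.const _)).pow 2)
  simp only [← pow_mul, Nat.reduceMul] at h2
  have h1 := hz.one_le
  apply le_of_sq_le_sq _ (by positivity)
  refine h2.trans (h4.trans ?_)
  rw [mul_pow, ← pow_mul]
  gcongr
  nlinarith

omit hz in
lemma linear_lipschitz (a u v : Fin n → ℝ) :
    |a ⬝ᵥ u - a ⬝ᵥ v| ≤ √(a ⬝ᵥ a) * √((u - v) ⬝ᵥ (u - v)) := by
  rw [← dotProduct_sub, ← Real.sqrt_mul (dotProduct_self_nonneg' a)]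
  exact Real.abs_le_sqrt (dotProduct_sq_le _ _)

lemma centered_dotProduct_sq_le (a : Fin n → ℝ) :
    ∫ x, (a ⬝ᵥ z x - a ⬝ᵥ meanVec μ z) ^ 2 ∂μ ≤ c * (a ⬝ᵥ a) := by
  have h := hz.moment_two_le (φ := fun u => a ⬝ᵥ u) (Real.sqrt_nonneg (a ⬝ᵥ a))
    (linear_lipschitz a) (by have := hz.allLp; fun_prop)
  rwa [integral_dotProduct_const hz.allLp, Real.sq_sqrt (dotProduct_self_nonneg' a)] at h

lemma centered_dotProduct_four_le (a : Fin n → ℝ) :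
    ∫ x, (a ⬝ᵥ z x - a ⬝ᵥ meanVec μ z) ^ 4 ∂μ ≤ c * (a ⬝ᵥ a) ^ 2 := by
  have h := hz.moment_four_le (φ := fun u => a ⬝ᵥ u) (Real.sqrt_nonneg (a ⬝ᵥ a))
    (linear_lipschitz a)
  rwa [integral_dotProduct_const hz.allLp, show 4 = 2 * 2 from rfl, pow_mul,
    Real.sq_sqrt (dotProduct_self_nonneg' a)] at h

/-- Up to the rank-one contribution of the mean, the second moment matrix is bounded. -/
lemma secondMoment_form_le (a : Fin n → ℝ) :
    a ⬝ᵥ (secondMoment μ z *ᵥ a) ≤ c * (a ⬝ᵥ a) + (a ⬝ᵥ meanVec μ z) ^ 2 := by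
  have h := hz.centered_dotProduct_sq_le a
  have hzz := hz.allLp
  rw [show (fun x => (a ⬝ᵥ z x - a ⬝ᵥ meanVec μ z) ^ 2) = fun x => (a ⬝ᵥ z x) ^ 2 -
    2 * (a ⬝ᵥ meanVec μ z) * (a ⬝ᵥ z x) + (a ⬝ᵥ meanVec μ z) ^ 2 by funext x; ring] at h
  simp (disch := fun_prop) only [AllLp.integral_add, AllLp.integral_sub, integral_const_mul,
    integral_const] at h
  rw [integral_dotProduct_sq hzz, integral_dotProduct_const hzz, probReal_univ, one_smul] at h
  linarith

lemma dotProduct_four_le (a : Fin n → ℝ) :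
    ∫ x, (a ⬝ᵥ z x) ^ 4 ∂μ ≤ 8 * (c * (a ⬝ᵥ a) ^ 2 + (a ⬝ᵥ (secondMoment μ z *ᵥ a)) ^ 2) := by
  have hzz := hz.allLp
  have h1 : ∫ x, (a ⬝ᵥ z x) ^ 4 ∂μ ≤ ∫ x, (8 * (a ⬝ᵥ z x - a ⬝ᵥ meanVec μ z) ^ 4 +
      8 * (a ⬝ᵥ meanVec μ z) ^ 4) ∂μ := by
    refine AllLp.integral_mono (by fun_prop) (by fun_prop) fun x => ?_
    simpa using add_pow_four_le (a ⬝ᵥ z x - a ⬝ᵥ meanVec μ z) (a ⬝ᵥ meanVec μ z)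
  simp (disch := fun_prop) only [AllLp.integral_add, integral_const_mul, integral_const] at h1
  rw [probReal_univ, one_smul] at h1
  have h2 := hz.centered_dotProduct_four_le a
  have h3 : (a ⬝ᵥ meanVec μ z) ^ 4 ≤ (a ⬝ᵥ (secondMoment μ z *ᵥ a)) ^ 2 := by
    rw [show 4 = 2 * 2 from rfl, pow_mul]
    exact pow_le_pow_left₀ (sq_nonneg _) (meanVec_sq_le hzz a) 2
  linarith

/-- Quadratic forms of concentrated vectors concentrate: the square root of the form is Lipschitz,
so it has bounded fluctuations around its mean. -/
lemma variance_form_le {B : Matrix (Fin n) (Fin n) ℝ} (hB : B.PosSemidef) {ℓ : ℝ} (hℓ : 0 ≤ ℓ)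
    (hle : ∀ v, v ⬝ᵥ (B *ᵥ v) ≤ ℓ * (v ⬝ᵥ v)) :
    ∫ x, (z x ⬝ᵥ (B *ᵥ z x) - (secondMoment μ z * B).trace) ^ 2 ∂μ ≤
      8 * c * ℓ * (ℓ + (secondMoment μ z * B).trace) := by
  have hzz := hz.allLp
  have hlip : ∀ u v, |√(u ⬝ᵥ (B *ᵥ u)) - √(v ⬝ᵥ (B *ᵥ v))| ≤ √ℓ * √((u - v) ⬝ᵥ (u - v)) :=
    fun u v => (hB.sqrt_form_sub_le u v).trans (by
      rw [← Real.sqrt_mul hℓ]; exact Real.sqrt_le_sqrt (hle _))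
  have hp : AllLp (fun x => √(z x ⬝ᵥ (B *ᵥ z x))) μ := by fun_prop
  have h4 := hz.moment_four_le (φ := fun u => √(u ⬝ᵥ (B *ᵥ u))) (Real.sqrt_nonneg ℓ) hlip
  have h2 := hz.moment_two_le (φ := fun u => √(u ⬝ᵥ (B *ᵥ u))) (Real.sqrt_nonneg ℓ) hlip hp
  have htr : (secondMoment μ z * B).trace = ∫ x, √(z x ⬝ᵥ (B *ᵥ z x)) ^ 2 ∂μ := by
    rw [← integral_form hzz]
    congr 1; funext x
    rw [Real.sq_sqrt (hB.form_nonneg _)]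
  have he2 := hp.sq_integral_le
  rw [← htr] at he2
  have hx : ∀ x, z x ⬝ᵥ (B *ᵥ z x) = √(z x ⬝ᵥ (B *ᵥ z x)) ^ 2 := fun x =>
    (Real.sq_sqrt (hB.form_nonneg _)).symm
  rw [show (√ℓ) ^ 4 = ℓ ^ 2 by rw [show 4 = 2 * 2 from rfl, pow_mul, Real.sq_sqrt hℓ]] at h4
  rw [Real.sq_sqrt hℓ] at h2
  rw [show (fun x => (z x ⬝ᵥ (B *ᵥ z x) - (secondMoment μ z * B).trace) ^ 2) = fun x =>
    (√(z x ⬝ᵥ (B *ᵥ z x)) ^ 2 - (secondMoment μ z * B).trace) ^ 2 from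
    funext fun x => by rw [← hx x]]
  set tr := (secondMoment μ z * B).trace
  set p := fun x => √(z x ⬝ᵥ (B *ᵥ z x))
  set e := ∫ x, p x ∂μ with he
  change ∫ x, (p x ^ 2 - tr) ^ 2 ∂μ ≤ _
  change ∫ x, (p x - e) ^ 4 ∂μ ≤ _ at h4
  change ∫ x, (p x - e) ^ 2 ∂μ ≤ _ at h2
  change tr = ∫ x, p x ^ 2 ∂μ at htr
  set D := ∫ x, (p x - e) ^ 2 ∂μ with hD
  have hD' : tr = D + e ^ 2 := by
    rw [htr, hD, show (fun x => (p x - e) ^ 2) = fun x => p x ^ 2 - 2 * e * p x + e ^ 2 by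
      funext x; ring]
    simp (disch := fun_prop) only [AllLp.integral_add, AllLp.integral_sub, integral_const_mul,
      integral_const, probReal_univ, one_smul]
    rw [← he]; ring
  have hD0 : 0 ≤ D := integral_nonneg fun x => sq_nonneg _
  calc ∫ x, (p x ^ 2 - tr) ^ 2 ∂μ
      ≤ ∫ x, (2 * (p x - e) ^ 4 - 4 * D * (p x - e) ^ 2 + 2 * D ^ 2 +
          8 * e ^ 2 * (p x - e) ^ 2) ∂μ := by
        refine AllLp.integral_mono (by fun_prop) (by fun_prop) fun x => ?_
        rw [hD']
        -- `p² - 𝔼 p² = ((p - e)² - D) + 2 e (p - e)`, where `D` is the variance of `p`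
        nlinarith [sq_nonneg (((p x - e) ^ 2 - D) - 2 * e * (p x - e))]
    _ = 2 * ∫ x, (p x - e) ^ 4 ∂μ - 4 * D * D + 2 * D ^ 2 + 8 * e ^ 2 * D := by
        simp (disch := fun_prop) only [AllLp.integral_add, AllLp.integral_sub, integral_const_mul,
          integral_const, probReal_univ, one_smul]
        rw [← hD]
    _ ≤ 2 * (c * ℓ ^ 2) + 8 * tr * (c * ℓ) := by
        have h5 : e ^ 2 * D ≤ tr * (c * ℓ) := mul_le_mul he2 h2 hD0 (by rw [hD']; positivity)
        nlinarith [sq_nonneg D]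
    _ ≤ 8 * c * ℓ * (ℓ + tr) := by
        have := hz.pos
        nlinarith [mul_nonneg this.le (sq_nonneg ℓ)]

lemma centered_normSq_le :
    ∫ x, (z x - meanVec μ z) ⬝ᵥ (z x - meanVec μ z) ∂μ ≤ c * n := by
  have hzz := hz.allLp
  simp only [dotProduct, Pi.sub_apply]
  rw [AllLp.integral_sum fun i => by fun_prop]
  calc ∑ i, ∫ x, (z x i - meanVec μ z i) * (z x i - meanVec μ z i) ∂μ ≤ ∑ i : Fin n, c := by
        refine Finset.sum_le_sum fun i _ => ?_
        have h := hz.centered_dotProduct_sq_le (Pi.single i 1)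
        simpa [sq] using h
    _ = c * n := by simp [mul_comm]

/-- The Euclidean norm is itself Lipschitz, hence concentrated, so the fourth moment of the centered
features is of the order of the square of their second moment. -/
lemma centered_normSq_sq_le :
    ∫ x, ((z x - meanVec μ z) ⬝ᵥ (z x - meanVec μ z)) ^ 2 ∂μ ≤ 8 * (c + (c * n) ^ 2) := by
  have hzz := hz.allLp
  set m := meanVec μ z
  have hone := Matrix.PosSemidef.one (n := Fin n) (R := ℝ)
  have h4 := hz.moment (fun u => √((u - m) ⬝ᵥ (u - m))) fun a b => by
    simpa using hone.sqrt_form_sub_le (a - m) (b - m)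
  have hp : AllLp (fun x => √((z x - m) ⬝ᵥ (z x - m))) μ := by
    simp only [dotProduct, Pi.sub_apply]; fun_prop
  have he2 := hp.sq_integral_le
  simp only [Real.sq_sqrt (dotProduct_self_nonneg' _)] at he2
  have he := he2.trans hz.centered_normSq_le
  set e := ∫ x, √((z x - m) ⬝ᵥ (z x - m)) ∂μ
  calc ∫ x, ((z x - m) ⬝ᵥ (z x - m)) ^ 2 ∂μ
      = ∫ x, √((z x - m) ⬝ᵥ (z x - m)) ^ 4 ∂μ := by
        congr 1; funext x
        rw [show 4 = 2 * 2 from rfl, pow_mul, Real.sq_sqrt (dotProduct_self_nonneg' _)]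
    _ ≤ ∫ x, (8 * (√((z x - m) ⬝ᵥ (z x - m)) - e) ^ 4 + 8 * e ^ 4) ∂μ := by
        refine AllLp.integral_mono (by fun_prop) (by fun_prop) fun x => ?_
        simpa using add_pow_four_le (√((z x - m) ⬝ᵥ (z x - m)) - e) e
    _ = 8 * ∫ x, (√((z x - m) ⬝ᵥ (z x - m)) - e) ^ 4 ∂μ + 8 * e ^ 4 := by
        simp (disch := fun_prop) only [AllLp.integral_add, integral_const_mul,
          integral_const, probReal_univ, one_smul]
    _ ≤ 8 * (c + (c * n) ^ 2) := by
        have : e ^ 4 ≤ (c * n) ^ 2 := by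
          rw [show 4 = 2 * 2 from rfl, pow_mul]
          exact pow_le_pow_left₀ (sq_nonneg _) he 2
        linarith

/-- Up to the contribution of the mean, `Tr (𝔼[z zᵀ] B)` is at most the dimension times a bound
for `B`. -/
lemma trace_le {B : Matrix (Fin n) (Fin n) ℝ} (hB : B.PosSemidef) {ℓ : ℝ} (hℓ : 0 ≤ ℓ)
    (hle : ∀ v, v ⬝ᵥ (B *ᵥ v) ≤ ℓ * (v ⬝ᵥ v)) :
    (secondMoment μ z * B).trace ≤ ℓ * (c * n) + meanVec μ z ⬝ᵥ (B *ᵥ meanVec μ z) := by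
  have hzz := hz.allLp
  set m := meanVec μ z with hm
  rw [← integral_form hzz]
  have hpt : ∀ x, z x ⬝ᵥ (B *ᵥ z x) ≤ ℓ * ((z x - m) ⬝ᵥ (z x - m)) +
      2 * ((B *ᵥ m) ⬝ᵥ z x) - m ⬝ᵥ (B *ᵥ m) := fun x => by
    have h1 := hle (z x - m)
    have h2 := form_add_smul hB.transpose_eq (z x) m (-1)
    rw [neg_one_smul, ← sub_eq_add_neg] at h2
    rw [dotProduct_comm (B *ᵥ m)]
    linarith
  have hcn : AllLp (fun x => (z x - m) ⬝ᵥ (z x - m)) μ := by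
    simp only [dotProduct, Pi.sub_apply]; fun_prop
  refine (AllLp.integral_mono (by fun_prop) (by fun_prop) hpt).trans ?_
  simp (disch := fun_prop) only [AllLp.integral_add, AllLp.integral_sub, integral_const_mul,
    integral_const, probReal_univ, one_smul]
  rw [integral_dotProduct_const hzz, ← hm, dotProduct_comm (B *ᵥ m)]
  have := mul_le_mul_of_nonneg_left hz.centered_normSq_le hℓ
  linarith

end Concentrated

/-! ### Concentration of bilinear forms -/

/-- A symmetric matrix which acts with norm at most `L`, both for the Euclidean norm and for the
seminorm of `S`. -/
structure Multiplier (S H : Matrix (Fin n) (Fin n) ℝ) (L : ℝ) : Prop where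
  symm : Hᵀ = H
  pos : 0 < L
  normSq_le : ∀ a, (H *ᵥ a) ⬝ᵥ (H *ᵥ a) ≤ L ^ 2 * (a ⬝ᵥ a)
  form_le : ∀ a, (H *ᵥ a) ⬝ᵥ (S *ᵥ (H *ᵥ a)) ≤ L ^ 2 * (a ⬝ᵥ (S *ᵥ a))

omit [IsProbabilityMeasure μ] in
lemma Multiplier.one (S : Matrix (Fin n) (Fin n) ℝ) : Multiplier S 1 1 where
  symm := by simp
  pos := one_pos
  normSq_le a := by simp
  form_le a := by simp

lemma Multiplier.sq {S H : Matrix (Fin n) (Fin n) ℝ} {L : ℝ} (hH : Multiplier S H L) :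
    Multiplier S (H * H) (L ^ 2) where
  symm := by rw [Matrix.transpose_mul, hH.symm]
  pos := pow_pos hH.pos 2
  normSq_le a := by
    rw [← Matrix.mulVec_mulVec]
    nlinarith [hH.normSq_le (H *ᵥ a), hH.normSq_le a, sq_nonneg L]
  form_le a := by
    rw [← Matrix.mulVec_mulVec]
    nlinarith [hH.form_le (H *ᵥ a), hH.form_le a, sq_nonneg L]

section Multiplier

variable {S H B : Matrix (Fin n) (Fin n) ℝ} {L : ℝ}

lemma form_mul_mul (hH : Hᵀ = H) (v : Fin n → ℝ) :
    v ⬝ᵥ ((H * B * H) *ᵥ v) = (H *ᵥ v) ⬝ᵥ (B *ᵥ (H *ᵥ v)) := by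
  rw [Matrix.mul_assoc, ← Matrix.mulVec_mulVec, ← Matrix.mulVec_mulVec, Matrix.dotProduct_mulVec v,
    ← Matrix.mulVec_transpose, hH]

lemma posSemidef_mul_mul (hB : B.PosSemidef) (hH : Hᵀ = H) : (H * B * H).PosSemidef := by
  refine posSemidef_of_form ?_ fun v => ?_
  · rw [Matrix.transpose_mul, Matrix.transpose_mul, hH, hB.transpose_eq, Matrix.mul_assoc]
  · rw [form_mul_mul hH]; exact hB.form_nonneg _

lemma Multiplier.trace_mul_mul_le (hH : Multiplier S H L) (hS : S.PosSemidef)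
    (hB : B.PosSemidef) : (S * (H * B * H)).trace ≤ L ^ 2 * (S * B).trace := by
  have h1 : (L ^ 2 • S - H * S * H).PosSemidef := by
    refine posSemidef_of_form ?_ fun v => ?_
    · rw [Matrix.transpose_sub, (posSemidef_mul_mul hS hH.symm).transpose_eq,
        Matrix.transpose_smul, hS.transpose_eq]
    · rw [Matrix.sub_mulVec, dotProduct_sub, form_mul_mul hH.symm, Matrix.smul_mulVec,
        dotProduct_smul, smul_eq_mul]
      linarith [hH.form_le v]
  have h2 := trace_mul_nonneg h1 hB
  rw [Matrix.sub_mul, Matrix.trace_sub, Matrix.smul_mul, Matrix.trace_smul, smul_eq_mul] at h2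
  have h3 : (H * S * H * B).trace = (S * (H * B * H)).trace := by
    rw [Matrix.mul_assoc, Matrix.mul_assoc, Matrix.trace_mul_comm]
    simp only [Matrix.mul_assoc]
  linarith

lemma trace_mul_symm (hS : Sᵀ = S) (hH : Hᵀ = H) (hB : Bᵀ = B) :
    (S * (B * H)).trace = (S * (H * B)).trace := by
  rw [← Matrix.trace_transpose, Matrix.transpose_mul, Matrix.transpose_mul, hS, hH, hB,
    Matrix.trace_mul_comm]

lemma trace_polarization (hS : Sᵀ = S) (hH : Hᵀ = H) (hB : Bᵀ = B) (t : ℝ) :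
    (S * ((H + t • 1) * B * (H + t • 1))).trace =
      (S * (H * B * H)).trace + 2 * t * (S * (H * B)).trace + t ^ 2 * (S * B).trace := by
  simp only [Matrix.add_mul, Matrix.mul_add, Matrix.smul_mul, Matrix.mul_smul, Matrix.one_mul,
    Matrix.mul_one, Matrix.trace_add, Matrix.trace_smul, smul_eq_mul]
  rw [trace_mul_symm hS hH hB]
  ring

lemma add_smul_one_symm (hH : Hᵀ = H) (t : ℝ) :
    (H + t • (1 : Matrix (Fin n) (Fin n) ℝ))ᵀ = H + t • 1 := by
  simp [hH]

lemma Multiplier.abs_trace_le (hH : Multiplier S H L) (hS : S.PosSemidef) (hB : B.PosSemidef) :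
    |(S * (H * B)).trace| ≤ L * (S * B).trace := by
  have h0 := hH.trace_mul_mul_le hS hB
  have hp : ∀ t : ℝ, 0 ≤ (S * ((H + t • 1) * B * (H + t • 1))).trace := fun t =>
    trace_mul_nonneg hS (posSemidef_mul_mul hB (add_smul_one_symm hH.symm t))
  have h1 := hp L
  have h2 := hp (-L)
  rw [trace_polarization hS.transpose_eq hH.symm hB.transpose_eq] at h1 h2
  have hL := hH.pos
  rw [abs_le]
  constructor <;> refine le_of_mul_le_mul_left ?_ hL <;> nlinarith

end Multiplier

/-- Bilinear forms `zᵀ H A⁻¹ z` concentrate, by polarization. -/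
lemma Concentrated.variance_mul_inv_le {c : ℝ} (hz : Concentrated c μ z) {lam : ℝ}
    (hlam : 0 < lam) {A H : Matrix (Fin n) (Fin n) ℝ} (hA : Coercive lam A) {L : ℝ}
    (hH : Multiplier (secondMoment μ z) H L) :
    ∫ x, (z x ⬝ᵥ ((H * A⁻¹) *ᵥ z x) - (secondMoment μ z * (H * A⁻¹)).trace) ^ 2 ∂μ ≤
      8 * c * (L ^ 2 + 1) ^ 2 * lam⁻¹ * (lam⁻¹ + (secondMoment μ z * A⁻¹).trace) := by
  have hzz := hz.allLp
  set S := secondMoment μ z with hSdef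
  have hS : S.PosSemidef := secondMoment_posSemidef hzz
  have hQ := hA.inv_posSemidef hlam
  set Q := A⁻¹ with hQdef
  have hc := hz.pos
  have htr0 := trace_mul_nonneg hS hQ
  set ℓ := 2 * (L ^ 2 + 1) * lam⁻¹ with hℓ
  have hℓ0 : 0 ≤ ℓ := by positivity
  set Pm := fun t : ℝ => (H + t • 1) * Q * (H + t • 1) with hPm
  have hP : ∀ t, (Pm t).PosSemidef := fun t =>
    posSemidef_mul_mul hQ (add_smul_one_symm hH.symm t)
  have hPle : ∀ t : ℝ, t ^ 2 = 1 → ∀ v, v ⬝ᵥ (Pm t *ᵥ v) ≤ ℓ * (v ⬝ᵥ v) := fun t ht v => by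
    rw [hPm, form_mul_mul (add_smul_one_symm hH.symm t)]
    refine (hA.form_inv_le hlam _).trans ?_
    have h1 := (Matrix.PosSemidef.one (n := Fin n) (R := ℝ)).form_add_le (H *ᵥ v) (t • v)
    simp only [Matrix.one_mulVec, dotProduct_smul, smul_dotProduct, smul_eq_mul] at h1
    rw [← mul_assoc t t, ← sq, ht, one_mul] at h1
    rw [Matrix.add_mulVec, Matrix.smul_mulVec, Matrix.one_mulVec, hℓ]
    have h2 := hH.normSq_le v
    have : 0 < lam⁻¹ := inv_pos.2 hlam
    nlinarith
  -- the forms of `Pm 1` and `Pm (-1)` are nonnegative, and their sum is a sum of squares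
  have hPtr : ∀ t : ℝ, t ^ 2 = 1 → (S * Pm t).trace ≤ 2 * (L ^ 2 + 1) * (S * Q).trace :=
    fun t ht => by
    have h1 := hH.trace_mul_mul_le hS hQ
    have h2 := abs_le.1 (hH.abs_trace_le hS hQ)
    have h4 : (S * Pm (-t)).trace + (S * Pm t).trace =
        2 * (S * (H * Q * H)).trace + 2 * (S * Q).trace := by
      rw [hPm, trace_polarization hS.transpose_eq hH.symm hQ.transpose_eq,
        trace_polarization hS.transpose_eq hH.symm hQ.transpose_eq]
      linear_combination (2 * (S * Q).trace) * ht
    have h5 := trace_mul_nonneg hS (hP (-t))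
    linarith
  have hV : ∀ t : ℝ, t ^ 2 = 1 → ∫ x, (z x ⬝ᵥ (Pm t *ᵥ z x) - (S * Pm t).trace) ^ 2 ∂μ ≤
      8 * c * ℓ * (ℓ + 2 * (L ^ 2 + 1) * (S * Q).trace) := fun t ht =>
    (hz.variance_form_le (hP t) hℓ0 (hPle t ht)).trans (by
      have := hPtr t ht
      gcongr)
  have h1 := hV 1 (by norm_num)
  have h2 := hV (-1) (by norm_num)
  have key : ∀ x, z x ⬝ᵥ ((H * Q) *ᵥ z x) - (S * (H * Q)).trace =
      (1 / 4) * (z x ⬝ᵥ (Pm 1 *ᵥ z x) - (S * Pm 1).trace) -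
      (1 / 4) * (z x ⬝ᵥ (Pm (-1) *ᵥ z x) - (S * Pm (-1)).trace) := fun x => by
    have e1 : ∀ t : ℝ, z x ⬝ᵥ (Pm t *ᵥ z x) = z x ⬝ᵥ ((H * Q * H) *ᵥ z x) +
        2 * t * (z x ⬝ᵥ ((H * Q) *ᵥ z x)) + t ^ 2 * (z x ⬝ᵥ (Q *ᵥ z x)) := fun t => by
      rw [hPm, form_mul_mul (add_smul_one_symm hH.symm t), Matrix.add_mulVec, Matrix.smul_mulVec,
        Matrix.one_mulVec, form_add_smul hQ.transpose_eq, form_mul_mul hH.symm,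
        dotProduct_mulVec_comm hQ.transpose_eq, ← Matrix.mulVec_mulVec,
        Matrix.dotProduct_mulVec (z x) H, ← Matrix.mulVec_transpose, hH.symm,
        dotProduct_mulVec_comm hQ.transpose_eq]
    have e2 : ∀ t : ℝ, (S * Pm t).trace = _ := fun t =>
      trace_polarization hS.transpose_eq hH.symm hQ.transpose_eq t
    rw [e1, e1, e2, e2]
    ring
  calc ∫ x, (z x ⬝ᵥ ((H * Q) *ᵥ z x) - (S * (H * Q)).trace) ^ 2 ∂μ
      ≤ ∫ x, ((1 / 8) * (z x ⬝ᵥ (Pm 1 *ᵥ z x) - (S * Pm 1).trace) ^ 2 +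
        (1 / 8) * (z x ⬝ᵥ (Pm (-1) *ᵥ z x) - (S * Pm (-1)).trace) ^ 2) ∂μ := by
        refine AllLp.integral_mono (by fun_prop) (by fun_prop) fun x => ?_
        simp only [key]
        nlinarith [sq_nonneg ((z x ⬝ᵥ (Pm 1 *ᵥ z x) - (S * Pm 1).trace) +
          (z x ⬝ᵥ (Pm (-1) *ᵥ z x) - (S * Pm (-1)).trace))]
    _ ≤ (1 / 8) * (8 * c * ℓ * (ℓ + 2 * (L ^ 2 + 1) * (S * Q).trace)) +
        (1 / 8) * (8 * c * ℓ * (ℓ + 2 * (L ^ 2 + 1) * (S * Q).trace)) := by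
        rw [AllLp.integral_add (by fun_prop) (by fun_prop), integral_const_mul, integral_const_mul]
        linarith
    _ = 8 * c * (L ^ 2 + 1) ^ 2 * lam⁻¹ * (lam⁻¹ + (S * Q).trace) := by
        rw [hℓ]; ring

end Features

/-! ### Ridge regression and its leave-one-out update -/

section Ridge

variable {n M : ℕ}

/-- The regularized sample second moment matrix `ν⁻¹ ∑ⱼ vⱼ vⱼᵀ + lam I`. The normalization `ν` is
not tied to the number of samples, so that removing a sample does not change it. -/
def gram (ν lam : ℝ) (v : Fin M → Fin n → ℝ) : Matrix (Fin n) (Fin n) ℝ :=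
  ν⁻¹ • ∑ j, Matrix.vecMulVec (v j) (v j) + lam • (1 : Matrix (Fin n) (Fin n) ℝ)

/-- The ridge weights fitted on the feature vectors `v` and the labels `y`. -/
def ridge (ν lam : ℝ) (v : Fin M → Fin n → ℝ) (y : Fin M → ℝ) : Fin n → ℝ :=
  (gram ν lam v)⁻¹ *ᵥ (ν⁻¹ • ∑ j, y j • v j)

lemma form_sum_vecMulVec (ν : ℝ) (v : Fin M → Fin n → ℝ) (a : Fin n → ℝ) :
    a ⬝ᵥ ((ν⁻¹ • ∑ j, Matrix.vecMulVec (v j) (v j)) *ᵥ a) = ν⁻¹ * ∑ j, (v j ⬝ᵥ a) ^ 2 := by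
  rw [Matrix.smul_mulVec, dotProduct_smul, Matrix.sum_mulVec, dotProduct_sum, smul_eq_mul]
  congr 1
  refine Finset.sum_congr rfl fun j _ => ?_
  rw [vecMulVec_mulVec', dotProduct_smul, smul_eq_mul, dotProduct_comm a, sq]

lemma form_gram (ν lam : ℝ) (v : Fin M → Fin n → ℝ) (a : Fin n → ℝ) :
    a ⬝ᵥ (gram ν lam v *ᵥ a) = ν⁻¹ * ∑ j, (v j ⬝ᵥ a) ^ 2 + lam * (a ⬝ᵥ a) := by
  rw [gram, Matrix.add_mulVec, dotProduct_add, form_sum_vecMulVec, Matrix.smul_mulVec,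
    dotProduct_smul, Matrix.one_mulVec, smul_eq_mul]

lemma gram_coercive {ν : ℝ} (hν : 0 ≤ ν) (lam : ℝ) (v : Fin M → Fin n → ℝ) :
    Coercive lam (gram ν lam v) := by
  refine coercive_add (posSemidef_of_form ?_ fun a => ?_)
  · simp [Matrix.transpose_sum, Matrix.transpose_vecMulVec]
  · rw [form_sum_vecMulVec]; positivity

lemma gram_succAbove (ν lam : ℝ) (v : Fin (M + 1) → Fin n → ℝ) (i : Fin (M + 1)) :
    gram ν lam v = gram ν lam (fun j => v (i.succAbove j)) +
      ν⁻¹ • Matrix.vecMulVec (v i) (v i) := by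
  rw [gram, gram, Fin.sum_univ_succAbove _ i, smul_add]
  abel

variable {ν lam : ℝ} (hν : 0 < ν) (hlam : 0 < lam)
include hν hlam

/-- The leave-one-out update of the ridge weights. -/
lemma ridge_succAbove (v : Fin (M + 1) → Fin n → ℝ) (y : Fin (M + 1) → ℝ) (i : Fin (M + 1)) :
    ridge ν lam v y = ridge ν lam (fun j => v (i.succAbove j)) (fun j => y (i.succAbove j)) +
      (ν⁻¹ * (y i - v i ⬝ᵥ ridge ν lam (fun j => v (i.succAbove j)) (fun j => y (i.succAbove j))) /
        (1 + ν⁻¹ * (v i ⬝ᵥ ((gram ν lam fun j => v (i.succAbove j))⁻¹ *ᵥ v i)))) •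
        ((gram ν lam fun j => v (i.succAbove j))⁻¹ *ᵥ v i) := by
  have hA := gram_coercive hν.le lam (fun j => v (i.succAbove j))
  have hpos : 0 < 1 + ν⁻¹ * (v i ⬝ᵥ ((gram ν lam fun j => v (i.succAbove j))⁻¹ *ᵥ v i)) := by
    have := mul_nonneg (inv_nonneg.2 hν.le) ((hA.inv_posSemidef hlam).form_nonneg (v i)); linarith
  conv_lhs => rw [ridge, gram_succAbove ν lam v i, Fin.sum_univ_succAbove _ i, smul_add,
    hA.inv_add_rank_one_mulVec hlam (inv_nonneg.2 hν.le)]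
  rw [Matrix.mulVec_add, Matrix.mulVec_smul, Matrix.mulVec_smul, dotProduct_add, dotProduct_smul,
    dotProduct_smul, ← ridge]
  set Q := (gram ν lam fun j => v (i.succAbove j))⁻¹
  set w := ridge ν lam (fun j => v (i.succAbove j)) (fun j => y (i.succAbove j))
  simp only [smul_eq_mul]
  have hpos' : ν + v i ⬝ᵥ (Q *ᵥ v i) ≠ 0 := by
    have := mul_pos hν hpos
    rw [mul_add, ← mul_assoc, mul_inv_cancel₀ hν.ne'] at this
    linarith
  ext k
  simp only [Pi.add_apply, Pi.sub_apply, Pi.smul_apply, smul_eq_mul]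
  field_simp
  ring

omit hν in
/-- The normal equations of the ridge weights. -/
lemma gram_mulVec_ridge (hν : 0 ≤ ν) (v : Fin M → Fin n → ℝ) (y : Fin M → ℝ) :
    gram ν lam v *ᵥ ridge ν lam v y = ν⁻¹ • ∑ j, y j • v j :=
  (gram_coercive hν lam v).mulVec_inv hlam _

/-- The energy `wᵀ A w` of the ridge weights is at most the mean square of the labels. -/
lemma ridge_form_le (v : Fin M → Fin n → ℝ) (y : Fin M → ℝ) :
    ridge ν lam v y ⬝ᵥ (gram ν lam v *ᵥ ridge ν lam v y) ≤ ν⁻¹ * ∑ j, y j ^ 2 := by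
  set w := ridge ν lam v y with hw
  have h1 : w ⬝ᵥ (gram ν lam v *ᵥ w) = ν⁻¹ * ∑ j, y j * (v j ⬝ᵥ w) := by
    rw [hw, gram_mulVec_ridge hlam hν.le, dotProduct_smul, dotProduct_sum, smul_eq_mul, ← hw]
    congr 1
    refine Finset.sum_congr rfl fun j _ => ?_
    rw [dotProduct_smul, smul_eq_mul, dotProduct_comm]
  have h2 := form_gram ν lam v w
  have h3 : 0 ≤ lam * (w ⬝ᵥ w) := mul_nonneg hlam.le (dotProduct_self_nonneg' w)
  have h4 : ∑ j, y j * (v j ⬝ᵥ w) ≤ (1 / 2) * ∑ j, y j ^ 2 + (1 / 2) * ∑ j, (v j ⬝ᵥ w) ^ 2 := by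
    rw [Finset.mul_sum, Finset.mul_sum, ← Finset.sum_add_distrib]
    refine Finset.sum_le_sum fun j _ => ?_
    nlinarith [sq_nonneg (y j - v j ⬝ᵥ w)]
  have h5 := mul_le_mul_of_nonneg_left h4 (inv_nonneg.2 hν.le)
  rw [mul_add] at h5
  linarith

lemma ridge_normSq_le (v : Fin M → Fin n → ℝ) (y : Fin M → ℝ) :
    lam * (ridge ν lam v y ⬝ᵥ ridge ν lam v y) ≤ ν⁻¹ * ∑ j, y j ^ 2 :=
  ((gram_coercive hν.le lam v).le _).trans (ridge_form_le hν hlam v y)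

/-- The inverse of `gram` is small in the direction of the sample mean `s`, hence bounded in any
direction `m` up to the squared distance of `m` to the sample mean. -/
lemma form_inv_gram_le (hM : 0 < M) (hνM : ν ≤ 2 * M) (v : Fin M → Fin n → ℝ) (m : Fin n → ℝ) :
    m ⬝ᵥ ((gram ν lam v)⁻¹ *ᵥ m) ≤
      4 + 2 * lam⁻¹ * ((M : ℝ)⁻¹ ^ 2 * ((∑ j, (v j - m)) ⬝ᵥ (∑ j, (v j - m)))) := by
  have hA := gram_coercive hν.le lam v
  have hM' : (0 : ℝ) < M := by exact_mod_cast hM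
  set s : Fin n → ℝ := (M : ℝ)⁻¹ • ∑ j, v j with hs
  set d : Fin n → ℝ := ∑ j, (v j - m) with hd
  have hm : m = s + (-(M : ℝ)⁻¹) • d := by
    ext i
    simp only [hs, hd, Finset.sum_sub_distrib, Finset.sum_const, Finset.card_univ,
      Fintype.card_fin, Pi.add_apply, Pi.smul_apply, Pi.sub_apply, Finset.sum_apply, smul_eq_mul,
      ← Nat.cast_smul_eq_nsmul ℝ]
    field_simp
    ring
  have h1 := (hA.inv_posSemidef hlam).form_add_le s ((-(M : ℝ)⁻¹) • d)
  rw [← hm] at h1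
  -- by Jensen over the samples, the form of `gram` dominates `(M / ν) (sᵀ ·)²`
  have h2 : (M / ν) * (s ⬝ᵥ ((gram ν lam v)⁻¹ *ᵥ s)) ≤ 1 := by
    refine hA.form_inv_le_one hlam s fun a => ?_
    rw [form_gram]
    have h3 : (s ⬝ᵥ a) = (M : ℝ)⁻¹ * ∑ j, v j ⬝ᵥ a := by
      rw [hs, smul_dotProduct, sum_dotProduct, smul_eq_mul]
    have h4 := sq_sum_le_card_mul_sum_sq (s := Finset.univ) (f := fun j => v j ⬝ᵥ a)
    rw [Finset.card_univ, Fintype.card_fin] at h4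
    have h5 : M / ν * (s ⬝ᵥ a) ^ 2 ≤ ν⁻¹ * ∑ j, (v j ⬝ᵥ a) ^ 2 := by
      rw [h3, mul_pow, div_mul_eq_mul_div, inv_mul_eq_div, inv_pow]
      gcongr
      rw [inv_mul_eq_div, mul_div_assoc', div_le_iff₀ (by positivity)]
      nlinarith
    have := mul_nonneg hlam.le (dotProduct_self_nonneg' a)
    linarith
  have h6 : s ⬝ᵥ ((gram ν lam v)⁻¹ *ᵥ s) ≤ 2 := by
    have h7 := (hA.inv_posSemidef hlam).form_nonneg s
    have h8 : (1 / 2 : ℝ) ≤ M / ν := by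
      rw [div_le_div_iff₀ (by norm_num) hν]; linarith
    nlinarith
  have h9 := hA.form_inv_le hlam ((-(M : ℝ)⁻¹) • d)
  simp only [dotProduct_smul, smul_dotProduct, smul_eq_mul] at h1 h9
  calc _ ≤ _ := h1
    _ ≤ 2 * 2 + 2 * (lam⁻¹ * (-(M : ℝ)⁻¹ * (-(M : ℝ)⁻¹ * (d ⬝ᵥ d)))) := by linarith
    _ = _ := by ring

end Ridge

/-! ### Independent samples -/

section Sampling

variable {X : Type*} [MeasurableSpace X] {n M : ℕ} {μ : Measure X} [IsProbabilityMeasure μ]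

lemma measurePreserving_removeNth (μ : Measure X) [IsProbabilityMeasure μ] (i : Fin (M + 1)) :
    MeasurePreserving (fun U : Fin (M + 1) → X => (U i, fun j => U (i.succAbove j)))
      (Measure.pi fun _ => μ) (μ.prod (Measure.pi fun _ : Fin M => μ)) :=
  measurePreserving_piFinSuccAbove (fun _ : Fin (M + 1) => μ) i

/-- Any sample may be singled out: it is independent of the others. -/
lemma integral_removeNth (i : Fin (M + 1)) (f : X × (Fin M → X) → ℝ) :
    ∫ U, f (U i, fun j => U (i.succAbove j)) ∂(Measure.pi fun _ : Fin (M + 1) => μ) =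
      ∫ p, f p ∂(μ.prod (Measure.pi fun _ : Fin M => μ)) :=
  (measurePreserving_piFinSuccAbove (fun _ : Fin (M + 1) => μ) i).integral_comp' f

variable {z : X → Fin n → ℝ}

lemma allLp_sample (hz : ∀ i, AllLp (fun x => z x i) μ) (j : Fin M) (i : Fin n) :
    AllLp (fun V : Fin M → X => z (V j) i) (Measure.pi fun _ : Fin M => μ) :=
  (hz i).comp (measurePreserving_eval (fun _ : Fin M => μ) j)

lemma AllLp.finset_prod {Ω κ : Type*} [MeasurableSpace Ω] {P : Measure Ω} [IsFiniteMeasure P]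
    (s : Finset κ) {f : κ → Ω → ℝ} (hf : ∀ i, AllLp (f i) P) :
    AllLp (fun ω => ∏ i ∈ s, f i ω) P := by
  classical
  induction s using Finset.induction_on with
  | empty => simpa using AllLp.const 1
  | insert a s ha ih => simpa [Finset.prod_insert ha] using (hf a).mul ih

lemma AllLp.det {Ω ι : Type*} [MeasurableSpace Ω] {P : Measure Ω} [IsFiniteMeasure P] [Fintype ι]
    [DecidableEq ι] {A : Ω → Matrix ι ι ℝ} (hA : ∀ i j, AllLp (fun ω => A ω i j) P) :
    AllLp (fun ω => (A ω).det) P := by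
  simp only [Matrix.det_apply']
  exact AllLp.sum fun σ => (AllLp.finset_prod _ fun i => hA _ _).const_mul _

/-- The entries of the inverse of a random matrix which is uniformly coercive have moments of all
orders: they are bounded. -/
lemma AllLp.inv {Ω ι : Type*} [MeasurableSpace Ω] {P : Measure Ω} [IsFiniteMeasure P] [Fintype ι]
    [DecidableEq ι] {A : Ω → Matrix ι ι ℝ} (hA : ∀ i j, AllLp (fun ω => A ω i j) P) {lam : ℝ}
    (hlam : 0 < lam) (hc : ∀ ω, Coercive lam (A ω)) (i j : ι) :
    AllLp (fun ω => (A ω)⁻¹ i j) P := by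
  refine AllLp.of_bounded ?_ fun ω => (hc ω).inv_apply_abs_le hlam i j
  have h : ∀ ω, (A ω)⁻¹ i j = (A ω).det⁻¹ * (A ω).adjugate i j := fun ω => by
    rw [Matrix.inv_def, Ring.inverse_eq_inv', Matrix.smul_apply, smul_eq_mul]
  simp only [h]
  refine (AllLp.det hA).1.aemeasurable.inv.aestronglyMeasurable.mul ?_
  simp only [Matrix.adjugate_apply]
  refine (AllLp.det fun k l => ?_).1
  by_cases hk : k = j
  · subst hk; simpa using AllLp.const _
  · simpa [Matrix.updateRow_ne hk] using hA k l

lemma AllLp.gram {Ω : Type*} [MeasurableSpace Ω] {P : Measure Ω} [IsFiniteMeasure P]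
    {v : Ω → Fin M → Fin n → ℝ} (hv : ∀ j i, AllLp (fun ω => v ω j i) P) (ν lam : ℝ)
    (i j : Fin n) : AllLp (fun ω => gram ν lam (v ω) i j) P := by
  simp only [RidgeFeatures.gram, Matrix.add_apply, Matrix.smul_apply, Matrix.sum_apply,
    Matrix.vecMulVec_apply, smul_eq_mul]
  fun_prop

lemma AllLp.inv_gram {Ω : Type*} [MeasurableSpace Ω] {P : Measure Ω} [IsFiniteMeasure P]
    {v : Ω → Fin M → Fin n → ℝ} (hv : ∀ j i, AllLp (fun ω => v ω j i) P) {ν lam : ℝ}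
    (hν : 0 ≤ ν) (hlam : 0 < lam) (i j : Fin n) :
    AllLp (fun ω => (RidgeFeatures.gram ν lam (v ω))⁻¹ i j) P :=
  AllLp.inv (AllLp.gram hv ν lam) hlam (fun ω => gram_coercive hν lam (v ω)) i j

lemma AllLp.ridge {Ω : Type*} [MeasurableSpace Ω] {P : Measure Ω} [IsFiniteMeasure P]
    {v : Ω → Fin M → Fin n → ℝ} (hv : ∀ j i, AllLp (fun ω => v ω j i) P)
    {y : Ω → Fin M → ℝ} (hy : ∀ j, AllLp (fun ω => y ω j) P) {ν lam : ℝ}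
    (hν : 0 ≤ ν) (hlam : 0 < lam) (i : Fin n) :
    AllLp (fun ω => RidgeFeatures.ridge ν lam (v ω) (y ω) i) P := by
  refine AllLp.mulVec (AllLp.inv_gram hv hν hlam) (fun k => ?_) i
  simp only [Pi.smul_apply, Finset.sum_apply, smul_eq_mul]
  fun_prop

section SampleMean

/-- The centered features `z - 𝔼[z]`. -/
def centered (μ : Measure X) (z : X → Fin n → ℝ) (x : X) : Fin n → ℝ := z x - meanVec μ z

/-- The sum of the centered samples. -/
def centeredSum (μ : Measure X) (z : X → Fin n → ℝ) (V : Fin M → X) : Fin n → ℝ :=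
  ∑ j, centered μ z (V j)

lemma allLp_centeredSum (hz : ∀ i, AllLp (fun x => z x i) μ) (i : Fin n) :
    AllLp (fun V : Fin M → X => centeredSum μ z V i) (Measure.pi fun _ : Fin M => μ) := by
  have := fun j i => allLp_sample (M := M) hz j i
  simp only [centeredSum, centered, Finset.sum_apply, Pi.sub_apply]
  exact AllLp.sum fun j => (this j i).sub (.const _)

lemma integral_centered_dotProduct (hz : ∀ i, AllLp (fun x => z x i) μ) (a : Fin n → ℝ) :
    ∫ x, a ⬝ᵥ (z x - meanVec μ z) ∂μ = 0 := by
  simp only [dotProduct_sub]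
  rw [AllLp.integral_sub (by fun_prop) (by fun_prop), integral_dotProduct_const hz]
  simp

/-- The second and fourth moments of the norm of the sum of the centered samples. The samples are
added one at a time; the terms that are linear in the new sample have mean zero. -/
lemma Concentrated.integral_centeredSum_le {c : ℝ} (hz : Concentrated c μ z) (M : ℕ) :
    (∫ V : Fin M → X, centeredSum μ z V ⬝ᵥ centeredSum μ z V ∂(Measure.pi fun _ => μ) ≤
      M * (c * n)) ∧
    ∫ V : Fin M → X, (centeredSum μ z V ⬝ᵥ centeredSum μ z V) ^ 2 ∂(Measure.pi fun _ => μ) ≤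
      4 * M ^ 2 * (c * n) ^ 2 + 3 * M * (8 * (c + (c * n) ^ 2)) := by
  induction M with
  | zero => simp [centeredSum]
  | succ M ih =>
    obtain ⟨ih2, ih4⟩ := ih
    have hzz := hz.allLp
    have hC : ∀ i, AllLp (fun x => centered μ z x i) μ := fun i => by
      simp only [centered, Pi.sub_apply]; fun_prop
    have hC1 : ∀ i, AllLp (fun p : X × (Fin M → X) => centered μ z p.1 i) (μ.prod (Measure.pi fun _ => μ)) := fun i =>
      (hC i).comp measurePreserving_fst
    have hS := allLp_centeredSum (M := M) hzz
    have hS2 : ∀ i, AllLp (fun p : X × (Fin M → X) => centeredSum μ z p.2 i) (μ.prod (Measure.pi fun _ => μ)) :=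
      fun i => (hS i).comp measurePreserving_snd
    have hsum : ∀ U : Fin (M + 1) → X, centeredSum μ z U =
        centered μ z (U 0) + centeredSum μ z (fun j => U ((0 : Fin (M + 1)).succAbove j)) := fun U => by
      rw [centeredSum, Fin.sum_univ_succAbove _ 0]; rfl
    have hz2 : ∫ p : X × (Fin M → X), centered μ z p.1 ⬝ᵥ centered μ z p.1 ∂(μ.prod (Measure.pi fun _ => μ)) ≤ c * n := by
      rw [integral_fun_fst (f := fun x => centered μ z x ⬝ᵥ centered μ z x)]
      rw [probReal_univ, one_smul]; exact hz.centered_normSq_le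
    have hz4 : ∫ p : X × (Fin M → X), (centered μ z p.1 ⬝ᵥ centered μ z p.1) ^ 2 ∂(μ.prod (Measure.pi fun _ => μ)) ≤
        8 * (c + (c * n) ^ 2) := by
      rw [integral_fun_fst (f := fun x => (centered μ z x ⬝ᵥ centered μ z x) ^ 2)]
      rw [probReal_univ, one_smul]; exact hz.centered_normSq_sq_le
    have hcross : ∀ f : (Fin M → X) → ℝ, AllLp f (Measure.pi fun _ => μ) →
        ∫ p : X × (Fin M → X), f p.2 * (centeredSum μ z p.2 ⬝ᵥ centered μ z p.1) ∂(μ.prod (Measure.pi fun _ => μ)) = 0 :=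
      fun f hf => by
      have hf2 : AllLp (fun p : X × (Fin M → X) => f p.2) (μ.prod (Measure.pi fun _ => μ)) :=
        hf.comp measurePreserving_snd
      rw [integral_prod_symm _ (hf2.mul (by fun_prop)).integrable]
      simp only [integral_const_mul, centered, integral_centered_dotProduct hzz, mul_zero,
        integral_zero]
    have hmix : ∫ p : X × (Fin M → X), (centeredSum μ z p.2 ⬝ᵥ centeredSum μ z p.2) *
        (centered μ z p.1 ⬝ᵥ centered μ z p.1) ∂(μ.prod (Measure.pi fun _ => μ)) ≤ (M * (c * n)) * (c * n) := by
      rw [show (fun p : X × (Fin M → X) => (centeredSum μ z p.2 ⬝ᵥ centeredSum μ z p.2) *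
        (centered μ z p.1 ⬝ᵥ centered μ z p.1)) = fun p => (centered μ z p.1 ⬝ᵥ centered μ z p.1) *
        (centeredSum μ z p.2 ⬝ᵥ centeredSum μ z p.2) from funext fun p => mul_comm _ _,
        integral_prod_mul (fun x => centered μ z x ⬝ᵥ centered μ z x) fun V => centeredSum μ z V ⬝ᵥ centeredSum μ z V,
        mul_comm]
      refine mul_le_mul ih2 hz.centered_normSq_le
        (integral_nonneg fun _ => dotProduct_self_nonneg' _) ?_
      have := hz.pos; positivity
    constructor
    · simp only [hsum]
      rw [integral_removeNth 0 fun p => (centered μ z p.1 + centeredSum μ z p.2) ⬝ᵥ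
        (centered μ z p.1 + centeredSum μ z p.2)]
      rw [show (fun p : X × (Fin M → X) => (centered μ z p.1 + centeredSum μ z p.2) ⬝ᵥ
        (centered μ z p.1 + centeredSum μ z p.2)) = fun p => centered μ z p.1 ⬝ᵥ centered μ z p.1 +
        2 * (centeredSum μ z p.2 ⬝ᵥ centered μ z p.1) + centeredSum μ z p.2 ⬝ᵥ centeredSum μ z p.2 from
        funext fun p => by
          rw [add_dotProduct, dotProduct_add, dotProduct_add,
            dotProduct_comm (centered μ z p.1) (centeredSum μ z p.2)]; ring]
      simp (disch := fun_prop) only [AllLp.integral_add, integral_const_mul]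
      have h0 := hcross (fun _ => 1) (by fun_prop)
      simp only [one_mul] at h0
      rw [h0,
        integral_fun_snd (f := fun V => centeredSum μ z V ⬝ᵥ centeredSum μ z V)]
      push_cast
      simp only [probReal_univ, one_smul]
      linarith
    · simp only [hsum]
      rw [integral_removeNth 0 fun p => ((centered μ z p.1 + centeredSum μ z p.2) ⬝ᵥ
        (centered μ z p.1 + centeredSum μ z p.2)) ^ 2]
      -- the expansion of `‖a + b‖⁴`, up to terms bounded by `‖a‖² ‖b‖²` and `‖b‖⁴`
      have hpt : ∀ p : X × (Fin M → X), ((centered μ z p.1 + centeredSum μ z p.2) ⬝ᵥ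
          (centered μ z p.1 + centeredSum μ z p.2)) ^ 2 ≤
          (centeredSum μ z p.2 ⬝ᵥ centeredSum μ z p.2) ^ 2 +
          4 * ((centeredSum μ z p.2 ⬝ᵥ centeredSum μ z p.2) * (centeredSum μ z p.2 ⬝ᵥ centered μ z p.1)) +
          8 * ((centeredSum μ z p.2 ⬝ᵥ centeredSum μ z p.2) * (centered μ z p.1 ⬝ᵥ centered μ z p.1)) +
          3 * (centered μ z p.1 ⬝ᵥ centered μ z p.1) ^ 2 := fun p => by
        rw [add_dotProduct, dotProduct_add, dotProduct_add,
            dotProduct_comm (centered μ z p.1) (centeredSum μ z p.2)]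
        have ha := dotProduct_self_nonneg' (centeredSum μ z p.2)
        have hb := dotProduct_self_nonneg' (centered μ z p.1)
        have ht := dotProduct_sq_le (centeredSum μ z p.2) (centered μ z p.1)
        set a := centeredSum μ z p.2 ⬝ᵥ centeredSum μ z p.2
        set b := centered μ z p.1 ⬝ᵥ centered μ z p.1
        set t := centeredSum μ z p.2 ⬝ᵥ centered μ z p.1
        have ht2 : t ≤ (a + b) / 2 := by
          apply le_of_sq_le_sq _ (by positivity)
          nlinarith [sq_nonneg (a - b)]
        nlinarith [mul_le_mul_of_nonneg_right ht2 hb]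
      refine (AllLp.integral_mono ?_ (by fun_prop) hpt).trans ?_
      · simp only [dotProduct, Pi.add_apply]; fun_prop
      simp (disch := fun_prop) only [AllLp.integral_add, integral_const_mul]
      rw [hcross (fun V => centeredSum μ z V ⬝ᵥ centeredSum μ z V) (by fun_prop),
        integral_fun_snd (f := fun V => (centeredSum μ z V ⬝ᵥ centeredSum μ z V) ^ 2)]
      push_cast
      simp only [probReal_univ, one_smul]
      nlinarith

end SampleMean

end Sampling

/-! ### Leave-one-out observables -/

section LeaveOneOut

variable {X : Type*} [MeasurableSpace X] {n M : ℕ} {μ : Measure X} [IsProbabilityMeasure μ]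
  {z : X → Fin n → ℝ} {c ν lam : ℝ}

/-- The normalized trace `ν⁻¹ Tr (S B)`. -/
def normTrace (ν : ℝ) (S B : Matrix (Fin n) (Fin n) ℝ) : ℝ := ν⁻¹ * (S * B).trace

/-- The resolvent of the sample `V`. -/
def sampleInv (ν lam : ℝ) (z : X → Fin n → ℝ) (V : Fin M → X) : Matrix (Fin n) (Fin n) ℝ :=
  (gram ν lam fun j => z (V j))⁻¹

/-- The features of the sample that is left out. -/
def leftOut (z : X → Fin n → ℝ) (p : X × (Fin M → X)) : Fin n → ℝ := z p.1

/-- The resolvent of the sample `p.2` together with the extra sample `p.1`. -/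
def fullInv (ν lam : ℝ) (z : X → Fin n → ℝ) (p : X × (Fin M → X)) : Matrix (Fin n) (Fin n) ℝ :=
  (gram ν lam (fun j => z (p.2 j)) + ν⁻¹ • Matrix.vecMulVec (z p.1) (z p.1))⁻¹

/-- The form `ν⁻¹ zᵀ H Q z`, where `z` is left out of the resolvent `Q`; for `H = 1` this is the
leverage of the sample that is left out. -/
def lev (ν lam : ℝ) (z : X → Fin n → ℝ) (H : Matrix (Fin n) (Fin n) ℝ) (p : X × (Fin M → X)) : ℝ :=
  ν⁻¹ * (leftOut z p ⬝ᵥ ((H * sampleInv ν lam z p.2) *ᵥ leftOut z p))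

/-- The factor `1 / (1 + κ)` by which a residual shrinks when its sample, of leverage `κ`, joins
the training set. -/
def shrink (ν lam : ℝ) (z : X → Fin n → ℝ) (p : X × (Fin M → X)) : ℝ := (1 + lev ν lam z 1 p)⁻¹

/-- The same factor, computed from the normalized trace of the full resolvent. The factor `1` in the
trace makes it the case `H = 1` of the traces in `fluct`. -/
def fullShrink (ν lam : ℝ) (S : Matrix (Fin n) (Fin n) ℝ) (z : X → Fin n → ℝ)
    (p : X × (Fin M → X)) : ℝ := (1 + normTrace ν S (1 * fullInv ν lam z p))⁻¹

/-- The fluctuation of `lev H / (1 + lev 1)` around its value computed from normalized traces of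
the full resolvent. -/
def fluct (ν lam : ℝ) (S : Matrix (Fin n) (Fin n) ℝ) (z : X → Fin n → ℝ)
    (H : Matrix (Fin n) (Fin n) ℝ) (p : X × (Fin M → X)) : ℝ :=
  normTrace ν S (H * fullInv ν lam z p) * fullShrink ν lam S z p -
    lev ν lam z H p * shrink ν lam z p

/-- The form `mᵀ Q m` of the resolvent at the feature mean `m`. -/
def meanForm (ν lam : ℝ) (μ : Measure X) (z : X → Fin n → ℝ) (V : Fin M → X) : ℝ :=
  meanVec μ z ⬝ᵥ (sampleInv ν lam z V *ᵥ meanVec μ z)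

lemma allLp_sampleInv (hz : ∀ i, AllLp (fun x => z x i) μ) (hν : 0 < ν) (hlam : 0 < lam)
    (i j : Fin n) :
    AllLp (fun V : Fin M → X => sampleInv ν lam z V i j) (Measure.pi fun _ => μ) :=
  AllLp.inv_gram (fun j i => allLp_sample hz j i) hν.le hlam i j

lemma allLp_sampleInv_snd (hz : ∀ i, AllLp (fun x => z x i) μ) (hν : 0 < ν) (hlam : 0 < lam)
    (i j : Fin n) :
    AllLp (fun p : X × (Fin M → X) => sampleInv ν lam z p.2 i j)
      (μ.prod (Measure.pi fun _ => μ)) :=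
  (allLp_sampleInv hz hν hlam i j).comp measurePreserving_snd

lemma allLp_leftOut (hz : ∀ i, AllLp (fun x => z x i) μ) (i : Fin n) :
    AllLp (fun p : X × (Fin M → X) => leftOut z p i) (μ.prod (Measure.pi fun _ => μ)) :=
  (hz i).comp measurePreserving_fst

lemma allLp_fullInv (hz : ∀ i, AllLp (fun x => z x i) μ) (hν : 0 < ν) (hlam : 0 < lam)
    (i j : Fin n) :
    AllLp (fun p : X × (Fin M → X) => fullInv ν lam z p i j)
      (μ.prod (Measure.pi fun _ => μ)) := by
  refine AllLp.inv (fun i j => ?_) hlam (fun p =>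
    (gram_coercive hν.le lam _).add_rank_one (inv_nonneg.2 hν.le) _) i j
  simp only [Matrix.add_apply, Matrix.smul_apply, Matrix.vecMulVec_apply, smul_eq_mul]
  exact (AllLp.gram (fun j i => (allLp_sample hz j i).comp measurePreserving_snd) ν lam i j).add
    (((allLp_leftOut hz i).mul (allLp_leftOut hz j)).const_mul _)

lemma AllLp.mul_const_matrix {Ω : Type*} [MeasurableSpace Ω] {P : Measure Ω} [IsFiniteMeasure P]
    {Q : Ω → Matrix (Fin n) (Fin n) ℝ} (hQ : ∀ i j, AllLp (fun ω => Q ω i j) P)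
    (H : Matrix (Fin n) (Fin n) ℝ) (i j : Fin n) : AllLp (fun ω => (H * Q ω) i j) P := by
  simp only [Matrix.mul_apply]
  fun_prop

lemma AllLp.normTrace {Ω : Type*} [MeasurableSpace Ω] {P : Measure Ω} [IsFiniteMeasure P]
    {Q : Ω → Matrix (Fin n) (Fin n) ℝ} (hQ : ∀ i j, AllLp (fun ω => Q ω i j) P)
    (ν : ℝ) (S H : Matrix (Fin n) (Fin n) ℝ) :
    AllLp (fun ω => normTrace ν S (H * Q ω)) P := by
  simp only [RidgeFeatures.normTrace, ← Matrix.mul_assoc, Matrix.trace, Matrix.diag]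
  exact (AllLp.sum fun i => AllLp.mul_const_matrix hQ _ i i).const_mul _

lemma allLp_meanForm (hz : ∀ i, AllLp (fun x => z x i) μ) (hν : 0 < ν) (hlam : 0 < lam) :
    AllLp (fun V : Fin M → X => meanForm ν lam μ z V) (Measure.pi fun _ => μ) := by
  have := allLp_sampleInv (M := M) hz hν hlam
  simp only [meanForm]
  fun_prop

lemma allLp_lev (hz : ∀ i, AllLp (fun x => z x i) μ) (hν : 0 < ν) (hlam : 0 < lam)
    (H : Matrix (Fin n) (Fin n) ℝ) :
    AllLp (fun p : X × (Fin M → X) => lev ν lam z H p) (μ.prod (Measure.pi fun _ => μ)) := by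
  have h1 := allLp_leftOut (M := M) hz
  have h2 := AllLp.mul_const_matrix (allLp_sampleInv_snd (M := M) hz hν hlam) H
  exact (AllLp.dotProduct h1 (AllLp.mulVec h2 h1)).const_mul _

omit [MeasurableSpace X] in
lemma sampleInv_posSemidef (hν : 0 < ν) (hlam : 0 < lam) (V : Fin M → X) :
    (sampleInv ν lam z V).PosSemidef :=
  (gram_coercive hν.le lam _).inv_posSemidef hlam

omit [MeasurableSpace X] in
lemma fullInv_posSemidef (hν : 0 < ν) (hlam : 0 < lam) (p : X × (Fin M → X)) :
    (fullInv ν lam z p).PosSemidef :=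
  ((gram_coercive hν.le lam _).add_rank_one (inv_nonneg.2 hν.le) _).inv_posSemidef hlam

lemma lev_one_nonneg (hν : 0 < ν) (hlam : 0 < lam) (p : X × (Fin M → X)) :
    0 ≤ lev ν lam z 1 p := by
  rw [lev, Matrix.one_mul]
  exact mul_nonneg (inv_nonneg.2 hν.le) ((sampleInv_posSemidef hν hlam _).form_nonneg _)

lemma normTrace_one_nonneg (hν : 0 < ν) {S B : Matrix (Fin n) (Fin n) ℝ} (hS : S.PosSemidef)
    (hB : B.PosSemidef) : 0 ≤ normTrace ν S (1 * B) := by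
  rw [normTrace, Matrix.one_mul]
  exact mul_nonneg (inv_nonneg.2 hν.le) (trace_mul_nonneg hS hB)

lemma allLp_shrink (hz : ∀ i, AllLp (fun x => z x i) μ) (hν : 0 < ν) (hlam : 0 < lam) :
    AllLp (fun p : X × (Fin M → X) => shrink ν lam z p) (μ.prod (Measure.pi fun _ => μ)) :=
  AllLp.inv_of_one_le ((AllLp.const 1).add (allLp_lev hz hν hlam 1)).1 fun p => by
    linarith [lev_one_nonneg (z := z) hν hlam p]

lemma allLp_fullShrink (hz : ∀ i, AllLp (fun x => z x i) μ) (hν : 0 < ν) (hlam : 0 < lam)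
    {S : Matrix (Fin n) (Fin n) ℝ} (hS : S.PosSemidef) :
    AllLp (fun p : X × (Fin M → X) => fullShrink ν lam S z p) (μ.prod (Measure.pi fun _ => μ)) :=
  AllLp.inv_of_one_le ((AllLp.const 1).add (AllLp.normTrace (allLp_fullInv hz hν hlam) ν S 1)).1
    fun p => by linarith [normTrace_one_nonneg hν hS (fullInv_posSemidef (z := z) hν hlam p)]

lemma allLp_fluct (hz : ∀ i, AllLp (fun x => z x i) μ) (hν : 0 < ν) (hlam : 0 < lam)
    {S : Matrix (Fin n) (Fin n) ℝ} (hS : S.PosSemidef) (H : Matrix (Fin n) (Fin n) ℝ) :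
    AllLp (fun p : X × (Fin M → X) => fluct ν lam S z H p) (μ.prod (Measure.pi fun _ => μ)) :=
  ((AllLp.normTrace (allLp_fullInv hz hν hlam) ν S H).mul (allLp_fullShrink hz hν hlam hS)).sub
    ((allLp_lev hz hν hlam H).mul (allLp_shrink hz hν hlam))

/-! ### The direction of the feature mean -/

/-- The second moment matrix, compressed by the resolvent, is bounded even if the feature mean is
not. -/
lemma Concentrated.form_inv_le {A : Matrix (Fin n) (Fin n) ℝ} (hz : Concentrated c μ z)
    (hlam : 0 < lam) (hA : Coercive lam A) (v : Fin n → ℝ) :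
    (A⁻¹ *ᵥ v) ⬝ᵥ (secondMoment μ z *ᵥ (A⁻¹ *ᵥ v)) ≤
      (c * lam⁻¹ + meanVec μ z ⬝ᵥ (A⁻¹ *ᵥ meanVec μ z)) * (v ⬝ᵥ (A⁻¹ *ᵥ v)) := by
  have h1 := hz.secondMoment_form_le (A⁻¹ *ᵥ v)
  have h2 := (hA.inv_posSemidef hlam).form_sq_le (meanVec μ z) v
  have h3 := hA.normSq_inv_le hlam v
  rw [dotProduct_comm (A⁻¹ *ᵥ v) (meanVec μ z)] at h1
  have h4 : (A⁻¹ *ᵥ v) ⬝ᵥ (A⁻¹ *ᵥ v) ≤ lam⁻¹ * (v ⬝ᵥ (A⁻¹ *ᵥ v)) := by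
    rwa [inv_mul_eq_div, le_div_iff₀ hlam, mul_comm]
  nlinarith [mul_le_mul_of_nonneg_left h4 hz.pos.le]

/-- A bound for the second moment of `mᵀ Q m`. -/
def meanFormBound (c lam Γ : ℝ) : ℝ := 32 + 8 * lam⁻¹ ^ 2 * (28 * (c * Γ) ^ 2 + 24 * c)

/-- The feature mean may be large, but the resolvent is small in the direction of the sample mean,
which is at a bounded distance from the mean. -/
lemma Concentrated.integral_meanForm_sq_le (hz : Concentrated c μ z) (hν : 0 < ν) (hlam : 0 < lam)
    {Γ : ℝ} (hM : 0 < M) (hνM : ν ≤ 2 * M) (hn : n ≤ Γ * M) :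
    ∫ V : Fin M → X, meanForm ν lam μ z V ^ 2 ∂(Measure.pi fun _ => μ) ≤
      meanFormBound c lam Γ := by
  have hD := allLp_centeredSum (M := M) hz.allLp
  have hM' : (0 : ℝ) < M := by exact_mod_cast hM
  have hM1 : (1 : ℝ) ≤ M := by exact_mod_cast hM
  have hc := hz.pos
  have hpt : ∀ V : Fin M → X, meanForm ν lam μ z V ^ 2 ≤ 32 + 8 * lam⁻¹ ^ 2 * (M : ℝ)⁻¹ ^ 4 *
      (centeredSum μ z V ⬝ᵥ centeredSum μ z V) ^ 2 := fun V => by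
    have h1 := form_inv_gram_le hν hlam hM hνM (fun j => z (V j)) (meanVec μ z)
    have h0 := (sampleInv_posSemidef (z := z) hν hlam V).form_nonneg (meanVec μ z)
    have h2 := pow_le_pow_left₀ h0 h1 2
    refine h2.trans ((add_sq_le_two _ _).trans (le_of_eq ?_))
    rw [centeredSum]
    simp only [centered]
    ring
  refine (AllLp.integral_mono ((allLp_meanForm hz.allLp hν hlam).pow 2) (by fun_prop) hpt).trans ?_
  simp (disch := fun_prop) only [AllLp.integral_add, integral_const_mul, integral_const,
    probReal_univ, one_smul]
  have h4 := (hz.integral_centeredSum_le M).2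
  rw [meanFormBound, mul_assoc]
  gcongr
  calc _ ≤ (M : ℝ)⁻¹ ^ 4 * (4 * M ^ 2 * (c * (Γ * M)) ^ 2 + 3 * M * (8 * (c * M ^ 3 +
        (c * (Γ * M)) ^ 2 * M))) := by
        refine mul_le_mul_of_nonneg_left (h4.trans ?_) (by positivity)
        have h5 : (c * n) ^ 2 ≤ (c * (Γ * M)) ^ 2 := by gcongr
        have h6 : c * 1 ≤ c * M ^ 3 := by
          gcongr; exact one_le_pow₀ hM1
        have h7 : (c * n) ^ 2 ≤ (c * (Γ * M)) ^ 2 * M :=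
          h5.trans (le_mul_of_one_le_right (sq_nonneg _) hM1)
        gcongr
        linarith
    _ = 28 * (c * Γ) ^ 2 + 24 * c := by
        field_simp
        ring

lemma meanFormBound_one_le (hc : 0 < c) {Γ : ℝ} : 1 ≤ meanFormBound c lam Γ := by
  have : 0 ≤ 8 * lam⁻¹ ^ 2 * (28 * (c * Γ) ^ 2 + 24 * c) := by positivity
  rw [meanFormBound]; linarith

lemma integral_meanForm_le (hz : ∀ i, AllLp (fun x => z x i) μ) (hν : 0 < ν) (hlam : 0 < lam)
    {R : ℝ} (hR1 : 1 ≤ R)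
    (hR : ∫ V : Fin M → X, meanForm ν lam μ z V ^ 2 ∂(Measure.pi fun _ => μ) ≤ R) :
    ∫ V : Fin M → X, meanForm ν lam μ z V ∂(Measure.pi fun _ => μ) ≤ R := by
  have h1 := (allLp_meanForm (M := M) hz hν hlam).sq_integral_le
  apply le_of_sq_le_sq _ (by linarith)
  nlinarith

/-! ### Concentration of the leverages -/

lemma abs_normTrace_le {S H B : Matrix (Fin n) (Fin n) ℝ} {L : ℝ} (hν : 0 < ν)
    (hH : Multiplier S H L) (hS : S.PosSemidef) (hB : B.PosSemidef) :
    |normTrace ν S (H * B)| ≤ L * normTrace ν S (1 * B) := by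
  rw [normTrace, normTrace, Matrix.one_mul, abs_mul, abs_of_pos (inv_pos.2 hν), mul_left_comm]
  exact mul_le_mul_of_nonneg_left (hH.abs_trace_le hS hB) (inv_nonneg.2 hν.le)

/-- Removing one sample changes the normalized traces of the resolvent by `O(1 / ν)`. -/
lemma Concentrated.abs_normTrace_sub_le (hz : Concentrated c μ z) (hν : 0 < ν) (hlam : 0 < lam)
    {H : Matrix (Fin n) (Fin n) ℝ} {L : ℝ} (hH : Multiplier (secondMoment μ z) H L)
    (p : X × (Fin M → X)) :
    |normTrace ν (secondMoment μ z) (H * fullInv ν lam z p) -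
      normTrace ν (secondMoment μ z) (H * sampleInv ν lam z p.2)| ≤
      L * (c * lam⁻¹ + meanForm ν lam μ z p.2) * ν⁻¹ := by
  have hA := gram_coercive hν.le lam (fun j => z (p.2 j))
  have hS := secondMoment_posSemidef hz.allLp
  have hκ := lev_one_nonneg (z := z) hν hlam p
  have hrho := hz.form_inv_le hlam hA (z p.1)
  have hκ' : ν⁻¹ * (z p.1 ⬝ᵥ (sampleInv ν lam z p.2 *ᵥ z p.1)) = lev ν lam z 1 p := by
    rw [lev, Matrix.one_mul]; rfl
  have hfull : fullInv ν lam z p = sampleInv ν lam z p.2 - (ν⁻¹ / (1 + lev ν lam z 1 p)) •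
      Matrix.vecMulVec (sampleInv ν lam z p.2 *ᵥ z p.1) (sampleInv ν lam z p.2 *ᵥ z p.1) := by
    rw [← hκ']; exact hA.inv_add_rank_one hlam (inv_nonneg.2 hν.le) (z p.1)
  change (sampleInv ν lam z p.2 *ᵥ z p.1) ⬝ᵥ (secondMoment μ z *ᵥ
    (sampleInv ν lam z p.2 *ᵥ z p.1)) ≤ (c * lam⁻¹ + meanForm ν lam μ z p.2) *
      (z p.1 ⬝ᵥ (sampleInv ν lam z p.2 *ᵥ z p.1)) at hrho
  rw [hfull]
  set a := sampleInv ν lam z p.2 *ᵥ z p.1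
  set S := secondMoment μ z
  set κ := lev ν lam z 1 p
  set ρ := c * lam⁻¹ + meanForm ν lam μ z p.2
  have hρ : 0 ≤ ρ := add_nonneg (mul_nonneg hz.pos.le (inv_nonneg.2 hlam.le))
    ((sampleInv_posSemidef hν hlam _).form_nonneg _)
  have h1 : |a ⬝ᵥ (S *ᵥ (H *ᵥ a))| ≤ L * (a ⬝ᵥ (S *ᵥ a)) := by
    apply abs_le_of_sq_le_sq _ (mul_nonneg hH.pos.le (hS.form_nonneg _))
    refine (hS.form_sq_le a (H *ᵥ a)).trans ?_
    nlinarith [hH.form_le a, hS.form_nonneg a]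
  have h2 : normTrace ν S (H * (sampleInv ν lam z p.2 - (ν⁻¹ / (1 + κ)) •
      Matrix.vecMulVec a a)) - normTrace ν S (H * sampleInv ν lam z p.2) =
      -(ν⁻¹ * (ν⁻¹ / (1 + κ)) * (a ⬝ᵥ (S *ᵥ (H *ᵥ a)))) := by
    rw [normTrace, normTrace, Matrix.mul_sub, Matrix.mul_sub, Matrix.trace_sub, Matrix.mul_smul,
      Matrix.mul_smul, Matrix.trace_smul, ← Matrix.mul_assoc, ← Matrix.mul_assoc,
      trace_mul_vecMulVec, ← Matrix.mulVec_mulVec, smul_eq_mul]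
    ring
  have hνi := inv_pos.2 hν
  rw [h2, abs_neg, abs_mul, abs_of_nonneg (by positivity)]
  calc ν⁻¹ * (ν⁻¹ / (1 + κ)) * |a ⬝ᵥ (S *ᵥ (H *ᵥ a))|
      ≤ ν⁻¹ * (ν⁻¹ / (1 + κ)) * (L * (ρ * (z p.1 ⬝ᵥ a))) := by
        gcongr
        exact h1.trans (mul_le_mul_of_nonneg_left hrho hH.pos.le)
    _ = L * ρ * ν⁻¹ * (κ / (1 + κ)) := by rw [← hκ']; ring
    -- the leverage `κ` is unbounded, but `κ / (1 + κ)` is not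
    _ ≤ L * ρ * ν⁻¹ * 1 := by
        have := hH.pos
        gcongr
        rw [div_le_one (by positivity)]; linarith
    _ = L * ρ * ν⁻¹ := mul_one _

/-- Given the other samples, the left-out sample is concentrated, so the bilinear form `lev` is close
to its mean, a normalized trace of the resolvent of the other samples. -/
lemma Concentrated.integral_lev_sub_sq_le (hz : Concentrated c μ z) (hν : 0 < ν) (hlam : 0 < lam)
    {H : Matrix (Fin n) (Fin n) ℝ} {L Γ R : ℝ} (hH : Multiplier (secondMoment μ z) H L)
    (hn : n ≤ Γ * ν) (hν1 : 1 ≤ ν) (hR1 : 1 ≤ R)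
    (hR : ∫ V : Fin M → X, meanForm ν lam μ z V ^ 2 ∂(Measure.pi fun _ => μ) ≤ R) :
    ∫ p : X × (Fin M → X), (lev ν lam z H p -
      normTrace ν (secondMoment μ z) (H * sampleInv ν lam z p.2)) ^ 2
        ∂(μ.prod (Measure.pi fun _ => μ)) ≤
      8 * c * (L ^ 2 + 1) ^ 2 * lam⁻¹ * (lam⁻¹ + lam⁻¹ * (c * Γ) + R) * ν⁻¹ := by
  have hzz := hz.allLp
  have hmf := allLp_meanForm (M := M) hzz hν hlam
  have hνi := inv_pos.2 hν
  have hli := inv_pos.2 hlam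
  have hc := hz.pos
  have hint := ((allLp_lev hzz hν hlam H).sub (AllLp.normTrace (allLp_sampleInv_snd (M := M)
    hzz hν hlam) ν (secondMoment μ z) H)).pow 2
  refine (integral_prod_le_of_inner (h := fun V => ν⁻¹ ^ 2 * (8 * c * (L ^ 2 + 1) ^ 2 * lam⁻¹ *
    (lam⁻¹ + (lam⁻¹ * (c * n) + meanForm ν lam μ z V)))) hint.integrable
    (AllLp.integrable (by fun_prop)) fun V => ?_).trans ?_
  · have hA := gram_coercive hν.le lam (fun j => z (V j))
    have h1 := hz.variance_mul_inv_le hlam hA hH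
    have h2 := hz.trace_le (hA.inv_posSemidef hlam) hli.le (hA.form_inv_le hlam)
    simp only [lev, normTrace, ← mul_sub, mul_pow, integral_const_mul]
    refine mul_le_mul_of_nonneg_left (h1.trans ?_) (by positivity)
    gcongr
    exact h2
  · have h3 := integral_meanForm_le hzz hν hlam hR1 hR
    simp (disch := fun_prop) only [AllLp.integral_add, integral_const_mul, integral_const,
      probReal_univ, one_smul]
    have h4 : lam⁻¹ + (lam⁻¹ * (c * n) + ∫ V : Fin M → X, meanForm ν lam μ z V
        ∂(Measure.pi fun _ => μ)) ≤ ν * (lam⁻¹ + lam⁻¹ * (c * Γ) + R) := by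
      have h5 : lam⁻¹ * (c * n) ≤ lam⁻¹ * (c * (Γ * ν)) := by gcongr
      have h6 : lam⁻¹ ≤ ν * lam⁻¹ := le_mul_of_one_le_left hli.le hν1
      have h7 : R ≤ ν * R := le_mul_of_one_le_left (by linarith) hν1
      nlinarith
    calc _ ≤ ν⁻¹ ^ 2 * (8 * c * (L ^ 2 + 1) ^ 2 * lam⁻¹ *
          (ν * (lam⁻¹ + lam⁻¹ * (c * Γ) + R))) := by gcongr
      _ = _ := by field_simp

/-- The constant in the bound for the fluctuations of the leverages. -/
def fluctBound (c lam Γ R L : ℝ) : ℝ :=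
  24 * L ^ 2 * (c ^ 2 * lam⁻¹ ^ 2 + R) +
    3 * (32 * L ^ 2 + 8 * (L ^ 2 + 1) ^ 2) * c * lam⁻¹ * (lam⁻¹ + lam⁻¹ * (c * Γ) + R)

/-- The quotients `T' / (1 + d')` and `η / (1 + κ)` are compared through a third one, `T / (1 + d)`,
whose numerator is at most a multiple of `d`. -/
lemma abs_mul_inv_sub_le {T T' d d' η κ L : ℝ} (hd : 0 ≤ d) (hd' : 0 ≤ d') (hκ : 0 ≤ κ)
    (hL : 0 ≤ L) (hT : |T| ≤ L * d) :
    |T' * (1 + d')⁻¹ - η * (1 + κ)⁻¹| ≤ (|T' - T| + L * |d' - d|) + (L * |κ - d| + |η - T|) := by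
  have key : ∀ a b : ℝ, 0 ≤ b → |a * (1 + b)⁻¹ - T * (1 + d)⁻¹| ≤ |a - T| + L * |b - d| :=
    fun a b hb => by
    have h1 : a * (1 + b)⁻¹ - T * (1 + d)⁻¹ = (a - T) * (1 + b)⁻¹ +
        (T * (1 + d)⁻¹) * ((d - b) * (1 + b)⁻¹) := by
      field_simp; ring
    have hb1 : |(1 + b)⁻¹| ≤ 1 := by
      rw [abs_of_nonneg (by positivity)]; exact inv_le_one_of_one_le₀ (by linarith)
    have h2 : |T * (1 + d)⁻¹| ≤ L := by
      rw [abs_mul, abs_of_nonneg (by positivity : 0 ≤ (1 + d)⁻¹), ← div_eq_mul_inv,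
        div_le_iff₀ (by positivity)]
      nlinarith
    rw [h1]
    refine (abs_add_le _ _).trans (add_le_add ?_ ?_)
    · rw [abs_mul]; exact mul_le_of_le_one_right (abs_nonneg _) hb1
    · rw [abs_mul, abs_mul (d - b), abs_sub_comm d b]
      exact mul_le_mul h2 (mul_le_of_le_one_right (abs_nonneg _) hb1) (by positivity) hL
  have h1 := key T' d' hd'
  have h2 := key η κ hκ
  rw [abs_sub_comm] at h2
  calc _ = |(T' * (1 + d')⁻¹ - T * (1 + d)⁻¹) + (T * (1 + d)⁻¹ - η * (1 + κ)⁻¹)| := by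
        congr 1; ring
    _ ≤ _ := (abs_add_le _ _).trans (by linarith)

lemma Concentrated.integral_fluct_sq_le (hz : Concentrated c μ z) (hν : 0 < ν) (hlam : 0 < lam)
    {H : Matrix (Fin n) (Fin n) ℝ} {L Γ R : ℝ} (hH : Multiplier (secondMoment μ z) H L)
    (hn : n ≤ Γ * ν) (hν1 : 1 ≤ ν) (hR1 : 1 ≤ R)
    (hR : ∫ V : Fin M → X, meanForm ν lam μ z V ^ 2 ∂(Measure.pi fun _ => μ) ≤ R) :
    ∫ p : X × (Fin M → X), fluct ν lam (secondMoment μ z) z H p ^ 2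
        ∂(μ.prod (Measure.pi fun _ => μ)) ≤ fluctBound c lam Γ R L * ν⁻¹ := by
  have hzz := hz.allLp
  have hS := secondMoment_posSemidef hzz
  set S := secondMoment μ z
  have hνi := inv_pos.2 hν
  have hL := hH.pos
  have hmf : AllLp (fun p : X × (Fin M → X) => meanForm ν lam μ z p.2)
      (μ.prod (Measure.pi fun _ => μ)) :=
    (allLp_meanForm (M := M) hzz hν hlam).comp measurePreserving_snd
  have hdiff : ∀ H' : Matrix (Fin n) (Fin n) ℝ, AllLp (fun p : X × (Fin M → X) =>
      (lev ν lam z H' p - normTrace ν S (H' * sampleInv ν lam z p.2)) ^ 2)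
      (μ.prod (Measure.pi fun _ => μ)) := fun H' =>
    ((allLp_lev hzz hν hlam H').sub (AllLp.normTrace (allLp_sampleInv_snd (M := M)
      hzz hν hlam) ν S H')).pow 2
  have hpt : ∀ p : X × (Fin M → X), fluct ν lam S z H p ^ 2 ≤
      12 * L ^ 2 * ν⁻¹ ^ 2 * (2 * (c * lam⁻¹) ^ 2 + 2 * meanForm ν lam μ z p.2 ^ 2) +
      3 * L ^ 2 * (lev ν lam z 1 p - normTrace ν S (1 * sampleInv ν lam z p.2)) ^ 2 +
      3 * (lev ν lam z H p - normTrace ν S (H * sampleInv ν lam z p.2)) ^ 2 := fun p => by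
    have hQ := sampleInv_posSemidef (z := z) hν hlam p.2
    have h1 := abs_mul_inv_sub_le (T' := normTrace ν S (H * fullInv ν lam z p))
      (η := lev ν lam z H p)
      (normTrace_one_nonneg hν hS hQ)
      (normTrace_one_nonneg hν hS (fullInv_posSemidef (z := z) hν hlam p))
      (lev_one_nonneg (z := z) hν hlam p) hL.le (abs_normTrace_le hν hH hS hQ)
    have h2 := hz.abs_normTrace_sub_le hν hlam hH p
    have h3 := hz.abs_normTrace_sub_le hν hlam (Multiplier.one S) p
    have hρ2 := add_sq_le_two (c * lam⁻¹) (meanForm ν lam μ z p.2)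
    set ρ := c * lam⁻¹ + meanForm ν lam μ z p.2
    change |fluct ν lam S z H p| ≤ _ at h1
    have h4 : |fluct ν lam S z H p| ≤ 2 * (L * ρ * ν⁻¹) +
        L * |lev ν lam z 1 p - normTrace ν S (1 * sampleInv ν lam z p.2)| +
        |lev ν lam z H p - normTrace ν S (H * sampleInv ν lam z p.2)| := by
      have := mul_le_mul_of_nonneg_left h3 hL.le
      linarith
    rw [← sq_abs (fluct ν lam S z H p), ← sq_abs (lev ν lam z 1 p - _),
      ← sq_abs (lev ν lam z H p - _)]
    set x := |lev ν lam z 1 p - normTrace ν S (1 * sampleInv ν lam z p.2)|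
    set y := |lev ν lam z H p - normTrace ν S (H * sampleInv ν lam z p.2)|
    calc |fluct ν lam S z H p| ^ 2 ≤ (2 * (L * ρ * ν⁻¹) + L * x + y) ^ 2 :=
          pow_le_pow_left₀ (abs_nonneg _) h4 2
      _ ≤ 12 * L ^ 2 * ν⁻¹ ^ 2 * ρ ^ 2 + 3 * L ^ 2 * x ^ 2 + 3 * y ^ 2 := by
          nlinarith [sq_nonneg (2 * (L * ρ * ν⁻¹) - L * x), sq_nonneg (2 * (L * ρ * ν⁻¹) - y),
            sq_nonneg (L * x - y)]
      _ ≤ _ := by gcongr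
  have hl := allLp_lev (M := M) hzz hν hlam
  have hT := AllLp.normTrace (allLp_sampleInv_snd (M := M) hzz hν hlam) ν S
  refine (AllLp.integral_mono ((allLp_fluct hzz hν hlam hS H).pow 2) (by fun_prop) hpt).trans ?_
  simp (disch := fun_prop) only [AllLp.integral_add, integral_const_mul, integral_const,
    probReal_univ, one_smul]
  have h1 := hz.integral_lev_sub_sq_le hν hlam hH hn hν1 hR1 hR
  have h2 := hz.integral_lev_sub_sq_le hν hlam (Multiplier.one S) hn hν1 hR1 hR
  rw [integral_fun_snd (f := fun V => meanForm ν lam μ z V ^ 2), probReal_univ, one_smul]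
  have h3 : ν⁻¹ ^ 2 ≤ ν⁻¹ := by
    rw [sq]; exact mul_le_of_le_one_left hνi.le (inv_le_one_of_one_le₀ hν1)
  have h4 : 12 * L ^ 2 * ν⁻¹ ^ 2 * (2 * (c * lam⁻¹) ^ 2 +
      2 * ∫ V : Fin M → X, meanForm ν lam μ z V ^ 2 ∂(Measure.pi fun _ => μ)) ≤
      12 * L ^ 2 * ν⁻¹ * (2 * (c * lam⁻¹) ^ 2 + 2 * R) := by
    have : 0 ≤ ∫ V : Fin M → X, meanForm ν lam μ z V ^ 2 ∂(Measure.pi fun _ => μ) :=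
      integral_nonneg fun _ => sq_nonneg _
    gcongr
  calc _ ≤ 12 * L ^ 2 * ν⁻¹ * (2 * (c * lam⁻¹) ^ 2 + 2 * R) +
        3 * L ^ 2 * (8 * c * (1 ^ 2 + 1) ^ 2 * lam⁻¹ * (lam⁻¹ + lam⁻¹ * (c * Γ) + R) * ν⁻¹) +
        3 * (8 * c * (L ^ 2 + 1) ^ 2 * lam⁻¹ * (lam⁻¹ + lam⁻¹ * (c * Γ) + R) * ν⁻¹) := by
        gcongr
    _ = fluctBound c lam Γ R L * ν⁻¹ := by rw [fluctBound]; ring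

end LeaveOneOut

/-! ### The deterministic resolvent -/

section DeterministicEquivalent

variable {n : ℕ} {S : Matrix (Fin n) (Fin n) ℝ} {lam d : ℝ}

lemma qBar_coercive (hS : S.PosSemidef) (hd : 0 ≤ d) :
    Coercive lam ((1 + d)⁻¹ • S + lam • (1 : Matrix (Fin n) (Fin n) ℝ)) :=
  coercive_add (hS.smul (by positivity))

lemma qBar_posSemidef (hS : S.PosSemidef) (hlam : 0 < lam) (hd : 0 ≤ d) :
    (qBar S lam d).PosSemidef :=
  (qBar_coercive hS hd).inv_posSemidef hlam

lemma smul_mul_qBar_add (hS : S.PosSemidef) (hlam : 0 < lam) (hd : 0 ≤ d) :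
    (1 + d)⁻¹ • (S * qBar S lam d) + lam • qBar S lam d = 1 := by
  have := (qBar_coercive (lam := lam) hS hd).mul_inv hlam
  rwa [Matrix.add_mul, Matrix.smul_mul, Matrix.smul_mul, Matrix.one_mul] at this

lemma mul_qBar_comm (hS : S.PosSemidef) (hlam : 0 < lam) (hd : 0 ≤ d) :
    S * qBar S lam d = qBar S lam d * S := by
  have h1 := smul_mul_qBar_add hS hlam hd
  have h2 := (qBar_coercive (lam := lam) hS hd).inv_mul hlam
  rw [Matrix.mul_add, Matrix.mul_smul, Matrix.mul_smul, Matrix.mul_one] at h2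
  have h3 : (1 + d)⁻¹ • (S * qBar S lam d) = (1 + d)⁻¹ • (qBar S lam d * S) :=
    add_right_cancel (h1.trans h2.symm)
  exact smul_right_injective _ (by positivity : (1 + d)⁻¹ ≠ 0) h3

lemma mul_qBar_symm (hS : S.PosSemidef) (hlam : 0 < lam) (hd : 0 ≤ d) :
    (S * qBar S lam d)ᵀ = S * qBar S lam d := by
  rw [Matrix.transpose_mul, hS.transpose_eq, (qBar_posSemidef hS hlam hd).transpose_eq,
    mul_qBar_comm hS hlam hd]

/-- `S (S / (1 + d) + lam)⁻¹` is a contraction up to the factor `1 + d`. -/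
lemma multiplier_mul_qBar (hS : S.PosSemidef) (hlam : 0 < lam) (hd : 0 ≤ d) :
    Multiplier S (S * qBar S lam d) (1 + d) := by
  -- both norms of `a` are expanded along this decomposition, whose cross terms are nonnegative
  have hdec : ∀ a, a = (1 + d)⁻¹ • ((S * qBar S lam d) *ᵥ a) + lam • (qBar S lam d *ᵥ a) :=
    fun a => by
    rw [← Matrix.smul_mulVec, ← Matrix.smul_mulVec, ← Matrix.add_mulVec,
      smul_mul_qBar_add hS hlam hd, Matrix.one_mulVec]
  have hd1 : 0 < 1 + d := by positivity
  refine ⟨mul_qBar_symm hS hlam hd, hd1, fun a => ?_, fun a => ?_⟩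
  · have h := form_add_smul (A := (1 : Matrix (Fin n) (Fin n) ℝ)) (by simp)
      ((1 + d)⁻¹ • ((S * qBar S lam d) *ᵥ a)) (qBar S lam d *ᵥ a) lam
    simp only [Matrix.one_mulVec] at h
    rw [← hdec a] at h
    have h1 : 0 ≤ (S * qBar S lam d) *ᵥ a ⬝ᵥ qBar S lam d *ᵥ a := by
      rw [← Matrix.mulVec_mulVec, dotProduct_comm]
      exact hS.form_nonneg _
    have h2 := dotProduct_self_nonneg' (qBar S lam d *ᵥ a)
    rw [h]
    simp only [smul_dotProduct, dotProduct_smul, smul_eq_mul]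
    have h3 : (1 + d) ^ 2 * ((1 + d)⁻¹ * ((1 + d)⁻¹ *
        ((S * qBar S lam d) *ᵥ a ⬝ᵥ (S * qBar S lam d) *ᵥ a))) =
        (S * qBar S lam d) *ᵥ a ⬝ᵥ (S * qBar S lam d) *ᵥ a := by field_simp
    rw [mul_add, mul_add, h3]
    have h4 : 0 ≤ (1 + d) ^ 2 * (2 * lam * ((1 + d)⁻¹ *
      ((S * qBar S lam d) *ᵥ a ⬝ᵥ qBar S lam d *ᵥ a))) := by positivity
    have h5 : 0 ≤ (1 + d) ^ 2 * (lam ^ 2 * (qBar S lam d *ᵥ a ⬝ᵥ qBar S lam d *ᵥ a)) := by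
      positivity
    linarith
  · have h := form_add_smul hS.transpose_eq
      ((1 + d)⁻¹ • ((S * qBar S lam d) *ᵥ a)) (qBar S lam d *ᵥ a) lam
    rw [← hdec a] at h
    have h1 : 0 ≤ (S * qBar S lam d) *ᵥ a ⬝ᵥ (S *ᵥ (qBar S lam d *ᵥ a)) := by
      rw [← Matrix.mulVec_mulVec]
      exact dotProduct_self_nonneg' _
    have h2 := hS.form_nonneg (qBar S lam d *ᵥ a)
    rw [h]
    simp only [smul_dotProduct, dotProduct_smul, smul_eq_mul, Matrix.mulVec_smul]
    have h3 : (1 + d) ^ 2 * ((1 + d)⁻¹ * ((1 + d)⁻¹ *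
        ((S * qBar S lam d) *ᵥ a ⬝ᵥ (S *ᵥ ((S * qBar S lam d) *ᵥ a))))) =
        (S * qBar S lam d) *ᵥ a ⬝ᵥ (S *ᵥ ((S * qBar S lam d) *ᵥ a)) := by field_simp
    rw [mul_add, mul_add, h3]
    have h4 : 0 ≤ (1 + d) ^ 2 * (2 * lam * ((1 + d)⁻¹ *
      ((S * qBar S lam d) *ᵥ a ⬝ᵥ (S *ᵥ (qBar S lam d *ᵥ a))))) := by positivity
    have h5 : 0 ≤ (1 + d) ^ 2 * (lam ^ 2 * (qBar S lam d *ᵥ a ⬝ᵥ (S *ᵥ (qBar S lam d *ᵥ a)))) := by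
      positivity
    linarith

/-- `α` is the normalized trace of `S (S Q̄) Q̄`, up to the factor `(1 + δ)²`. -/
lemma alpha_eq (N : ℕ) (hS : S.PosSemidef) (hlam : 0 < lam) (hd : 0 ≤ d) :
    alpha N S lam d = normTrace N S ((S * qBar S lam d) * qBar S lam d) * ((1 + d)⁻¹) ^ 2 := by
  have h1 : frobeniusSq (((1 + d)⁻¹ • S) * qBar S lam d) =
      ((1 + d)⁻¹) ^ 2 * (S * ((S * qBar S lam d) * qBar S lam d)).trace := by
    have h2 : S * ((S * qBar S lam d) * qBar S lam d) =
        (S * qBar S lam d) * (S * qBar S lam d)ᵀ := by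
      rw [mul_qBar_symm hS hlam hd]
      conv_lhs => rw [mul_qBar_comm hS hlam hd]
      simp only [Matrix.mul_assoc]
    rw [h2, frobeniusSq, Matrix.smul_mul]
    simp only [Matrix.smul_apply, smul_eq_mul, mul_pow, Matrix.trace, Matrix.diag,
      Matrix.mul_apply (M := S * qBar S lam d), Matrix.transpose_apply, Finset.mul_sum]
    refine Finset.sum_congr rfl fun i _ => Finset.sum_congr rfl fun j _ => ?_
    ring
  rw [alpha, normTrace, h1]
  ring

lemma isDelta_eq_normTrace {N : ℕ} (hδ : IsDelta N S lam d) :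
    normTrace N S (1 * qBar S lam d) = d := by
  rw [normTrace, Matrix.one_mul]; exact hδ.2.symm

end DeterministicEquivalent

/-! ### The leverages concentrate at the fixed point -/

section Concentration

variable {X : Type*} [MeasurableSpace X] {n M : ℕ} {μ : Measure X} [IsProbabilityMeasure μ]
  {z : X → Fin n → ℝ} {c ν lam : ℝ}

/-- The error in the first-order equation satisfied by the normalized trace of `D` times the
resolvent, relative to `Q̄`, where `H = D S Q̄`. -/
def traceErr (ν lam : ℝ) (S : Matrix (Fin n) (Fin n) ℝ) (z : X → Fin n → ℝ) (δ : ℝ)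
    (D H : Matrix (Fin n) (Fin n) ℝ) (p : X × (Fin M → X)) : ℝ :=
  normTrace ν S (D * fullInv ν lam z p) - normTrace ν S (D * qBar S lam δ) -
    normTrace ν S (H * fullInv ν lam z p) * ((1 + δ)⁻¹ - fullShrink ν lam S z p)

omit [MeasurableSpace X] in
lemma fullInv_removeNth (U : Fin (M + 1) → X) (i : Fin (M + 1)) :
    fullInv ν lam z (U i, fun j => U (i.succAbove j)) = sampleInv ν lam z U := by
  rw [fullInv, sampleInv, gram_succAbove ν lam (fun j => z (U j)) i]

omit [MeasurableSpace X] in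
lemma fullInv_mulVec_leftOut (hν : 0 < ν) (hlam : 0 < lam) (p : X × (Fin M → X)) :
    fullInv ν lam z p *ᵥ leftOut z p =
      shrink ν lam z p • (sampleInv ν lam z p.2 *ᵥ leftOut z p) := by
  rw [shrink, lev, Matrix.one_mul]
  exact (gram_coercive hν.le lam _).inv_add_rank_one_mulVec_self hlam (inv_nonneg.2 hν.le) _

/-- The resolvent identity, expanded over the samples: the error is an average of leave-one-out
fluctuations. -/
lemma traceErr_removeNth {S D H : Matrix (Fin n) (Fin n) ℝ} {δ : ℝ} (hS : S.PosSemidef)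
    (hlam : 0 < lam) (hδ : 0 ≤ δ) (hH : Hᵀ = H) (h1 : D * qBar S lam δ * S = H)
    (h2 : S * D * qBar S lam δ = H) (hν : ν = (M + 1 : ℕ)) (U : Fin (M + 1) → X)
    (k : Fin (M + 1)) :
    traceErr ν lam S z δ D H (U k, fun j => U (k.succAbove j)) =
      ν⁻¹ * ∑ i, fluct ν lam S z H (U i, fun j => U (i.succAbove j)) := by
  have hν0 : 0 < ν := by rw [hν]; positivity
  have hA := gram_coercive hν0.le lam (fun j => z (U j))
  have hB := qBar_coercive (lam := lam) hS hδ
  have hfs : ∀ i : Fin (M + 1), fullShrink ν lam S z (U i, fun j => U (i.succAbove j)) =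
      fullShrink ν lam S z (U k, fun j => U (k.succAbove j)) := fun i => by
    rw [fullShrink, fullShrink, fullInv_removeNth, fullInv_removeNth]
  simp only [fluct, hfs, traceErr]
  simp only [fullInv_removeNth, Finset.sum_sub_distrib, Finset.sum_const, Finset.card_univ,
    Fintype.card_fin]
  have hterm : ∀ i : Fin (M + 1), lev ν lam z H (U i, fun j => U (i.succAbove j)) *
      shrink ν lam z (U i, fun j => U (i.succAbove j)) =
      ν⁻¹ * (z (U i) ⬝ᵥ ((sampleInv ν lam z U * H) *ᵥ z (U i))) := fun i => by
    have h3 := fullInv_mulVec_leftOut (z := z) hν0 hlam (U i, fun j => U (i.succAbove j))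
    rw [fullInv_removeNth] at h3
    have h4 : (sampleInv ν lam z U)ᵀ = sampleInv ν lam z U := hA.inv_symm
    rw [← Matrix.mulVec_mulVec, dotProduct_mulVec_comm h4]
    change _ = ν⁻¹ * ((H *ᵥ z (U i)) ⬝ᵥ (sampleInv ν lam z U *ᵥ
      leftOut z (U i, fun j => U (i.succAbove j))))
    rw [h3, dotProduct_smul, smul_eq_mul, lev, ← Matrix.mulVec_mulVec, dotProduct_mulVec_comm hH,
      dotProduct_comm (H *ᵥ z (U i))]
    change ν⁻¹ * (_ ⬝ᵥ (H *ᵥ z (U i))) * _ = _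
    ring
  simp only [hterm]
  have hres : sampleInv ν lam z U - qBar S lam δ = qBar S lam δ *
      ((1 + δ)⁻¹ • S - ν⁻¹ • ∑ j, Matrix.vecMulVec (z (U j)) (z (U j))) * sampleInv ν lam z U := by
    have := hA.inv_sub_inv hB hlam hlam
    rw [gram, add_sub_add_right_eq_sub] at this
    exact this
  have htr : (S * (D * sampleInv ν lam z U)).trace - (S * (D * qBar S lam δ)).trace =
      (1 + δ)⁻¹ * (S * (H * sampleInv ν lam z U)).trace -
      ν⁻¹ * ∑ i, z (U i) ⬝ᵥ ((sampleInv ν lam z U * H) *ᵥ z (U i)) := by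
    rw [← Matrix.trace_sub, ← Matrix.mul_sub, ← Matrix.mul_sub, hres]
    rw [Matrix.mul_sub, Matrix.sub_mul, Matrix.mul_sub, Matrix.mul_sub, Matrix.trace_sub]
    congr 1
    · rw [Matrix.mul_smul, Matrix.smul_mul, Matrix.mul_smul, Matrix.mul_smul, Matrix.trace_smul,
        smul_eq_mul, ← h1]
      simp only [Matrix.mul_assoc]
    · rw [Matrix.mul_smul, Matrix.smul_mul, Matrix.mul_smul, Matrix.mul_smul, Matrix.trace_smul,
        smul_eq_mul]
      congr 1
      have : S * (D * (qBar S lam δ * (∑ j, Matrix.vecMulVec (z (U j)) (z (U j))) *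
          sampleInv ν lam z U)) = H * (∑ j, Matrix.vecMulVec (z (U j)) (z (U j))) *
          sampleInv ν lam z U := by
        rw [← h2]; simp only [Matrix.mul_assoc]
      rw [this, Matrix.trace_mul_comm, ← Matrix.mul_assoc, Finset.mul_sum, Matrix.trace_sum]
      exact Finset.sum_congr rfl fun i _ => trace_mul_vecMulVec _ _ _
  have hνn : ν⁻¹ * ((M + 1 : ℕ) : ℝ) = 1 := by rw [hν]; exact inv_mul_cancel₀ (by positivity)
  simp only [normTrace, nsmul_eq_mul]
  rw [← mul_sub, htr, ← Finset.mul_sum]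
  linear_combination (-(ν⁻¹ * (S * (H * sampleInv ν lam z U)).trace *
    fullShrink ν lam S z (U k, fun j => U (k.succAbove j)))) * hνn

lemma allLp_traceErr (hz : ∀ i, AllLp (fun x => z x i) μ) (hν : 0 < ν) (hlam : 0 < lam)
    {S : Matrix (Fin n) (Fin n) ℝ} (hS : S.PosSemidef) (δ : ℝ) (D H : Matrix (Fin n) (Fin n) ℝ) :
    AllLp (fun p : X × (Fin M → X) => traceErr ν lam S z δ D H p)
      (μ.prod (Measure.pi fun _ => μ)) :=
  ((AllLp.normTrace (allLp_fullInv hz hν hlam) ν S D).sub (.const _)).sub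
    ((AllLp.normTrace (allLp_fullInv hz hν hlam) ν S H).mul
      ((AllLp.const _).sub (allLp_fullShrink hz hν hlam hS)))

/-- Jensen's inequality for the average in `traceErr_removeNth`; all samples contribute equally. -/
lemma integral_traceErr_sq_le (hz : ∀ i, AllLp (fun x => z x i) μ)
    {S D H : Matrix (Fin n) (Fin n) ℝ} {δ : ℝ} (hS : S.PosSemidef)
    (hlam : 0 < lam) (hδ : 0 ≤ δ) (hH : Hᵀ = H) (h1 : D * qBar S lam δ * S = H)
    (h2 : S * D * qBar S lam δ = H) (hν : ν = (M + 1 : ℕ)) :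
    ∫ p : X × (Fin M → X), traceErr ν lam S z δ D H p ^ 2 ∂(μ.prod (Measure.pi fun _ => μ)) ≤
      ∫ p : X × (Fin M → X), fluct ν lam S z H p ^ 2 ∂(μ.prod (Measure.pi fun _ => μ)) := by
  have hν0 : 0 < ν := by rw [hν]; positivity
  have hf : ∀ i : Fin (M + 1), AllLp (fun U : Fin (M + 1) → X =>
      fluct ν lam S z H (U i, fun j => U (i.succAbove j))) (Measure.pi fun _ => μ) := fun i =>
    (allLp_fluct hz hν0 hlam hS H).comp (measurePreserving_removeNth μ i)
  have hνn : ν⁻¹ * ((M + 1 : ℕ) : ℝ) = 1 := by rw [hν]; exact inv_mul_cancel₀ (by positivity)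
  rw [← integral_removeNth 0 fun p => traceErr ν lam S z δ D H p ^ 2]
  calc _ ≤ ∫ U : Fin (M + 1) → X, ν⁻¹ * ∑ i, fluct ν lam S z H
        (U i, fun j => U (i.succAbove j)) ^ 2 ∂(Measure.pi fun _ => μ) := by
        refine AllLp.integral_mono (((allLp_traceErr hz hν0 hlam hS δ D H).comp
          (measurePreserving_removeNth μ 0)).pow 2)
          ((AllLp.sum fun i => (hf i).pow 2).const_mul _) fun U => ?_
        rw [traceErr_removeNth hS hlam hδ hH h1 h2 hν U 0, mul_pow]
        have h4 := sq_sum_le_card_mul_sum_sq (s := Finset.univ)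
          (f := fun i => fluct ν lam S z H (U i, fun j => U (i.succAbove j)))
        rw [Finset.card_univ, Fintype.card_fin] at h4
        calc _ ≤ ν⁻¹ ^ 2 * (((M + 1 : ℕ) : ℝ) * ∑ i, fluct ν lam S z H
              (U i, fun j => U (i.succAbove j)) ^ 2) := by gcongr
          _ = ν⁻¹ * (ν⁻¹ * ((M + 1 : ℕ) : ℝ)) * ∑ i, fluct ν lam S z H
              (U i, fun j => U (i.succAbove j)) ^ 2 := by ring
          _ = _ := by rw [hνn, mul_one]
    _ = ν⁻¹ * ∑ i : Fin (M + 1), ∫ p : X × (Fin M → X), fluct ν lam S z H p ^ 2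
          ∂(μ.prod (Measure.pi fun _ => μ)) := by
        rw [integral_const_mul, AllLp.integral_sum fun i => (hf i).pow 2]
        congr 1
        exact Finset.sum_congr rfl fun i _ => integral_removeNth i fun p => fluct ν lam S z H p ^ 2
    _ = _ := by
        rw [Finset.sum_const, Finset.card_univ, Fintype.card_fin, nsmul_eq_mul, ← mul_assoc, hνn,
          one_mul]

lemma fluctBound_mono {Γ R L L' : ℝ} (hc : 0 < c) (hlam : 0 < lam) (hΓ : 0 ≤ Γ) (hR : 0 ≤ R)
    (hL : 0 ≤ L) (h : L ≤ L') : fluctBound c lam Γ R L ≤ fluctBound c lam Γ R L' := by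
  have := inv_pos.2 hlam
  rw [fluctBound, fluctBound]
  gcongr

lemma fluctBound_nonneg {Γ R L : ℝ} (hc : 0 < c) (hlam : 0 < lam) (hΓ : 0 ≤ Γ) (hR : 0 ≤ R) :
    0 ≤ fluctBound c lam Γ R L := by
  have := inv_pos.2 hlam
  rw [fluctBound]
  positivity

/-- The fixed-point equation is stable: its error controls the distance of the normalized trace to
`δ`. -/
lemma abs_fullShrink_sub_le {S : Matrix (Fin n) (Fin n) ℝ} (hS : S.PosSemidef) (hν : 0 < ν)
    (hlam : 0 < lam) {δ : ℝ} (hδ : 0 ≤ δ) (hfix : normTrace ν S (1 * qBar S lam δ) = δ)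
    (p : X × (Fin M → X)) :
    |fullShrink ν lam S z p - (1 + δ)⁻¹| ≤
      |traceErr ν lam S z δ 1 (S * qBar S lam δ) p| := by
  have hQ := fullInv_posSemidef (z := z) hν hlam p
  have hd := normTrace_one_nonneg hν hS hQ
  have hT := abs_normTrace_le hν (multiplier_mul_qBar hS hlam hδ) hS hQ
  rw [traceErr, fullShrink, hfix]
  set d := normTrace ν S (1 * fullInv ν lam z p)
  set T := normTrace ν S (S * qBar S lam δ * fullInv ν lam z p)
  have h1 : d - δ - T * ((1 + δ)⁻¹ - (1 + d)⁻¹) =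
      ((1 + d)⁻¹ - (1 + δ)⁻¹) * (T - (1 + d) * (1 + δ)) := by
    field_simp; ring
  -- `T ≤ (1 + δ) d`, so the second factor is at least `1` in absolute value
  rw [h1, abs_mul]
  refine le_mul_of_one_le_right (abs_nonneg _) ?_
  rw [abs_sub_comm]
  refine le_trans ?_ (le_abs_self _)
  nlinarith [le_abs_self T]

lemma fluct_one_eq {S : Matrix (Fin n) (Fin n) ℝ} (hS : S.PosSemidef) (hν : 0 < ν)
    (hlam : 0 < lam) (p : X × (Fin M → X)) :
    fluct ν lam S z 1 p = shrink ν lam z p - fullShrink ν lam S z p := by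
  have hd := normTrace_one_nonneg hν hS (fullInv_posSemidef (z := z) hν hlam p)
  have hκ := lev_one_nonneg (z := z) hν hlam p
  rw [fluct, shrink, fullShrink]
  field_simp
  ring

lemma shrink_nonneg (hν : 0 < ν) (hlam : 0 < lam) (p : X × (Fin M → X)) :
    0 ≤ shrink ν lam z p :=
  inv_nonneg.2 (by linarith [lev_one_nonneg (z := z) hν hlam p])

lemma shrink_le_one (hν : 0 < ν) (hlam : 0 < lam) (p : X × (Fin M → X)) :
    shrink ν lam z p ≤ 1 :=
  inv_le_one_of_one_le₀ (by linarith [lev_one_nonneg (z := z) hν hlam p])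

/-- The deviation of the leave-one-out coefficient of the squared residual from `α`. -/
lemma abs_lev_mul_shrink_sq_sub_le {N : ℕ} {S : Matrix (Fin n) (Fin n) ℝ} (hS : S.PosSemidef)
    (hN : 0 < N) (hlam : 0 < lam) {δ Λ : ℝ} (hδ : IsDelta N S lam δ) (hΛ : 1 + δ ≤ Λ)
    (p : X × (Fin M → X)) :
    |lev N lam z (S * qBar S lam δ) p * shrink N lam z p ^ 2 - alpha N S lam δ| ≤
      |fluct N lam S z (S * qBar S lam δ) p| +
      |traceErr N lam S z δ (S * qBar S lam δ) (S * qBar S lam δ * (S * qBar S lam δ)) p| +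
      3 * Λ ^ 2 * |traceErr N lam S z δ 1 (S * qBar S lam δ) p| +
      Λ * |fluct N lam S z 1 p| := by
  have hδ0 := hδ.1
  have hν : (0 : ℝ) < N := by exact_mod_cast hN
  have hfix := isDelta_eq_normTrace hδ
  have hQ := fullInv_posSemidef (z := z) hν hlam p
  have hd := normTrace_one_nonneg hν hS hQ
  have hG := multiplier_mul_qBar hS hlam hδ0
  have hT := abs_normTrace_le hν hG hS (qBar_posSemidef hS hlam hδ0)
  have hT2 := abs_normTrace_le hν hG.sq hS hQ
  have he := abs_fullShrink_sub_le (z := z) hS hν hlam hδ0 hfix p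
  have hf1 := fluct_one_eq (z := z) hS hν hlam p
  have hs0 := shrink_nonneg (z := z) hν hlam p
  have hs1 := shrink_le_one (z := z) hν hlam p
  rw [hfix] at hT
  rw [alpha_eq N hS hlam hδ0]
  have hfsd : fullShrink N lam S z p * (1 + normTrace N S (1 * fullInv N lam z p)) = 1 :=
    inv_mul_cancel₀ (by positivity)
  have hfG : fluct N lam S z (S * qBar S lam δ) p =
      normTrace N S (S * qBar S lam δ * fullInv N lam z p) * fullShrink N lam S z p -
      lev N lam z (S * qBar S lam δ) p * shrink N lam z p := rfl
  have heG : traceErr N lam S z δ (S * qBar S lam δ)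
      (S * qBar S lam δ * (S * qBar S lam δ)) p =
      normTrace N S (S * qBar S lam δ * fullInv N lam z p) -
      normTrace N S (S * qBar S lam δ * qBar S lam δ) -
      normTrace N S (S * qBar S lam δ * (S * qBar S lam δ) * fullInv N lam z p) *
        ((1 + δ)⁻¹ - fullShrink N lam S z p) := rfl
  have hfs0 : 0 ≤ fullShrink N lam S z p := inv_nonneg.2 (by linarith)
  set G := S * qBar S lam δ
  set e1 := traceErr N lam S z δ 1 G p
  set eG := traceErr N lam S z δ G (G * G) p
  set f1 := fluct N lam S z 1 p
  set fG := fluct N lam S z G p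
  set s := shrink N lam z p
  set fs := fullShrink N lam S z p
  set τ := normTrace N S (G * fullInv N lam z p)
  set τb := normTrace N S (G * qBar S lam δ)
  set τ2 := normTrace N S (G * G * fullInv N lam z p)
  set η := lev N lam z G p
  set d := normTrace N S (1 * fullInv N lam z p)
  set u := (1 + δ)⁻¹ with hu
  have hΛ1 : 1 ≤ Λ := by linarith
  have hfs1 : fs ≤ 1 := by nlinarith
  have hu0 : 0 ≤ u := by positivity
  have huδ : u * (1 + δ) = 1 := inv_mul_cancel₀ (by positivity)
  have hu1 : u ≤ 1 := by nlinarith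
  have hτu : |τb * u| ≤ Λ := by
    rw [abs_mul, abs_of_nonneg hu0]
    calc |τb| * u ≤ ((1 + δ) * δ) * u := by gcongr
      _ = δ := by linear_combination δ * huδ
      _ ≤ Λ := by linarith
  have hτb : |τb| ≤ Λ ^ 2 := hT.trans (by nlinarith)
  have hτ2 : |τ2 * fs| ≤ Λ ^ 2 := by
    rw [abs_mul, abs_of_nonneg hfs0]
    calc |τ2| * fs ≤ ((1 + δ) ^ 2 * d) * fs := by gcongr
      _ = (1 + δ) ^ 2 * (1 - fs) := by linear_combination (1 + δ) ^ 2 * hfsd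
      _ ≤ Λ ^ 2 := by nlinarith [sq_nonneg (1 + δ)]
  -- `η s`, `τ` and the factors `fs` and `s` are replaced in turn by their equivalents
  have key : η * s ^ 2 - τb * u ^ 2 =
      -fG * s + eG * (fs * s) + (τ2 * fs) * ((u - fs) * s) + τb * ((fs - u) * s) +
      (τb * u) * (f1 + (fs - u)) := by
    rw [hf1]
    have h1 : η * s = τ * fs - fG := by linarith
    have h2 : τ - τb = eG + τ2 * (u - fs) := by linarith
    calc η * s ^ 2 - τb * u ^ 2 = (η * s) * s - τb * u ^ 2 := by ring
      _ = -fG * s + ((τ - τb) * fs + τb * (fs - u)) * s + (τb * u) * (s - u) := by rw [h1]; ring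
      _ = _ := by rw [h2]; ring
  have he1 : |fs - u| ≤ |e1| := he
  have he1' : |u - fs| ≤ |e1| := by rw [abs_sub_comm]; exact he
  rw [key]
  have b1 : |-fG * s| ≤ |fG| := by
    rw [abs_mul, abs_neg, abs_of_nonneg hs0]; exact mul_le_of_le_one_right (abs_nonneg _) hs1
  have b2 : |eG * (fs * s)| ≤ |eG| := by
    rw [abs_mul, abs_of_nonneg (mul_nonneg hfs0 hs0)]
    exact mul_le_of_le_one_right (abs_nonneg _) (mul_le_one₀ hfs1 hs0 hs1)
  have b3 : |(τ2 * fs) * ((u - fs) * s)| ≤ Λ ^ 2 * |e1| := by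
    rw [abs_mul, abs_mul (u - fs), abs_of_nonneg hs0]
    exact mul_le_mul hτ2 ((mul_le_of_le_one_right (abs_nonneg _) hs1).trans he1')
      (by positivity) (by positivity)
  have b4 : |τb * ((fs - u) * s)| ≤ Λ ^ 2 * |e1| := by
    rw [abs_mul, abs_mul (fs - u), abs_of_nonneg hs0]
    exact mul_le_mul hτb ((mul_le_of_le_one_right (abs_nonneg _) hs1).trans he1)
      (by positivity) (by positivity)
  have b5 : |(τb * u) * (f1 + (fs - u))| ≤ Λ * |f1| + Λ ^ 2 * |e1| := by
    rw [abs_mul]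
    calc |τb * u| * |f1 + (fs - u)| ≤ Λ * (|f1| + |e1|) :=
          mul_le_mul hτu ((abs_add_le _ _).trans (by linarith)) (abs_nonneg _) (by linarith)
      _ ≤ _ := by
          have := mul_nonneg (mul_nonneg (by linarith : 0 ≤ Λ) (sub_nonneg.2 hΛ1)) (abs_nonneg e1)
          linarith
  calc _ ≤ |-fG * s| + |eG * (fs * s)| + |(τ2 * fs) * ((u - fs) * s)| +
        |τb * ((fs - u) * s)| + |(τb * u) * (f1 + (fs - u))| := by
        refine (abs_add_le _ _).trans (add_le_add ((abs_add_le _ _).trans (add_le_add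
          ((abs_add_le _ _).trans (add_le_add (abs_add_le _ _) le_rfl)) le_rfl)) le_rfl)
    _ ≤ _ := by linarith

/-- The leverage of a sample that is left out concentrates at `δ`, and the coefficient of its
squared residual at `α`. -/
theorem Concentrated.integral_shrink_sub_sq_le (hz : Concentrated c μ z) (hlam : 0 < lam)
    {Γ R δ Λ : ℝ} (hδ : IsDelta (M + 1) (secondMoment μ z) lam δ) (hΛ : 1 + δ ≤ Λ)
    (hΓ : 0 ≤ Γ) (hn : n ≤ Γ * (M + 1 : ℕ)) (hR1 : 1 ≤ R)
    (hR : ∫ V : Fin M → X, meanForm (M + 1 : ℕ) lam μ z V ^ 2 ∂(Measure.pi fun _ => μ) ≤ R) :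
    (∫ p : X × (Fin M → X), (shrink (M + 1 : ℕ) lam z p - (1 + δ)⁻¹) ^ 2
        ∂(μ.prod (Measure.pi fun _ => μ)) ≤
      48 * Λ ^ 4 * fluctBound c lam Γ R (Λ ^ 2) * ((M + 1 : ℕ) : ℝ)⁻¹) ∧
    ∫ p : X × (Fin M → X), (lev (M + 1 : ℕ) lam z
        (secondMoment μ z * qBar (secondMoment μ z) lam δ) p * shrink (M + 1 : ℕ) lam z p ^ 2 -
        alpha (M + 1) (secondMoment μ z) lam δ) ^ 2 ∂(μ.prod (Measure.pi fun _ => μ)) ≤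
      48 * Λ ^ 4 * fluctBound c lam Γ R (Λ ^ 2) * ((M + 1 : ℕ) : ℝ)⁻¹ := by
  have hzz := hz.allLp
  have hS := secondMoment_posSemidef hzz
  set S := secondMoment μ z
  have hν : (0 : ℝ) < (M + 1 : ℕ) := by positivity
  have hν1 : (1 : ℝ) ≤ (M + 1 : ℕ) := by exact_mod_cast Nat.le_add_left 1 M
  obtain ⟨ν, hνM⟩ : ∃ ν : ℝ, ν = (M + 1 : ℕ) := ⟨_, rfl⟩
  have hδ0 := hδ.1
  have hΛ1 : 1 ≤ Λ := by linarith
  have hG := multiplier_mul_qBar hS hlam hδ0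
  have hfix := isDelta_eq_normTrace hδ
  have hptW := fun p => abs_lev_mul_shrink_sq_sub_le (M := M) (z := z) hS (Nat.succ_pos M) hlam hδ
    hΛ p
  rw [← hνM] at hν hν1 hn hR hfix ⊢
  simp only [Nat.succ_eq_add_one, ← hνM] at hptW
  have hcomm := mul_qBar_comm hS hlam hδ0
  have hGd : S * qBar S lam δ * qBar S lam δ * S =
      S * qBar S lam δ * (S * qBar S lam δ) := by
    rw [Matrix.mul_assoc (S * qBar S lam δ), ← hcomm]
  have hGd' : S * (S * qBar S lam δ) * qBar S lam δ =
      S * qBar S lam δ * (S * qBar S lam δ) := by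
    conv_lhs => rw [hcomm]
    simp only [Matrix.mul_assoc]
  have hFB : ∀ (H : Matrix (Fin n) (Fin n) ℝ) (L : ℝ), Multiplier S H L → L ≤ Λ ^ 2 →
      ∫ p : X × (Fin M → X), fluct ν lam S z H p ^ 2 ∂(μ.prod (Measure.pi fun _ => μ)) ≤
        fluctBound c lam Γ R (Λ ^ 2) * ν⁻¹ := fun H L hH hL =>
    (hz.integral_fluct_sq_le hν hlam hH hn hν1 hR1 hR).trans
      (mul_le_mul_of_nonneg_right (fluctBound_mono hz.pos hlam hΓ (by linarith) hH.pos.le hL)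
        (inv_nonneg.2 hν.le))
  have i1 := hFB 1 1 (.one S) (by nlinarith)
  have iG := hFB _ _ hG (by nlinarith)
  have iGG := hFB _ _ hG.sq (by nlinarith)
  have ie1 := (integral_traceErr_sq_le (z := z) (M := M) (D := 1) hzz hS hlam hδ0 hG.symm
    (by rw [Matrix.one_mul, hcomm]) (by rw [Matrix.mul_one]) hνM).trans iG
  have ieG := (integral_traceErr_sq_le (z := z) (M := M) (D := S * qBar S lam δ) hzz hS hlam hδ0
    hG.sq.symm hGd hGd' hνM).trans iGG
  have hF0 : 0 ≤ fluctBound c lam Γ R (Λ ^ 2) * ν⁻¹ :=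
    mul_nonneg (fluctBound_nonneg hz.pos hlam hΓ (by linarith)) (inv_nonneg.2 hν.le)
  have af := allLp_fluct (M := M) hzz hν hlam hS
  have ae := allLp_traceErr (M := M) hzz hν hlam hS δ
  have as := allLp_shrink (M := M) hzz hν hlam
  have al := allLp_lev (M := M) hzz hν hlam
  rw [mul_assoc (48 * Λ ^ 4)]
  set FB := fluctBound c lam Γ R (Λ ^ 2) * ν⁻¹
  have hΛ4 : 1 ≤ Λ ^ 4 := one_le_pow₀ hΛ1
  constructor
  · have hpt : ∀ p : X × (Fin M → X), (shrink ν lam z p - (1 + δ)⁻¹) ^ 2 ≤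
        2 * fluct ν lam S z 1 p ^ 2 + 2 * traceErr ν lam S z δ 1 (S * qBar S lam δ) p ^ 2 :=
      fun p => by
      have h1 := fluct_one_eq (z := z) hS hν hlam p
      have h2 := abs_fullShrink_sub_le (z := z) hS hν hlam hδ0 hfix p
      have h3 := sq_le_sq.2 h2
      have h4 := add_sq_le_two (fluct ν lam S z 1 p) (fullShrink ν lam S z p - (1 + δ)⁻¹)
      rw [h1] at h4 ⊢
      rw [sub_add_sub_cancel] at h4
      linarith
    refine (AllLp.integral_mono (by fun_prop) (by fun_prop) hpt).trans ?_
    simp (disch := fun_prop) only [AllLp.integral_add, integral_const_mul]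
    nlinarith
  · have hpt : ∀ p : X × (Fin M → X), (lev ν lam z (S * qBar S lam δ) p *
        shrink ν lam z p ^ 2 - alpha (M + 1) S lam δ) ^ 2 ≤
        4 * fluct ν lam S z (S * qBar S lam δ) p ^ 2 +
        4 * traceErr ν lam S z δ (S * qBar S lam δ)
          (S * qBar S lam δ * (S * qBar S lam δ)) p ^ 2 +
        36 * Λ ^ 4 * traceErr ν lam S z δ 1 (S * qBar S lam δ) p ^ 2 +
        4 * Λ ^ 2 * fluct ν lam S z 1 p ^ 2 := fun p => by
      have h := pow_le_pow_left₀ (abs_nonneg _) (hptW p) 2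
      rw [sq_abs] at h
      refine h.trans ?_
      rw [← sq_abs (fluct ν lam S z (S * qBar S lam δ) p), ← sq_abs (traceErr ν lam S z δ 1 _ p),
        ← sq_abs (traceErr ν lam S z δ (S * qBar S lam δ) _ p), ← sq_abs (fluct ν lam S z 1 p)]
      generalize |fluct ν lam S z (S * qBar S lam δ) p| = a
      generalize |traceErr ν lam S z δ (S * qBar S lam δ)
        (S * qBar S lam δ * (S * qBar S lam δ)) p| = b
      generalize |traceErr ν lam S z δ 1 (S * qBar S lam δ) p| = e
      generalize |fluct ν lam S z 1 p| = f
      nlinarith [sq_nonneg (a - b), sq_nonneg (a - 3 * Λ ^ 2 * e), sq_nonneg (a - Λ * f),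
        sq_nonneg (b - 3 * Λ ^ 2 * e), sq_nonneg (b - Λ * f), sq_nonneg (3 * Λ ^ 2 * e - Λ * f)]
    refine (AllLp.integral_mono (by fun_prop) (by fun_prop) hpt).trans ?_
    simp (disch := fun_prop) only [AllLp.integral_add, integral_const_mul]
    have hΛ2 : Λ ^ 2 ≤ Λ ^ 4 := pow_le_pow_right₀ hΛ1 (by norm_num)
    have j1 := mul_le_mul_of_nonneg_left ie1 (by positivity : 0 ≤ 36 * Λ ^ 4)
    have j2 := mul_le_mul_of_nonneg_left i1 (by positivity : 0 ≤ 4 * Λ ^ 2)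
    nlinarith

end Concentration

/-! ### Leave-one-out residuals -/

section Bias

variable {X : Type*} [MeasurableSpace X] {n M : ℕ} {μ : Measure X} [IsProbabilityMeasure μ]
  {z : X → Fin n → ℝ} {g : X → ℝ} {c ν lam : ℝ}

/-- The ridge weights fitted on the sample `V` with the noiseless labels `g`. -/
def sampleRidge (ν lam : ℝ) (z : X → Fin n → ℝ) (g : X → ℝ) (V : Fin M → X) : Fin n → ℝ :=
  ridge ν lam (fun j => z (V j)) (fun j => g (V j))

/-- The residual at `p.1` of the ridge predictor fitted on `p.2`. -/
def resid (ν lam : ℝ) (z : X → Fin n → ℝ) (g : X → ℝ) (p : X × (Fin M → X)) : ℝ :=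
  g p.1 - leftOut z p ⬝ᵥ sampleRidge ν lam z g p.2

/-- The change of the ridge weights when the sample `p.1` joins the training set. -/
def ridgeStep (ν lam : ℝ) (z : X → Fin n → ℝ) (g : X → ℝ) (p : X × (Fin M → X)) : Fin n → ℝ :=
  (ν⁻¹ * resid ν lam z g p * shrink ν lam z p) • (sampleInv ν lam z p.2 *ᵥ leftOut z p)

/-- The ridge weights fitted on the sample `p.2` together with `p.1`. -/
def fullRidge (ν lam : ℝ) (z : X → Fin n → ℝ) (g : X → ℝ) (p : X × (Fin M → X)) : Fin n → ℝ :=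
  sampleRidge ν lam z g p.2 + ridgeStep ν lam z g p

omit [MeasurableSpace X] in
lemma fullRidge_removeNth (hν : 0 < ν) (hlam : 0 < lam) (U : Fin (M + 1) → X)
    (i : Fin (M + 1)) :
    fullRidge ν lam z g (U i, fun j => U (i.succAbove j)) = sampleRidge ν lam z g U := by
  rw [sampleRidge, ridge_succAbove hν hlam _ _ i]
  simp only [fullRidge, ridgeStep, shrink, resid, lev, Matrix.one_mul, div_eq_mul_inv]
  rfl

/-- Joining the training set shrinks a residual. -/
lemma resid_fullRidge (hν : 0 < ν) (hlam : 0 < lam) (p : X × (Fin M → X)) :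
    g p.1 - leftOut z p ⬝ᵥ fullRidge ν lam z g p =
      resid ν lam z g p * shrink ν lam z p := by
  have hκ := lev_one_nonneg (z := z) hν hlam p
  have h1 : ν⁻¹ * (leftOut z p ⬝ᵥ (sampleInv ν lam z p.2 *ᵥ leftOut z p)) = lev ν lam z 1 p := by
    rw [lev, Matrix.one_mul]
  have h2 : shrink ν lam z p * (1 + lev ν lam z 1 p) = 1 := inv_mul_cancel₀ (by linarith)
  rw [fullRidge, dotProduct_add, ← sub_sub, ridgeStep, dotProduct_smul, smul_eq_mul]
  change resid ν lam z g p - _ = _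
  linear_combination (-(resid ν lam z g p * shrink ν lam z p)) * h1 - resid ν lam z g p * h2

/-- The normal equations, in terms of the leave-one-out residuals. -/
lemma smul_sampleRidge_dotProduct (hν : 0 < ν) (hlam : 0 < lam) (U : Fin (M + 1) → X)
    (a : Fin n → ℝ) :
    lam * (a ⬝ᵥ sampleRidge ν lam z g U) = ν⁻¹ * ∑ i, (a ⬝ᵥ z (U i)) *
      (resid ν lam z g (U i, fun j => U (i.succAbove j)) *
        shrink ν lam z (U i, fun j => U (i.succAbove j))) := by
  have h1 := congrArg (fun v => a ⬝ᵥ v)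
    (gram_mulVec_ridge hlam hν.le (fun j => z (U j)) (fun j => g (U j)))
  change a ⬝ᵥ (gram ν lam (fun j => z (U j)) *ᵥ sampleRidge ν lam z g U) = _ at h1
  simp only [gram, Matrix.add_mulVec, Matrix.smul_mulVec, Matrix.one_mulVec, dotProduct_add,
    dotProduct_smul, smul_eq_mul, Matrix.sum_mulVec, vecMulVec_mulVec', dotProduct_sum] at h1
  have h2 : ∀ i : Fin (M + 1), resid ν lam z g (U i, fun j => U (i.succAbove j)) *
      shrink ν lam z (U i, fun j => U (i.succAbove j)) =
      g (U i) - z (U i) ⬝ᵥ sampleRidge ν lam z g U := fun i => by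
    rw [← resid_fullRidge hν hlam, fullRidge_removeNth hν hlam]; rfl
  simp only [h2]
  have h3 : ∑ i, (a ⬝ᵥ z (U i)) * (g (U i) - z (U i) ⬝ᵥ sampleRidge ν lam z g U) =
      ∑ i, g (U i) * (a ⬝ᵥ z (U i)) -
      ∑ i, (z (U i) ⬝ᵥ sampleRidge ν lam z g U) * (a ⬝ᵥ z (U i)) := by
    rw [← Finset.sum_sub_distrib]
    exact Finset.sum_congr rfl fun i _ => by ring
  rw [h3]
  linear_combination h1

lemma allLp_sampleRidge (hz : ∀ i, AllLp (fun x => z x i) μ) (hg : AllLp g μ) (hν : 0 < ν)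
    (hlam : 0 < lam) (i : Fin n) :
    AllLp (fun V : Fin M → X => sampleRidge ν lam z g V i) (Measure.pi fun _ => μ) :=
  AllLp.ridge (fun j i => allLp_sample hz j i)
    (fun j => hg.comp (measurePreserving_eval (fun _ : Fin M => μ) j)) hν.le hlam i

lemma allLp_sampleRidge_snd (hz : ∀ i, AllLp (fun x => z x i) μ) (hg : AllLp g μ) (hν : 0 < ν)
    (hlam : 0 < lam) (i : Fin n) :
    AllLp (fun p : X × (Fin M → X) => sampleRidge ν lam z g p.2 i)
      (μ.prod (Measure.pi fun _ => μ)) :=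
  (allLp_sampleRidge hz hg hν hlam i).comp measurePreserving_snd

lemma allLp_resid (hz : ∀ i, AllLp (fun x => z x i) μ) (hg : AllLp g μ) (hν : 0 < ν)
    (hlam : 0 < lam) :
    AllLp (fun p : X × (Fin M → X) => resid ν lam z g p) (μ.prod (Measure.pi fun _ => μ)) :=
  (hg.comp measurePreserving_fst).sub (AllLp.dotProduct (allLp_leftOut hz)
    (allLp_sampleRidge_snd hz hg hν hlam))

lemma allLp_ridgeStep (hz : ∀ i, AllLp (fun x => z x i) μ) (hg : AllLp g μ) (hν : 0 < ν)
    (hlam : 0 < lam) (i : Fin n) :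
    AllLp (fun p : X × (Fin M → X) => ridgeStep ν lam z g p i)
      (μ.prod (Measure.pi fun _ => μ)) :=
  (((allLp_resid hz hg hν hlam).const_mul _).mul (allLp_shrink hz hν hlam)).mul
    (AllLp.mulVec (allLp_sampleInv_snd hz hν hlam) (allLp_leftOut hz) i)

/-- The label-feature covariance is controlled by the second moment matrix. -/
lemma crossMoment_sq_le (hz : ∀ i, AllLp (fun x => z x i) μ)
    (hg : Integrable (fun x => g x ^ 2) μ) (hgm : AEStronglyMeasurable g μ) (v : Fin n → ℝ) :
    (crossMoment μ g z ⬝ᵥ v) ^ 2 ≤ (∫ x, g x ^ 2 ∂μ) * (v ⬝ᵥ (secondMoment μ z *ᵥ v)) := by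
  have hg2 : MemLp g 2 μ := (memLp_two_iff_integrable_sq hgm).2 hg
  have hdz : ∀ a : Fin n → ℝ, AllLp (fun x => a ⬝ᵥ z x) μ := fun a =>
    AllLp.dotProduct (u := fun _ => a) (fun i => .const (a i)) hz
  have hz2 : ∀ a : Fin n → ℝ, MemLp (fun x => a ⬝ᵥ z x) 2 μ := fun a =>
    (memLp_two_iff_integrable_sq (hdz a).1).2 ((hdz a).pow 2).integrable
  have hgz : ∀ i, Integrable (fun x => g x * z x i) μ := fun i => by
    have := hg2.integrable_mul (hz2 (Pi.single i 1))
    simpa [Pi.mul_def] using this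
  rw [dotProduct_comm, ← integral_label_mul_dotProduct hgz, ← integral_dotProduct_sq hz]
  exact integral_mul_sq_le hg ((hdz v).pow 2).integrable (hg2.integrable_mul (hz2 v))

/-- The solution of the population equation is bounded when the right-hand side is bounded relative
to the second moment matrix. -/
lemma qBar_mulVec_bound {S : Matrix (Fin n) (Fin n) ℝ} (hS : S.PosSemidef) (hlam : 0 < lam)
    {δ Λ A : ℝ} (hδ : 0 ≤ δ) (hΛ : 1 + δ ≤ Λ) (hA : 0 ≤ A) {v : Fin n → ℝ}
    (hv : ∀ d, (v ⬝ᵥ d) ^ 2 ≤ A * (d ⬝ᵥ (S *ᵥ d))) :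
    (qBar S lam δ *ᵥ v) ⬝ᵥ (S *ᵥ (qBar S lam δ *ᵥ v)) ≤ Λ ^ 2 * A ∧
      (qBar S lam δ *ᵥ v) ⬝ᵥ (qBar S lam δ *ᵥ v) ≤ lam⁻¹ * (Λ * A) := by
  have hB := qBar_coercive (lam := lam) hS hδ
  have h1 := hB.form_inv hlam v
  change (qBar S lam δ *ᵥ v) ⬝ᵥ _ *ᵥ (qBar S lam δ *ᵥ v) = v ⬝ᵥ (qBar S lam δ *ᵥ v) at h1
  have h2 := hv (qBar S lam δ *ᵥ v)
  have h3 := hS.form_nonneg (qBar S lam δ *ᵥ v)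
  have h4 := dotProduct_self_nonneg' (qBar S lam δ *ᵥ v)
  set a := qBar S lam δ *ᵥ v
  simp only [Matrix.add_mulVec, Matrix.smul_mulVec, Matrix.one_mulVec, dotProduct_add,
    dotProduct_smul, smul_eq_mul] at h1
  have hu : (1 + δ) * (1 + δ)⁻¹ = 1 := mul_inv_cancel₀ (by positivity)
  have hla : 0 ≤ lam * (a ⬝ᵥ a) := by positivity
  have h5 : a ⬝ᵥ (S *ᵥ a) ≤ Λ * (v ⬝ᵥ a) := by
    calc a ⬝ᵥ (S *ᵥ a) = (1 + δ) * ((1 + δ)⁻¹ * (a ⬝ᵥ (S *ᵥ a))) := by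
          rw [← mul_assoc, hu, one_mul]
      _ ≤ (1 + δ) * (v ⬝ᵥ a) := by gcongr; linarith
      _ ≤ Λ * (v ⬝ᵥ a) := by
          have : 0 ≤ v ⬝ᵥ a := by rw [← h1]; positivity
          gcongr
  have h6 : 0 ≤ v ⬝ᵥ a := by rw [← h1]; positivity
  have h7 : v ⬝ᵥ a ≤ Λ * A := by
    rcases h6.eq_or_lt with h | h
    · rw [← h]; have : 0 ≤ Λ := by linarith
      positivity
    · have : (v ⬝ᵥ a) ^ 2 ≤ A * (Λ * (v ⬝ᵥ a)) := h2.trans (by gcongr)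
      nlinarith
  constructor
  · have : Λ * (v ⬝ᵥ a) ≤ Λ * (Λ * A) := by
      have : 0 ≤ Λ := by linarith
      gcongr
    linarith
  · rw [inv_mul_eq_div, le_div_iff₀ hlam]
    have : 0 ≤ (1 + δ)⁻¹ * (a ⬝ᵥ (S *ᵥ a)) := by positivity
    linarith

/-! ### Moments of the weights and of the residuals, for bounded labels -/

/-- The bound for the compressed second moment matrix. -/
def rho (c ν lam : ℝ) (μ : Measure X) (z : X → Fin n → ℝ) (V : Fin M → X) : ℝ :=
  c * lam⁻¹ + meanForm ν lam μ z V

omit [IsProbabilityMeasure μ] in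
lemma rho_nonneg (hc : 0 < c) (hν : 0 < ν) (hlam : 0 < lam) (V : Fin M → X) :
    0 ≤ rho c ν lam μ z V :=
  add_nonneg (mul_nonneg hc.le (inv_nonneg.2 hlam.le))
    ((sampleInv_posSemidef hν hlam _).form_nonneg _)

lemma allLp_rho (hz : ∀ i, AllLp (fun x => z x i) μ) (hν : 0 < ν) (hlam : 0 < lam) :
    AllLp (fun V : Fin M → X => rho c ν lam μ z V) (Measure.pi fun _ => μ) :=
  (AllLp.const _).add (allLp_meanForm hz hν hlam)

lemma allLp_rho_snd (hz : ∀ i, AllLp (fun x => z x i) μ) (hν : 0 < ν) (hlam : 0 < lam) :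
    AllLp (fun p : X × (Fin M → X) => rho c ν lam μ z p.2) (μ.prod (Measure.pi fun _ => μ)) :=
  (allLp_rho hz hν hlam).comp measurePreserving_snd

/-- The energy estimate `ridge_form_le`, transferred to the second moment seminorm. -/
lemma Concentrated.sampleRidge_form_le (hz : Concentrated c μ z) (hν : 0 < ν) (hlam : 0 < lam)
    (V : Fin M → X) :
    sampleRidge ν lam z g V ⬝ᵥ (secondMoment μ z *ᵥ sampleRidge ν lam z g V) ≤
      rho c ν lam μ z V * (ν⁻¹ * ∑ j, g (V j) ^ 2) := by
  have hA := gram_coercive hν.le lam (fun j => z (V j))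
  refine (hz.form_inv_le hlam hA (ν⁻¹ • ∑ j, g (V j) • z (V j))).trans ?_
  refine mul_le_mul_of_nonneg_left ?_ (rho_nonneg (z := z) hz.pos hν hlam V)
  rw [← hA.form_inv hlam]
  exact ridge_form_le hν hlam (fun j => z (V j)) (fun j => g (V j))

omit [MeasurableSpace X] in
lemma mean_sq_le {K : ℝ} (hK : ∀ x, |g x| ≤ K) (hν : 0 < ν) (hM : M ≤ ν) (V : Fin M → X) :
    ν⁻¹ * ∑ j, g (V j) ^ 2 ≤ K ^ 2 := by
  rw [inv_mul_eq_div, div_le_iff₀ hν]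
  calc ∑ j, g (V j) ^ 2 ≤ ∑ _j : Fin M, K ^ 2 :=
        Finset.sum_le_sum fun j _ => sq_le_sq.2 ((hK _).trans (le_abs_self _))
    _ = M * K ^ 2 := by simp
    _ ≤ K ^ 2 * ν := by rw [mul_comm]; gcongr

/-- The step in the second moment seminorm is of order `ν^(-1/2)`. -/
lemma Concentrated.ridgeStep_form_le (hz : Concentrated c μ z) (hν : 0 < ν) (hlam : 0 < lam)
    (p : X × (Fin M → X)) :
    ridgeStep ν lam z g p ⬝ᵥ (secondMoment μ z *ᵥ ridgeStep ν lam z g p) ≤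
      ν⁻¹ * (rho c ν lam μ z p.2 * resid ν lam z g p ^ 2) := by
  have hA := gram_coercive hν.le lam (fun j => z (p.2 j))
  have h1 := hz.form_inv_le hlam hA (leftOut z p)
  change (sampleInv ν lam z p.2 *ᵥ leftOut z p) ⬝ᵥ (secondMoment μ z *ᵥ
    (sampleInv ν lam z p.2 *ᵥ leftOut z p)) ≤ rho c ν lam μ z p.2 *
    (leftOut z p ⬝ᵥ (sampleInv ν lam z p.2 *ᵥ leftOut z p)) at h1
  have hκ := lev_one_nonneg (z := z) hν hlam p
  have h2 : leftOut z p ⬝ᵥ (sampleInv ν lam z p.2 *ᵥ leftOut z p) = ν * lev ν lam z 1 p := by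
    rw [lev, Matrix.one_mul, ← mul_assoc, mul_inv_cancel₀ hν.ne', one_mul]
  have hs0 := shrink_nonneg (z := z) hν hlam p
  have hs1 := shrink_le_one (z := z) hν hlam p
  have h3 : lev ν lam z 1 p * shrink ν lam z p ≤ 1 := by
    rw [shrink, ← div_eq_mul_inv, div_le_one (by linarith)]; linarith
  have hρ := rho_nonneg (μ := μ) (z := z) hz.pos hν hlam p.2
  rw [ridgeStep, Matrix.mulVec_smul, smul_dotProduct, dotProduct_smul, smul_eq_mul, smul_eq_mul]
  rw [h2] at h1
  calc _ = (ν⁻¹ * resid ν lam z g p * shrink ν lam z p) ^ 2 *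
        ((sampleInv ν lam z p.2 *ᵥ leftOut z p) ⬝ᵥ (secondMoment μ z *ᵥ
          (sampleInv ν lam z p.2 *ᵥ leftOut z p))) := by ring
    _ ≤ (ν⁻¹ * resid ν lam z g p * shrink ν lam z p) ^ 2 *
        (rho c ν lam μ z p.2 * (ν * lev ν lam z 1 p)) := by gcongr
    _ = ν⁻¹ * (rho c ν lam μ z p.2 * resid ν lam z g p ^ 2) *
        ((lev ν lam z 1 p * shrink ν lam z p) * shrink ν lam z p) * (ν⁻¹ * ν) := by ring
    _ ≤ ν⁻¹ * (rho c ν lam μ z p.2 * resid ν lam z g p ^ 2) * (1 * 1) * (ν⁻¹ * ν) := by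
        gcongr
    _ = _ := by rw [inv_mul_cancel₀ hν.ne']; ring

/-- A bound for the second moment of `rho`. -/
lemma Concentrated.integral_rho_sq_le (hz : Concentrated c μ z) (hν : 0 < ν) (hlam : 0 < lam)
    {R : ℝ}
    (hR : ∫ V : Fin M → X, meanForm ν lam μ z V ^ 2 ∂(Measure.pi fun _ => μ) ≤ R) :
    ∫ V : Fin M → X, rho c ν lam μ z V ^ 2 ∂(Measure.pi fun _ => μ) ≤
      2 * (c * lam⁻¹) ^ 2 + 2 * R := by
  have h := allLp_meanForm (M := M) hz.allLp hν hlam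
  calc _ ≤ ∫ V : Fin M → X, (2 * (c * lam⁻¹) ^ 2 + 2 * meanForm ν lam μ z V ^ 2)
          ∂(Measure.pi fun _ => μ) :=
        AllLp.integral_mono ((allLp_rho hz.allLp hν hlam).pow 2) (by fun_prop) fun V =>
          add_sq_le_two _ _
    _ ≤ _ := by
        simp (disch := fun_prop) only [AllLp.integral_add, integral_const_mul, integral_const,
          probReal_univ, one_smul]
        linarith

/-- The fourth moment of a linear observable of the left-out features, with a direction that depends
on the other samples. -/
lemma Concentrated.integral_dotProduct_four_le (hz : Concentrated c μ z) (hν : 0 < ν)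
    (hlam : 0 < lam) {a : (Fin M → X) → Fin n → ℝ}
    (ha : ∀ i, AllLp (fun V => a V i) (Measure.pi fun _ => μ)) {A : ℝ}
    (h1 : ∀ V, a V ⬝ᵥ a V ≤ A * lam⁻¹)
    (h2 : ∀ V, a V ⬝ᵥ (secondMoment μ z *ᵥ a V) ≤ A * rho c ν lam μ z V) {R : ℝ}
    (hR : ∫ V : Fin M → X, meanForm ν lam μ z V ^ 2 ∂(Measure.pi fun _ => μ) ≤ R) :
    ∫ p : X × (Fin M → X), (a p.2 ⬝ᵥ leftOut z p) ^ 4 ∂(μ.prod (Measure.pi fun _ => μ)) ≤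
      A ^ 2 * (8 * (c * lam⁻¹ ^ 2 + (2 * (c * lam⁻¹) ^ 2 + 2 * R))) := by
  have hzz := hz.allLp
  have hS := secondMoment_posSemidef hzz
  have hint : AllLp (fun p : X × (Fin M → X) => (a p.2 ⬝ᵥ leftOut z p) ^ 4)
      (μ.prod (Measure.pi fun _ => μ)) :=
    (AllLp.dotProduct (fun i => (ha i).comp measurePreserving_snd) (allLp_leftOut hzz)).pow 4
  have hρ := allLp_rho (c := c) (M := M) hzz hν hlam
  refine (integral_prod_le_of_inner (h := fun V => 8 * (c * (A * lam⁻¹) ^ 2 +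
    A ^ 2 * rho c ν lam μ z V ^ 2)) hint.integrable
    (AllLp.integrable (by fun_prop)) fun V => ?_).trans ?_
  · refine (hz.dotProduct_four_le (a V)).trans ?_
    have h3 := dotProduct_self_nonneg' (a V)
    have h4 := hS.form_nonneg (a V)
    have := hz.pos
    rw [← mul_pow A]
    gcongr
    · exact h1 V
    · exact h2 V
  · have h3 := hz.integral_rho_sq_le hν hlam hR
    simp (disch := fun_prop) only [AllLp.integral_add, integral_const_mul, integral_const,
      probReal_univ, one_smul]
    have := mul_le_mul_of_nonneg_left h3 (sq_nonneg A)
    linarith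

/-- Leaving the test sample out of the training set makes the weights independent of it, so a fourth
moment bound only needs the concentration of the features. -/
lemma Concentrated.integral_resid_four_le (hz : Concentrated c μ z) (hν : 0 < ν)
    (hlam : 0 < lam) (hg : AllLp g μ) {K : ℝ} (hK : ∀ x, |g x| ≤ K) (hM : M ≤ ν) {R : ℝ}
    (hR : ∫ V : Fin M → X, meanForm ν lam μ z V ^ 2 ∂(Measure.pi fun _ => μ) ≤ R) :
    ∫ p : X × (Fin M → X), resid ν lam z g p ^ 4 ∂(μ.prod (Measure.pi fun _ => μ)) ≤
      8 * K ^ 4 + 8 * (K ^ 4 * (8 * (c * lam⁻¹ ^ 2 + (2 * (c * lam⁻¹) ^ 2 + 2 * R)))) := by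
  have hzz := hz.allLp
  have h1 := hz.integral_dotProduct_four_le (a := fun V => sampleRidge ν lam z g V) (A := K ^ 2)
    hν hlam (allLp_sampleRidge (M := M) hzz hg hν hlam)
    (fun V => by
      have := ridge_normSq_le hν hlam (fun j => z (V j)) (fun j => g (V j))
      rw [← div_eq_mul_inv, le_div_iff₀ hlam, mul_comm]
      exact this.trans (mean_sq_le hK hν hM V))
    (fun V => (hz.sampleRidge_form_le hν hlam V).trans (by
      rw [mul_comm]
      exact mul_le_mul_of_nonneg_right (mean_sq_le hK hν hM V) (rho_nonneg hz.pos hν hlam V))) hR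
  have hd : AllLp (fun p : X × (Fin M → X) => (sampleRidge ν lam z g p.2 ⬝ᵥ leftOut z p) ^ 4)
      (μ.prod (Measure.pi fun _ => μ)) :=
    (AllLp.dotProduct (allLp_sampleRidge_snd hzz hg hν hlam) (allLp_leftOut hzz)).pow 4
  calc _ ≤ ∫ p : X × (Fin M → X), (8 * K ^ 4 +
          8 * (sampleRidge ν lam z g p.2 ⬝ᵥ leftOut z p) ^ 4) ∂(μ.prod (Measure.pi fun _ => μ)) := by
        refine AllLp.integral_mono ((allLp_resid hzz hg hν hlam).pow 4) (by fun_prop) fun p => ?_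
        have h2 := add_pow_four_le (g p.1) (-(leftOut z p ⬝ᵥ sampleRidge ν lam z g p.2))
        rw [← sub_eq_add_neg, Even.neg_pow (by decide), dotProduct_comm] at h2
        have h3 : g p.1 ^ 4 ≤ K ^ 4 := by
          have := pow_le_pow_left₀ (abs_nonneg _) (hK p.1) 4
          rwa [Even.pow_abs (by decide)] at this
        rw [resid, dotProduct_comm]
        linarith
    _ ≤ _ := by
        simp (disch := fun_prop) only [AllLp.integral_add, integral_const_mul, integral_const,
          probReal_univ, one_smul]
        rw [← pow_mul] at h1
        linarith

end Bias

/-! ### Expectations over the samples -/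

section ExpectationEstimates

variable {X : Type*} [MeasurableSpace X] {n M : ℕ} {μ : Measure X} [IsProbabilityMeasure μ]
  {z : X → Fin n → ℝ} {g : X → ℝ} {c ν lam : ℝ}

/-- An average over the samples of a leave-one-out observable has the expectation of that
observable. -/
lemma integral_average {f : X × (Fin M → X) → ℝ}
    (hf : AllLp f (μ.prod (Measure.pi fun _ => μ))) (hν : ν = (M + 1 : ℕ)) :
    ∫ U : Fin (M + 1) → X, ν⁻¹ * ∑ i, f (U i, fun j => U (i.succAbove j))
      ∂(Measure.pi fun _ => μ) = ∫ p, f p ∂(μ.prod (Measure.pi fun _ => μ)) := by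
  rw [integral_const_mul, AllLp.integral_sum fun i => hf.comp (measurePreserving_removeNth μ i)]
  simp only [integral_removeNth]
  rw [Finset.sum_const, Finset.card_univ, Fintype.card_fin, nsmul_eq_mul, ← mul_assoc, hν,
    inv_mul_cancel₀ (by positivity), one_mul]

/-- Any sample may be regarded as the last one to join the training set. -/
lemma integral_fullRidge (hν : 0 < ν) (hlam : 0 < lam) (φ : (Fin n → ℝ) → ℝ) :
    ∫ p : X × (Fin M → X), φ (fullRidge ν lam z g p) ∂(μ.prod (Measure.pi fun _ => μ)) =
      ∫ U : Fin (M + 1) → X, φ (sampleRidge ν lam z g U) ∂(Measure.pi fun _ => μ) := by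
  rw [← integral_removeNth 0]
  simp only [fullRidge_removeNth hν hlam]

lemma allLp_fullRidge (hz : ∀ i, AllLp (fun x => z x i) μ) (hg : AllLp g μ) (hν : 0 < ν)
    (hlam : 0 < lam) (i : Fin n) :
    AllLp (fun p : X × (Fin M → X) => fullRidge ν lam z g p i)
      (μ.prod (Measure.pi fun _ => μ)) :=
  (allLp_sampleRidge_snd hz hg hν hlam i).add (allLp_ridgeStep hz hg hν hlam i)

/-- The order `ν^(-1/2)` of all errors. -/
def rate (ν : ℝ) : ℝ := (√ν)⁻¹

lemma rate_pos (hν : 0 < ν) : 0 < rate ν := inv_pos.2 (Real.sqrt_pos.2 hν)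

lemma rate_sq (hν : 0 < ν) : rate ν * rate ν = ν⁻¹ := by
  rw [rate, ← mul_inv, Real.mul_self_sqrt hν.le]

lemma inv_rate_mul (hν : 0 < ν) : (rate ν)⁻¹ * ν⁻¹ = rate ν := by
  rw [← rate_sq hν, inv_mul_cancel_left₀ (rate_pos hν).ne']

lemma rate_le_one (hν : 1 ≤ ν) : rate ν ≤ 1 :=
  inv_le_one_of_one_le₀ (by rw [Real.one_le_sqrt]; exact hν)

/-- The weighted inequality between the arithmetic and geometric means. -/
lemma abs_mul_le_weighted_sq_add_sq {t : ℝ} (ht : 0 < t) (a b : ℝ) :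
    |a * b| ≤ 2⁻¹ * (t * a ^ 2 + t⁻¹ * b ^ 2) := by
  have h := sq_nonneg (√t * |a| - (√t)⁻¹ * |b|)
  have h1 : √t * √t = t := Real.mul_self_sqrt ht.le
  have h2 : (√t)⁻¹ * (√t)⁻¹ = t⁻¹ := by rw [← mul_inv, h1]
  have h3 : √t * (√t)⁻¹ = 1 := mul_inv_cancel₀ (Real.sqrt_pos.2 ht).ne'
  rw [abs_mul, ← sq_abs a, ← sq_abs b]
  have : (√t * |a| - (√t)⁻¹ * |b|) ^ 2 = t * |a| ^ 2 + t⁻¹ * |b| ^ 2 - 2 * (|a| * |b|) := by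
    linear_combination |a| ^ 2 * h1 + |b| ^ 2 * h2 - 2 * |a| * |b| * h3
  linarith

lemma abs_integral_le_of_abs_le {Ω : Type*} [MeasurableSpace Ω] {P : Measure Ω} {f h : Ω → ℝ}
    (hf : AllLp f P) (hh : AllLp h P) (hle : ∀ ω, |f ω| ≤ h ω) :
    |∫ ω, f ω ∂P| ≤ ∫ ω, h ω ∂P :=
  (abs_integral_le_integral_abs).trans (hf.abs.integral_mono hh hle)

/-- A factor that is within `ν^(-1/2)` of a constant in mean square may be replaced by it. -/
lemma abs_integral_mul_sub_le {Ω : Type*} [MeasurableSpace Ω] {P : Measure Ω}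
    [IsProbabilityMeasure P] {f s : Ω → ℝ} (hf : AllLp f P) (hs : AllLp s P) (hν : 0 < ν)
    {u D F : ℝ} (hfD : ∫ ω, f ω ^ 2 ∂P ≤ D) (hsF : ∫ ω, (s ω - u) ^ 2 ∂P ≤ F * ν⁻¹) :
    |∫ ω, f ω * s ω ∂P - u * ∫ ω, f ω ∂P| ≤ rate ν * (D + F) := by
  have h1 : ∫ ω, f ω * s ω ∂P - u * ∫ ω, f ω ∂P = ∫ ω, f ω * (s ω - u) ∂P := by
    rw [← integral_const_mul, ← AllLp.integral_sub (by fun_prop) (by fun_prop)]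
    congr 1; funext ω; ring
  have hr := rate_pos hν
  rw [h1]
  refine (abs_integral_le_of_abs_le (h := fun ω => 2⁻¹ * (rate ν * f ω ^ 2 +
    (rate ν)⁻¹ * (s ω - u) ^ 2)) (by fun_prop) (by fun_prop)
    fun ω => abs_mul_le_weighted_sq_add_sq hr _ _).trans ?_
  simp (disch := fun_prop) only [AllLp.integral_add, integral_const_mul]
  have h2 : (rate ν)⁻¹ * ∫ ω, (s ω - u) ^ 2 ∂P ≤ rate ν * F := by
    calc _ ≤ (rate ν)⁻¹ * (F * ν⁻¹) := by gcongr
      _ = ((rate ν)⁻¹ * ν⁻¹) * F := by ring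
      _ = _ := by rw [inv_rate_mul hν]
  have h3 : 0 ≤ ∫ ω, f ω ^ 2 ∂P := integral_nonneg fun _ => sq_nonneg _
  have h4 : 0 ≤ ∫ ω, (s ω - u) ^ 2 ∂P := integral_nonneg fun _ => sq_nonneg _
  have h5 : rate ν * ∫ ω, f ω ^ 2 ∂P ≤ rate ν * D := by gcongr
  have h6 : 0 ≤ rate ν * ∫ ω, f ω ^ 2 ∂P := by positivity
  have h7 : 0 ≤ (rate ν)⁻¹ * ∫ ω, (s ω - u) ^ 2 ∂P := by positivity
  linarith

lemma integral_mul_sq_le_of_four {Ω : Type*} [MeasurableSpace Ω] {P : Measure Ω}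
    [IsProbabilityMeasure P] {f h : Ω → ℝ} (hf : AllLp f P) (hh : AllLp h P) {A D : ℝ}
    (hA : ∫ ω, f ω ^ 4 ∂P ≤ A) (hD : ∫ ω, h ω ^ 4 ∂P ≤ D) :
    ∫ ω, (f ω * h ω) ^ 2 ∂P ≤ A + D := by
  have h1 : ∫ ω, (f ω * h ω) ^ 2 ∂P ≤ ∫ ω, (2⁻¹ * f ω ^ 4 + 2⁻¹ * h ω ^ 4) ∂P :=
    AllLp.integral_mono (by fun_prop) (by fun_prop) fun ω => by
      nlinarith [sq_nonneg (f ω ^ 2 - h ω ^ 2)]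
  simp (disch := fun_prop) only [AllLp.integral_add, integral_const_mul] at h1
  have h3 : 0 ≤ ∫ ω, f ω ^ 4 ∂P := integral_nonneg fun _ => by positivity
  have h4 : 0 ≤ ∫ ω, h ω ^ 4 ∂P := integral_nonneg fun _ => by positivity
  linarith

/-- The covariance of a linear observable of the left-out features with the residual. -/
lemma integral_dotProduct_mul_resid (hz : ∀ i, AllLp (fun x => z x i) μ) (hg : AllLp g μ)
    (hν : 0 < ν) (hlam : 0 < lam) {a : (Fin M → X) → Fin n → ℝ}
    (ha : ∀ i, AllLp (fun V => a V i) (Measure.pi fun _ => μ)) :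
    ∫ p : X × (Fin M → X), (a p.2 ⬝ᵥ leftOut z p) * resid ν lam z g p
        ∂(μ.prod (Measure.pi fun _ => μ)) =
      ∫ V : Fin M → X, (a V ⬝ᵥ crossMoment μ g z -
        a V ⬝ᵥ (secondMoment μ z *ᵥ sampleRidge ν lam z g V)) ∂(Measure.pi fun _ => μ) := by
  have hint : AllLp (fun p : X × (Fin M → X) => (a p.2 ⬝ᵥ leftOut z p) * resid ν lam z g p)
      (μ.prod (Measure.pi fun _ => μ)) :=
    (AllLp.dotProduct (fun i => (ha i).comp measurePreserving_snd) (allLp_leftOut hz)).mul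
      (allLp_resid hz hg hν hlam)
  rw [integral_prod_symm _ hint.integrable]
  congr 1; funext V
  have h1 : ∀ x, (a V ⬝ᵥ z x) * (g x - z x ⬝ᵥ sampleRidge ν lam z g V) =
      g x * (a V ⬝ᵥ z x) - (a V ⬝ᵥ z x) * (sampleRidge ν lam z g V ⬝ᵥ z x) := fun x => by
    rw [dotProduct_comm (z x)]; ring
  simp only [leftOut, resid, h1]
  rw [AllLp.integral_sub (by fun_prop) (by fun_prop), integral_dotProduct_mul_dotProduct hz,
    integral_label_mul_dotProduct fun i => (hg.mul (hz i)).integrable]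

end ExpectationEstimates

/-! ### Linear functionals of the weights -/

section LinearFunctionals

variable {X : Type*} [MeasurableSpace X] {n M : ℕ} {μ : Measure X} [IsProbabilityMeasure μ]
  {z : X → Fin n → ℝ} {g : X → ℝ} {c ν lam : ℝ}

lemma integral_rho_mul_resid_sq_le (hz : ∀ i, AllLp (fun x => z x i) μ) (hg : AllLp g μ)
    (hν : 0 < ν) (hlam : 0 < lam) {D : ℝ}
    (hρ : ∫ V : Fin M → X, rho c ν lam μ z V ^ 2 ∂(Measure.pi fun _ => μ) ≤ D)
    (hr : ∫ p : X × (Fin M → X), resid ν lam z g p ^ 4 ∂(μ.prod (Measure.pi fun _ => μ)) ≤ D) :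
    ∫ p : X × (Fin M → X), rho c ν lam μ z p.2 * resid ν lam z g p ^ 2
      ∂(μ.prod (Measure.pi fun _ => μ)) ≤ D := by
  have h1 := allLp_rho_snd (c := c) (M := M) hz hν hlam
  have h2 := allLp_resid (M := M) hz hg hν hlam
  have h3 : ∫ p : X × (Fin M → X), rho c ν lam μ z p.2 ^ 2 ∂(μ.prod (Measure.pi fun _ => μ)) =
      ∫ V : Fin M → X, rho c ν lam μ z V ^ 2 ∂(Measure.pi fun _ => μ) := by
    rw [integral_prod_symm _ (h1.pow 2).integrable]
    simp
  refine (AllLp.integral_mono (g := fun p : X × (Fin M → X) => 2⁻¹ * rho c ν lam μ z p.2 ^ 2 +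
    2⁻¹ * resid ν lam z g p ^ 4) (h1.mul (h2.pow 2))
    (((h1.pow 2).const_mul _).add ((h2.pow 4).const_mul _)) fun p => ?_).trans ?_
  · nlinarith [sq_nonneg (rho c ν lam μ z p.2 - resid ν lam z g p ^ 2)]
  · rw [AllLp.integral_add ((h1.pow 2).const_mul _) ((h2.pow 4).const_mul _), integral_const_mul,
      integral_const_mul, h3]
    linarith

lemma integral_rho_snd_le (hz : ∀ i, AllLp (fun x => z x i) μ)
    (hν : 0 < ν) (hlam : 0 < lam) {D : ℝ}
    (hρ : ∫ V : Fin M → X, rho c ν lam μ z V ^ 2 ∂(Measure.pi fun _ => μ) ≤ D) :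
    ∫ p : X × (Fin M → X), rho c ν lam μ z p.2 ∂(μ.prod (Measure.pi fun _ => μ)) ≤ 1 + D := by
  have h0 := allLp_rho (c := c) (M := M) hz hν hlam
  have h1 := allLp_rho_snd (c := c) (M := M) hz hν hlam
  have h2 : ∫ V : Fin M → X, rho c ν lam μ z V ∂(Measure.pi fun _ => μ) ≤
      ∫ V : Fin M → X, (1 + rho c ν lam μ z V ^ 2) ∂(Measure.pi fun _ => μ) :=
    AllLp.integral_mono h0 (by fun_prop) fun V => by
      nlinarith [sq_nonneg (rho c ν lam μ z V - 1)]
  rw [AllLp.integral_add (.const _) (h0.pow 2)] at h2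
  rw [integral_prod_symm _ h1.integrable]
  simp only [integral_const, probReal_univ, one_smul] at h2 ⊢
  linarith

/-- Joining one sample moves the linear functionals of the weights by `O(ν^(-1/2))`. -/
lemma Concentrated.abs_integral_dotProduct_fullRidge_sub_le (hz : Concentrated c μ z)
    (hg : AllLp g μ) (hν : 0 < ν) (hlam : 0 < lam) {D A : ℝ} (hA : 0 ≤ A)
    (hρ : ∫ V : Fin M → X, rho c ν lam μ z V ^ 2 ∂(Measure.pi fun _ => μ) ≤ D)
    (hr : ∫ p : X × (Fin M → X), resid ν lam z g p ^ 4 ∂(μ.prod (Measure.pi fun _ => μ)) ≤ D)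
    {v : Fin n → ℝ} (hv : ∀ d, (v ⬝ᵥ d) ^ 2 ≤ A * (d ⬝ᵥ (secondMoment μ z *ᵥ d))) :
    |∫ p : X × (Fin M → X), v ⬝ᵥ fullRidge ν lam z g p ∂(μ.prod (Measure.pi fun _ => μ)) -
      ∫ p : X × (Fin M → X), v ⬝ᵥ sampleRidge ν lam z g p.2
        ∂(μ.prod (Measure.pi fun _ => μ))| ≤ rate ν * (1 + A * D) := by
  have hzz := hz.allLp
  have hd : AllLp (fun p : X × (Fin M → X) => v ⬝ᵥ ridgeStep ν lam z g p)
      (μ.prod (Measure.pi fun _ => μ)) :=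
    AllLp.dotProduct (fun _ => .const _) (allLp_ridgeStep hzz hg hν hlam)
  have hw : AllLp (fun p : X × (Fin M → X) => v ⬝ᵥ sampleRidge ν lam z g p.2)
      (μ.prod (Measure.pi fun _ => μ)) :=
    AllLp.dotProduct (fun _ => .const _) (allLp_sampleRidge_snd hzz hg hν hlam)
  have hρr : AllLp (fun p : X × (Fin M → X) => rho c ν lam μ z p.2 * resid ν lam z g p ^ 2)
      (μ.prod (Measure.pi fun _ => μ)) :=
    (allLp_rho_snd hzz hν hlam).mul ((allLp_resid hzz hg hν hlam).pow 2)
  have hε := rate_pos hν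
  simp only [fullRidge, dotProduct_add]
  rw [AllLp.integral_add hw hd, add_sub_cancel_left]
  refine (abs_integral_le_of_abs_le hd (h := fun p => rate ν * (1 + A *
    (rho c ν lam μ z p.2 * resid ν lam z g p ^ 2)))
    (((AllLp.const _).add (hρr.const_mul _)).const_mul _) fun p => ?_).trans ?_
  · have h1 := hv (ridgeStep ν lam z g p)
    have h2 := hz.ridgeStep_form_le (g := g) hν hlam p
    have h3 := abs_mul_le_weighted_sq_add_sq hε 1 (v ⬝ᵥ ridgeStep ν lam z g p)
    have hq := mul_nonneg (rho_nonneg (μ := μ) (z := z) hz.pos hν hlam p.2)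
      (sq_nonneg (resid ν lam z g p))
    have h4 : (rate ν)⁻¹ * (v ⬝ᵥ ridgeStep ν lam z g p) ^ 2 ≤
        rate ν * (A * (rho c ν lam μ z p.2 * resid ν lam z g p ^ 2)) := by
      calc _ ≤ (rate ν)⁻¹ * (A * (ν⁻¹ * (rho c ν lam μ z p.2 * resid ν lam z g p ^ 2))) := by
            gcongr
            exact h1.trans (by gcongr)
        _ = ((rate ν)⁻¹ * ν⁻¹) * (A * (rho c ν lam μ z p.2 * resid ν lam z g p ^ 2)) := by ring
        _ = _ := by rw [inv_rate_mul hν]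
    have h5 : 0 ≤ rate ν * (A * (rho c ν lam μ z p.2 * resid ν lam z g p ^ 2)) := by positivity
    rw [one_mul] at h3
    linarith
  · rw [integral_const_mul, AllLp.integral_add (.const _) (hρr.const_mul _), integral_const_mul]
    simp only [integral_const, probReal_univ, one_smul]
    have := integral_rho_mul_resid_sq_le hzz hg hν hlam hρ hr
    gcongr

/-- Joining one sample moves the quadratic functionals of the weights by `O(ν^(-1/2))`. -/
lemma Concentrated.abs_integral_form_fullRidge_sub_le (hz : Concentrated c μ z)
    (hg : AllLp g μ) (hlam : 0 < lam) (hν : 1 ≤ ν) (hM : M ≤ ν) {D K L : ℝ}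
    (hK : ∀ x, |g x| ≤ K)
    (hρ : ∫ V : Fin M → X, rho c ν lam μ z V ^ 2 ∂(Measure.pi fun _ => μ) ≤ D)
    (hr : ∫ p : X × (Fin M → X), resid ν lam z g p ^ 4 ∂(μ.prod (Measure.pi fun _ => μ)) ≤ D)
    {H : Matrix (Fin n) (Fin n) ℝ} (hH : Multiplier (secondMoment μ z) H L) (hL : 1 ≤ L) :
    |∫ p : X × (Fin M → X), (H *ᵥ fullRidge ν lam z g p) ⬝ᵥ
        (secondMoment μ z *ᵥ fullRidge ν lam z g p) ∂(μ.prod (Measure.pi fun _ => μ)) -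
      ∫ p : X × (Fin M → X), (H *ᵥ sampleRidge ν lam z g p.2) ⬝ᵥ
        (secondMoment μ z *ᵥ sampleRidge ν lam z g p.2)
        ∂(μ.prod (Measure.pi fun _ => μ))| ≤
      rate ν * (L ^ 2 * (K ^ 2 * (1 + D) + 2 * D)) := by
  have hν0 : 0 < ν := by linarith
  have hzz := hz.allLp
  set S := secondMoment μ z with hSdef
  have hS : S.PosSemidef := secondMoment_posSemidef hzz
  have hw := allLp_sampleRidge_snd (M := M) hzz hg hν0 hlam
  have hf := allLp_fullRidge (M := M) hzz hg hν0 hlam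
  have hform : ∀ (w : X × (Fin M → X) → Fin n → ℝ),
      (∀ i, AllLp (fun p => w p i) (μ.prod (Measure.pi fun _ => μ))) →
      AllLp (fun p => (H *ᵥ w p) ⬝ᵥ (S *ᵥ w p)) (μ.prod (Measure.pi fun _ => μ)) := fun w hw =>
    AllLp.dotProduct (AllLp.mulVec (fun _ _ => .const _) hw)
      (AllLp.mulVec (fun _ _ => .const _) hw)
  have hρr : AllLp (fun p : X × (Fin M → X) => rho c ν lam μ z p.2 * resid ν lam z g p ^ 2)
      (μ.prod (Measure.pi fun _ => μ)) :=
    (allLp_rho_snd hzz hν0 hlam).mul ((allLp_resid hzz hg hν0 hlam).pow 2)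
  have hε := rate_pos hν0
  have hε1 := rate_le_one hν
  rw [← AllLp.integral_sub (hform _ hf) (hform _ hw)]
  refine (abs_integral_le_of_abs_le ((hform _ hf).sub (hform _ hw)) (h := fun p => rate ν * (L ^ 2 *
    (K ^ 2 * rho c ν lam μ z p.2 + 2 * (rho c ν lam μ z p.2 * resid ν lam z g p ^ 2))))
    (((((allLp_rho_snd hzz hν0 hlam).const_mul _).add (hρr.const_mul _)).const_mul _).const_mul _)
    fun p => ?_).trans ?_
  · have hρ0 := rho_nonneg (μ := μ) (z := z) hz.pos hν0 hlam p.2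
    have hd := hz.ridgeStep_form_le (g := g) hν0 hlam p
    have hwS : sampleRidge ν lam z g p.2 ⬝ᵥ (S *ᵥ sampleRidge ν lam z g p.2) ≤
        K ^ 2 * rho c ν lam μ z p.2 :=
      (hz.sampleRidge_form_le hν0 hlam p.2).trans (by
        rw [mul_comm]; exact mul_le_mul_of_nonneg_right (mean_sq_le hK hν0 hM p.2) hρ0)
    rw [fullRidge]
    set w := sampleRidge ν lam z g p.2
    set d := ridgeStep ν lam z g p
    set q := rho c ν lam μ z p.2 * resid ν lam z g p ^ 2
    have hq : 0 ≤ q := mul_nonneg hρ0 (sq_nonneg _)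
    have hbil : ∀ a b : Fin n → ℝ, |a ⬝ᵥ (S *ᵥ b)| ≤
        2⁻¹ * (rate ν * (a ⬝ᵥ (S *ᵥ a)) + (rate ν)⁻¹ * (b ⬝ᵥ (S *ᵥ b))) := fun a b => by
      have h1 := hS.form_sq_le a b
      have ha := hS.form_nonneg a
      have hb := hS.form_nonneg b
      have h2 := abs_mul_le_weighted_sq_add_sq hε √(a ⬝ᵥ (S *ᵥ a)) √(b ⬝ᵥ (S *ᵥ b))
      rw [Real.sq_sqrt ha, Real.sq_sqrt hb, ← Real.sqrt_mul ha] at h2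
      exact (Real.abs_le_sqrt h1).trans ((le_abs_self _).trans h2)
    have hbil1 : ∀ a b : Fin n → ℝ, |a ⬝ᵥ (S *ᵥ b)| ≤
        2⁻¹ * (a ⬝ᵥ (S *ᵥ a) + b ⬝ᵥ (S *ᵥ b)) := fun a b => by
      have h1 := form_add_smul hS.transpose_eq a b 1
      have h2 := form_add_smul hS.transpose_eq a b (-1)
      have h3 := hS.form_nonneg (a + (1 : ℝ) • b)
      have h4 := hS.form_nonneg (a + (-1 : ℝ) • b)
      rw [abs_le]; constructor <;> linarith
    have e1 := hbil (H *ᵥ w) d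
    have e2 := hbil w (H *ᵥ d)
    have e3 := hbil1 (H *ᵥ d) d
    rw [dotProduct_mulVec_comm hS.transpose_eq] at e2
    have hHw := hH.form_le w
    have hHd := hH.form_le d
    have hwS0 := hS.form_nonneg w
    have hdS0 := hS.form_nonneg d
    have hL2 : 1 ≤ L ^ 2 := one_le_pow₀ hL
    have hd' : (rate ν)⁻¹ * (d ⬝ᵥ (S *ᵥ d)) ≤ rate ν * q := by
      calc _ ≤ (rate ν)⁻¹ * (ν⁻¹ * q) := by gcongr
        _ = ((rate ν)⁻¹ * ν⁻¹) * q := by ring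
        _ = _ := by rw [inv_rate_mul hν0]
    have hd1 : d ⬝ᵥ (S *ᵥ d) ≤ rate ν * q := by
      refine le_trans ?_ hd'
      exact le_mul_of_one_le_left hdS0 ((one_le_inv₀ hε).2 hε1)
    have b1 : rate ν * ((H *ᵥ w) ⬝ᵥ (S *ᵥ (H *ᵥ w))) ≤
        L ^ 2 * (rate ν * (K ^ 2 * rho c ν lam μ z p.2)) := by
      calc _ ≤ rate ν * (L ^ 2 * (K ^ 2 * rho c ν lam μ z p.2)) := by
            gcongr; exact hHw.trans (by gcongr)
        _ = _ := by ring
    have b2 : (rate ν)⁻¹ * (d ⬝ᵥ (S *ᵥ d)) ≤ L ^ 2 * (rate ν * q) :=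
      hd'.trans (le_mul_of_one_le_left (by positivity) hL2)
    have b3 : rate ν * (w ⬝ᵥ (S *ᵥ w)) ≤ L ^ 2 * (rate ν * (K ^ 2 * rho c ν lam μ z p.2)) :=
      (mul_le_mul_of_nonneg_left hwS hε.le).trans (le_mul_of_one_le_left (by positivity) hL2)
    have b4 : (rate ν)⁻¹ * ((H *ᵥ d) ⬝ᵥ (S *ᵥ (H *ᵥ d))) ≤ L ^ 2 * (rate ν * q) := by
      calc _ ≤ (rate ν)⁻¹ * (L ^ 2 * (d ⬝ᵥ (S *ᵥ d))) := by gcongr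
        _ = L ^ 2 * ((rate ν)⁻¹ * (d ⬝ᵥ (S *ᵥ d))) := by ring
        _ ≤ _ := by gcongr
    have b5 : (H *ᵥ d) ⬝ᵥ (S *ᵥ (H *ᵥ d)) ≤ L ^ 2 * (rate ν * q) :=
      hHd.trans (by gcongr)
    have b6 : d ⬝ᵥ (S *ᵥ d) ≤ L ^ 2 * (rate ν * q) :=
      hd1.trans (le_mul_of_one_le_left (by positivity) hL2)
    have hexp : (H *ᵥ (w + d)) ⬝ᵥ (S *ᵥ (w + d)) - (H *ᵥ w) ⬝ᵥ (S *ᵥ w) =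
        (H *ᵥ w) ⬝ᵥ (S *ᵥ d) + (H *ᵥ d) ⬝ᵥ (S *ᵥ w) + (H *ᵥ d) ⬝ᵥ (S *ᵥ d) := by
      simp only [Matrix.mulVec_add, dotProduct_add, add_dotProduct]; ring
    rw [hexp]
    refine (abs_add_three _ _ _).trans ?_
    linarith
  · rw [integral_const_mul, integral_const_mul,
      AllLp.integral_add ((allLp_rho_snd hzz hν0 hlam).const_mul _) (hρr.const_mul _),
      integral_const_mul, integral_const_mul]
    have h1 := integral_rho_mul_resid_sq_le hzz hg hν0 hlam hρ hr
    have h2 := integral_rho_snd_le (c := c) hzz hν0 hlam hρ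
    gcongr

/-- The constant of `Concentrated.abs_integral_dotProduct_fullRidge_le`. -/
def linearBound (c lam Λ D F A : ℝ) : ℝ :=
  8 * (c * (lam⁻¹ * (Λ * A)) ^ 2 + (Λ ^ 2 * A) ^ 2) + D + F + (1 + Λ ^ 2 * A * D)

/-- The normal equations in expectation: linear functionals of the weights concentrate at those of
the solution of the population equation. -/
lemma Concentrated.abs_integral_dotProduct_fullRidge_le (hz : Concentrated c μ z)
    (hg : AllLp g μ) (hν : ν = (M + 1 : ℕ)) (hlam : 0 < lam) {δ Λ D F A : ℝ}
    (hδ : 0 ≤ δ) (hΛ : 1 + δ ≤ Λ) (hA : 0 ≤ A)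
    (hρ : ∫ V : Fin M → X, rho c ν lam μ z V ^ 2 ∂(Measure.pi fun _ => μ) ≤ D)
    (hr : ∫ p : X × (Fin M → X), resid ν lam z g p ^ 4 ∂(μ.prod (Measure.pi fun _ => μ)) ≤ D)
    (hs : ∫ p : X × (Fin M → X), (shrink ν lam z p - (1 + δ)⁻¹) ^ 2
      ∂(μ.prod (Measure.pi fun _ => μ)) ≤ F * ν⁻¹)
    {v : Fin n → ℝ} (hv : ∀ d, (v ⬝ᵥ d) ^ 2 ≤ A * (d ⬝ᵥ (secondMoment μ z *ᵥ d))) :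
    |∫ p : X × (Fin M → X), v ⬝ᵥ fullRidge ν lam z g p ∂(μ.prod (Measure.pi fun _ => μ)) -
      (1 + δ)⁻¹ * ((qBar (secondMoment μ z) lam δ *ᵥ v) ⬝ᵥ crossMoment μ g z)| ≤
      rate ν * linearBound c lam Λ D F A := by
  have hν0 : 0 < ν := by rw [hν]; positivity
  have hzz := hz.allLp
  set S := secondMoment μ z with hSdef
  have hS : S.PosSemidef := secondMoment_posSemidef hzz
  set a := qBar S lam δ *ᵥ v with ha
  obtain ⟨hb1, hb2⟩ := qBar_mulVec_bound hS hlam hδ hΛ hA hv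
  rw [← ha] at hb1 hb2
  have hε := rate_pos hν0
  -- the population equation `v = lam a + S a / (1 + δ)`
  have hva : v = lam • a + (1 + δ)⁻¹ • (S *ᵥ a) := by
    have h := (qBar_coercive (lam := lam) hS hδ).mulVec_inv hlam v
    change _ *ᵥ a = v at h
    rw [← h, Matrix.add_mulVec, Matrix.smul_mulVec, Matrix.smul_mulVec, Matrix.one_mulVec,
      add_comm]
  have hlin : ∀ (y : Fin n → ℝ), AllLp (fun p : X × (Fin M → X) => y ⬝ᵥ fullRidge ν lam z g p)
      (μ.prod (Measure.pi fun _ => μ)) := fun y =>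
    AllLp.dotProduct (fun _ => .const _) (allLp_fullRidge hzz hg hν0 hlam)
  have haz : AllLp (fun p : X × (Fin M → X) => a ⬝ᵥ leftOut z p)
      (μ.prod (Measure.pi fun _ => μ)) :=
    AllLp.dotProduct (fun _ => .const _) (allLp_leftOut hzz)
  have hres := allLp_resid (M := M) hzz hg hν0 hlam
  have hsh := allLp_shrink (M := M) hzz hν0 hlam
  -- the exact normal equation
  have e1 : lam * ∫ p : X × (Fin M → X), a ⬝ᵥ fullRidge ν lam z g p
      ∂(μ.prod (Measure.pi fun _ => μ)) =
      ∫ p : X × (Fin M → X), ((a ⬝ᵥ leftOut z p) * resid ν lam z g p) * shrink ν lam z p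
        ∂(μ.prod (Measure.pi fun _ => μ)) := by
    rw [integral_fullRidge hν0 hlam (fun w => a ⬝ᵥ w), ← integral_const_mul,
      ← integral_average ((haz.mul hres).mul hsh) hν]
    congr 1; funext U
    rw [smul_sampleRidge_dotProduct hν0 hlam]
    simp only [leftOut, mul_assoc]
  -- the shrinking factor is replaced by `1 / (1 + δ)`
  have e2 := abs_integral_mul_sub_le (haz.mul hres) hsh hν0
    (integral_mul_sq_le_of_four haz hres (A := 8 * (c * (lam⁻¹ * (Λ * A)) ^ 2 +
      (Λ ^ 2 * A) ^ 2)) ?_ hr) hs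
  swap
  · refine (integral_prod_le_of_inner (h := fun _ => 8 * (c * (lam⁻¹ * (Λ * A)) ^ 2 +
      (Λ ^ 2 * A) ^ 2)) (haz.pow 4).integrable (integrable_const _) fun V => ?_).trans (by simp)
    refine (hz.dotProduct_four_le a).trans ?_
    have := dotProduct_self_nonneg' a
    have := hS.form_nonneg a
    have := hz.pos
    gcongr
  -- the left-out sample is independent of the weights
  have e3 : ∫ p : X × (Fin M → X), (a ⬝ᵥ leftOut z p) * resid ν lam z g p
      ∂(μ.prod (Measure.pi fun _ => μ)) = a ⬝ᵥ crossMoment μ g z -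
      ∫ p : X × (Fin M → X), (S *ᵥ a) ⬝ᵥ sampleRidge ν lam z g p.2
        ∂(μ.prod (Measure.pi fun _ => μ)) := by
    have hw : AllLp (fun V : Fin M → X => (S *ᵥ a) ⬝ᵥ sampleRidge ν lam z g V)
        (Measure.pi fun _ => μ) :=
      AllLp.dotProduct (fun _ => .const _) (allLp_sampleRidge hzz hg hν0 hlam)
    rw [integral_dotProduct_mul_resid hzz hg hν0 hlam (a := fun _ => a) fun _ => .const _,
      integral_prod_symm _ (hw.comp measurePreserving_snd).integrable]
    have hcomm : ∀ w, a ⬝ᵥ (S *ᵥ w) = (S *ᵥ a) ⬝ᵥ w := fun w => by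
      rw [dotProduct_mulVec_comm hS.transpose_eq, dotProduct_comm]
    simp only [← hSdef, hcomm]
    rw [AllLp.integral_sub (.const _) hw]
    simp
  have hSa : ∀ d, ((S *ᵥ a) ⬝ᵥ d) ^ 2 ≤ (Λ ^ 2 * A) * (d ⬝ᵥ (S *ᵥ d)) := fun d => by
    rw [dotProduct_comm]
    refine (hS.form_sq_le d a).trans ?_
    rw [mul_comm]
    exact mul_le_mul_of_nonneg_right hb1 (hS.form_nonneg d)
  have e4 := hz.abs_integral_dotProduct_fullRidge_sub_le hg hν0 hlam (by positivity) hρ hr hSa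
  have e5 : ∫ p : X × (Fin M → X), v ⬝ᵥ fullRidge ν lam z g p ∂(μ.prod (Measure.pi fun _ => μ)) =
      lam * ∫ p : X × (Fin M → X), a ⬝ᵥ fullRidge ν lam z g p
        ∂(μ.prod (Measure.pi fun _ => μ)) +
      (1 + δ)⁻¹ * ∫ p : X × (Fin M → X), (S *ᵥ a) ⬝ᵥ fullRidge ν lam z g p
        ∂(μ.prod (Measure.pi fun _ => μ)) := by
    rw [← integral_const_mul, ← integral_const_mul,
      ← AllLp.integral_add ((hlin a).const_mul _) ((hlin _).const_mul _)]
    congr 1; funext p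
    conv_lhs => rw [hva]
    rw [add_dotProduct, smul_dotProduct, smul_dotProduct, smul_eq_mul, smul_eq_mul]
  have hu0 : 0 ≤ (1 + δ)⁻¹ := by positivity
  have hu1 : (1 + δ)⁻¹ ≤ 1 := inv_le_one_of_one_le₀ (by linarith)
  rw [e5, e1]
  rw [e3] at e2
  have e6 : |(1 + δ)⁻¹ * (∫ p : X × (Fin M → X), (S *ᵥ a) ⬝ᵥ fullRidge ν lam z g p
        ∂(μ.prod (Measure.pi fun _ => μ)) - ∫ p : X × (Fin M → X), (S *ᵥ a) ⬝ᵥ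
          sampleRidge ν lam z g p.2 ∂(μ.prod (Measure.pi fun _ => μ)))| ≤
      rate ν * (1 + Λ ^ 2 * A * D) := by
    rw [abs_mul, abs_of_nonneg hu0]
    exact (mul_le_of_le_one_left (abs_nonneg _) hu1).trans e4
  have := (abs_add_le _ _).trans (add_le_add e2 e6)
  refine le_trans (le_of_eq ?_) (this.trans (le_of_eq ?_))
  · congr 1; ring
  · rw [linearBound]; ring

end LinearFunctionals

/-! ### Quadratic functionals of the weights -/

section QuadraticFunctionals

variable {X : Type*} [MeasurableSpace X] {n M : ℕ} {μ : Measure X} [IsProbabilityMeasure μ]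
  {z : X → Fin n → ℝ} {g : X → ℝ} {c ν lam : ℝ}

/-- The error of the linear predictor with weights `w`, averaged over the test input. -/
def predRisk (μ : Measure X) (z : X → Fin n → ℝ) (g : X → ℝ) (w : Fin n → ℝ) : ℝ :=
  ∫ x, (g x - w ⬝ᵥ z x) ^ 2 ∂μ

lemma AllLp.memLp_two (hg : AllLp g μ) : MemLp g 2 μ :=
  (memLp_two_iff_integrable_sq hg.1).2 (hg.pow 2).integrable

lemma integrable_mul_dotProduct (hz : ∀ i, AllLp (fun x => z x i) μ) (hg : MemLp g 2 μ)
    (w : Fin n → ℝ) : Integrable (fun x => g x * (w ⬝ᵥ z x)) μ :=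
  hg.integrable_mul (AllLp.memLp_two (AllLp.dotProduct (fun i => .const (w i)) hz))

lemma integrable_mul_apply (hz : ∀ i, AllLp (fun x => z x i) μ) (hg : MemLp g 2 μ)
    (i : Fin n) : Integrable (fun x => g x * z x i) μ :=
  hg.integrable_mul (hz i).memLp_two

lemma predRisk_eq (hz : ∀ i, AllLp (fun x => z x i) μ) (hg : MemLp g 2 μ) (w : Fin n → ℝ) :
    predRisk μ z g w = ∫ x, g x ^ 2 ∂μ - 2 * (crossMoment μ g z ⬝ᵥ w) +
      w ⬝ᵥ (secondMoment μ z *ᵥ w) := by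
  have hw : AllLp (fun x => w ⬝ᵥ z x) μ := AllLp.dotProduct (fun _ => .const _) hz
  have hgw := integrable_mul_dotProduct hz hg w
  have h : ∀ x, (g x - w ⬝ᵥ z x) ^ 2 = g x ^ 2 - 2 * (g x * (w ⬝ᵥ z x)) + (w ⬝ᵥ z x) ^ 2 :=
    fun x => by ring
  simp only [predRisk, h]
  rw [integral_add (f := fun x => g x ^ 2 - 2 * (g x * (w ⬝ᵥ z x)))
      (hg.integrable_sq.sub (hgw.const_mul 2)) (hw.pow 2).integrable,
    integral_sub hg.integrable_sq (hgw.const_mul 2), integral_const_mul,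
    integral_dotProduct_sq hz, integral_label_mul_dotProduct (integrable_mul_apply hz hg),
    dotProduct_comm w (crossMoment μ g z)]

/-- The squared error of the deterministic equivalent of the weights. -/
def equivRisk (μ : Measure X) (z : X → Fin n → ℝ) (g : X → ℝ) (lam δ : ℝ) : ℝ :=
  ∫ x, g x ^ 2 ∂μ -
    2 * ((1 + δ)⁻¹ * ((qBar (secondMoment μ z) lam δ *ᵥ crossMoment μ g z) ⬝ᵥ
      crossMoment μ g z)) +
    (1 + δ)⁻¹ ^ 2 * ((qBar (secondMoment μ z) lam δ *ᵥ crossMoment μ g z) ⬝ᵥ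
      (secondMoment μ z *ᵥ (qBar (secondMoment μ z) lam δ *ᵥ crossMoment μ g z)))

/-- The quadratic functional of the weights, in terms of its deterministic equivalent and of the
leave-one-out error. -/
lemma Concentrated.abs_integral_form_fullRidge_le (hz : Concentrated c μ z)
    (hg : AllLp g μ) (hν : ν = (M + 1 : ℕ)) (hlam : 0 < lam) {δ Λ D F K α : ℝ}
    (hδ : 0 ≤ δ) (hΛ : 1 + δ ≤ Λ) (hK : ∀ x, |g x| ≤ K)
    (hρ : ∫ V : Fin M → X, rho c ν lam μ z V ^ 2 ∂(Measure.pi fun _ => μ) ≤ D)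
    (hw4 : ∫ p : X × (Fin M → X), (((secondMoment μ z * qBar (secondMoment μ z) lam δ) *ᵥ
      sampleRidge ν lam z g p.2) ⬝ᵥ leftOut z p) ^ 4 ∂(μ.prod (Measure.pi fun _ => μ)) ≤ D)
    (hr : ∫ p : X × (Fin M → X), resid ν lam z g p ^ 4 ∂(μ.prod (Measure.pi fun _ => μ)) ≤ D)
    (hs : ∫ p : X × (Fin M → X), (shrink ν lam z p - (1 + δ)⁻¹) ^ 2
      ∂(μ.prod (Measure.pi fun _ => μ)) ≤ F * ν⁻¹)
    (hα : ∫ p : X × (Fin M → X), (lev ν lam z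
        (secondMoment μ z * qBar (secondMoment μ z) lam δ) p * shrink ν lam z p ^ 2 - α) ^ 2
      ∂(μ.prod (Measure.pi fun _ => μ)) ≤ F * ν⁻¹) :
    |∫ p : X × (Fin M → X), fullRidge ν lam z g p ⬝ᵥ
        (secondMoment μ z *ᵥ fullRidge ν lam z g p) ∂(μ.prod (Measure.pi fun _ => μ)) -
      ((1 + δ)⁻¹ ^ 2 * ((qBar (secondMoment μ z) lam δ *ᵥ crossMoment μ g z) ⬝ᵥ
        (secondMoment μ z *ᵥ (qBar (secondMoment μ z) lam δ *ᵥ crossMoment μ g z))) +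
      α * ∫ p : X × (Fin M → X), resid ν lam z g p ^ 2 ∂(μ.prod (Measure.pi fun _ => μ)))| ≤
      rate ν * ((D + D + F) + (D + F) + Λ ^ 2 * (K ^ 2 * (1 + D) + 2 * D) +
        (1 + Λ ^ 2 * K ^ 2 * D) + linearBound c lam Λ D F (Λ ^ 2 * K ^ 2)) := by
  have hν0 : 0 < ν := by rw [hν]; positivity
  have hν1 : 1 ≤ ν := by rw [hν]; push_cast; linarith [(Nat.cast_nonneg M : (0 : ℝ) ≤ M)]
  have hMν : M ≤ ν := by rw [hν]; push_cast; linarith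
  have hzz := hz.allLp
  set S := secondMoment μ z with hSdef
  have hS : S.PosSemidef := secondMoment_posSemidef hzz
  set b := crossMoment μ g z with hb
  set a := qBar S lam δ *ᵥ b with ha
  set G := S * qBar S lam δ with hG
  have hH : Multiplier S G (1 + δ) := multiplier_mul_qBar hS hlam hδ
  have hH' : Multiplier S G Λ := by
    have hp := hH.pos
    have hsq : (1 + δ) ^ 2 ≤ Λ ^ 2 := by gcongr
    exact ⟨hH.symm, by linarith,
      fun v => (hH.normSq_le v).trans
        (mul_le_mul_of_nonneg_right hsq (dotProduct_self_nonneg' v)),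
      fun v => (hH.form_le v).trans (mul_le_mul_of_nonneg_right hsq (hS.form_nonneg v))⟩
  have hw := allLp_sampleRidge_snd (M := M) hzz hg hν0 hlam
  have hw0 := allLp_sampleRidge (M := M) hzz hg hν0 hlam
  have hf := allLp_fullRidge (M := M) hzz hg hν0 hlam
  have hres := allLp_resid (M := M) hzz hg hν0 hlam
  have hsh := allLp_shrink (M := M) hzz hν0 hlam
  have hlev := allLp_lev (M := M) hzz hν0 hlam G
  have hlo := allLp_leftOut (M := M) hzz
  have hGw : AllLp (fun p : X × (Fin M → X) => (G *ᵥ sampleRidge ν lam z g p.2) ⬝ᵥ leftOut z p)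
      (μ.prod (Measure.pi fun _ => μ)) :=
    AllLp.dotProduct (AllLp.mulVec (fun _ _ => .const _) hw) hlo
  have hGf : AllLp (fun p : X × (Fin M → X) => (G *ᵥ fullRidge ν lam z g p) ⬝ᵥ leftOut z p)
      (μ.prod (Measure.pi fun _ => μ)) :=
    AllLp.dotProduct (AllLp.mulVec (fun _ _ => .const _) hf) hlo
  have hε := rate_pos hν0
  have hu0 : 0 ≤ (1 + δ)⁻¹ := by positivity
  have hu1 : (1 + δ)⁻¹ ≤ 1 := inv_le_one_of_one_le₀ (by linarith)
  -- the exact normal equation, tested against `G w`; as `w` depends on the left-out sample, its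
  -- step contributes the term with the squared residual
  have e1 : lam * ∫ p : X × (Fin M → X), (G *ᵥ fullRidge ν lam z g p) ⬝ᵥ fullRidge ν lam z g p
      ∂(μ.prod (Measure.pi fun _ => μ)) =
      ∫ p : X × (Fin M → X), (((G *ᵥ sampleRidge ν lam z g p.2) ⬝ᵥ leftOut z p) *
        resid ν lam z g p) * shrink ν lam z p ∂(μ.prod (Measure.pi fun _ => μ)) +
      ∫ p : X × (Fin M → X), resid ν lam z g p ^ 2 * (lev ν lam z G p * shrink ν lam z p ^ 2)
        ∂(μ.prod (Measure.pi fun _ => μ)) := by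
    rw [← AllLp.integral_add ((hGw.mul hres).mul hsh) ((hres.pow 2).mul (hlev.mul (hsh.pow 2)))]
    have h1 : ∀ p : X × (Fin M → X), ((G *ᵥ sampleRidge ν lam z g p.2) ⬝ᵥ leftOut z p) *
        resid ν lam z g p * shrink ν lam z p +
        resid ν lam z g p ^ 2 * (lev ν lam z G p * shrink ν lam z p ^ 2) =
        ((G *ᵥ fullRidge ν lam z g p) ⬝ᵥ leftOut z p) * resid ν lam z g p *
          shrink ν lam z p := fun p => by
      rw [fullRidge, Matrix.mulVec_add, add_dotProduct, ridgeStep, Matrix.mulVec_smul,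
        smul_dotProduct, Matrix.mulVec_mulVec, dotProduct_comm _ (leftOut z p),
        dotProduct_comm _ (leftOut z p), smul_eq_mul, lev]
      ring
    simp only [h1]
    rw [integral_fullRidge hν0 hlam (fun w => (G *ᵥ w) ⬝ᵥ w), ← integral_const_mul,
      ← integral_average ((hGf.mul hres).mul hsh) hν]
    congr 1; funext U
    rw [smul_sampleRidge_dotProduct hν0 hlam]
    simp only [leftOut, mul_assoc, fullRidge_removeNth hν0 hlam]
  -- the shrinking factor is replaced by `1 / (1 + δ)`, the coefficient of the residual by `α`
  have e2 := abs_integral_mul_sub_le (hGw.mul hres) hsh hν0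
    (integral_mul_sq_le_of_four hGw hres hw4 hr) hs
  have e3 := abs_integral_mul_sub_le (hres.pow 2) (hlev.mul (hsh.pow 2)) hν0
    (D := D) (by simpa only [← pow_mul] using hr) hα
  have hGS : AllLp (fun V : Fin M → X => (G *ᵥ sampleRidge ν lam z g V) ⬝ᵥ
      (S *ᵥ sampleRidge ν lam z g V)) (Measure.pi fun _ => μ) :=
    AllLp.dotProduct (AllLp.mulVec (fun _ _ => .const _) hw0)
      (AllLp.mulVec (fun _ _ => .const _) hw0)
  have hSaw : AllLp (fun V : Fin M → X => (S *ᵥ a) ⬝ᵥ sampleRidge ν lam z g V)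
      (Measure.pi fun _ => μ) := AllLp.dotProduct (fun _ => .const _) hw0
  have e4 : ∫ p : X × (Fin M → X), ((G *ᵥ sampleRidge ν lam z g p.2) ⬝ᵥ leftOut z p) *
      resid ν lam z g p ∂(μ.prod (Measure.pi fun _ => μ)) =
      ∫ p : X × (Fin M → X), (S *ᵥ a) ⬝ᵥ sampleRidge ν lam z g p.2
        ∂(μ.prod (Measure.pi fun _ => μ)) -
      ∫ p : X × (Fin M → X), (G *ᵥ sampleRidge ν lam z g p.2) ⬝ᵥ
        (S *ᵥ sampleRidge ν lam z g p.2) ∂(μ.prod (Measure.pi fun _ => μ)) := by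
    rw [integral_dotProduct_mul_resid hzz hg hν0 hlam
      (a := fun V => G *ᵥ sampleRidge ν lam z g V) (AllLp.mulVec (fun _ _ => .const _) hw0),
      integral_prod_symm _ (hSaw.comp measurePreserving_snd).integrable,
      integral_prod_symm _ (hGS.comp measurePreserving_snd).integrable]
    have hcomm : ∀ w, (G *ᵥ w) ⬝ᵥ b = (S *ᵥ a) ⬝ᵥ w := fun w => by
      rw [dotProduct_comm, dotProduct_mulVec_comm hH.symm, dotProduct_comm, ha,
        Matrix.mulVec_mulVec]
    simp only [← hSdef, ← hb, hcomm]
    rw [AllLp.integral_sub hSaw hGS]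
    simp
  -- the matrix identity `S = lam G + G S / (1 + δ)`
  have hid : ∀ w, w ⬝ᵥ (S *ᵥ w) = lam * ((G *ᵥ w) ⬝ᵥ w) +
      (1 + δ)⁻¹ * ((G *ᵥ w) ⬝ᵥ (S *ᵥ w)) := fun w => by
    have h1 := (qBar_coercive (lam := lam) hS hδ).inv_mulVec hlam w
    change qBar S lam δ *ᵥ _ = w at h1
    have h2 : S *ᵥ w = G *ᵥ (((1 + δ)⁻¹ • S + lam • (1 : Matrix (Fin n) (Fin n) ℝ)) *ᵥ w) := by
      rw [hG, ← Matrix.mulVec_mulVec, h1]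
    have h3 : w ⬝ᵥ (S *ᵥ w) =
        (G *ᵥ w) ⬝ᵥ (((1 + δ)⁻¹ • S + lam • (1 : Matrix (Fin n) (Fin n) ℝ)) *ᵥ w) := by
      rw [h2, dotProduct_mulVec_comm hH.symm, dotProduct_comm]
    rw [h3]
    simp only [Matrix.add_mulVec, Matrix.smul_mulVec, Matrix.one_mulVec, dotProduct_add,
      dotProduct_smul, smul_eq_mul]
    rw [add_comm]
  have e5 : ∫ p : X × (Fin M → X), fullRidge ν lam z g p ⬝ᵥ (S *ᵥ fullRidge ν lam z g p)
      ∂(μ.prod (Measure.pi fun _ => μ)) =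
      lam * ∫ p : X × (Fin M → X), (G *ᵥ fullRidge ν lam z g p) ⬝ᵥ fullRidge ν lam z g p
        ∂(μ.prod (Measure.pi fun _ => μ)) +
      (1 + δ)⁻¹ * ∫ p : X × (Fin M → X), (G *ᵥ fullRidge ν lam z g p) ⬝ᵥ
        (S *ᵥ fullRidge ν lam z g p) ∂(μ.prod (Measure.pi fun _ => μ)) := by
    have h1 : ∀ i, AllLp (fun p : X × (Fin M → X) => (G *ᵥ fullRidge ν lam z g p) i)
      (μ.prod (Measure.pi fun _ => μ)) := AllLp.mulVec (fun _ _ => .const _) hf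
    simp only [hid]
    rw [AllLp.integral_add ((AllLp.dotProduct h1 hf).const_mul _)
      ((AllLp.dotProduct h1 (AllLp.mulVec (fun i j => .const (S i j)) hf)).const_mul _),
      integral_const_mul, integral_const_mul]
  have hbK : ∀ d, (b ⬝ᵥ d) ^ 2 ≤ K ^ 2 * (d ⬝ᵥ (S *ᵥ d)) := fun d => by
    refine (crossMoment_sq_le hzz (hg.pow 2).integrable hg.1 d).trans ?_
    refine mul_le_mul_of_nonneg_right ?_ (hS.form_nonneg d)
    refine ((hg.pow 2).integral_mono (.const (K ^ 2)) fun x =>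
      sq_le_sq.2 ((hK x).trans (le_abs_self K))).trans (by simp)
  obtain ⟨hb1, -⟩ := qBar_mulVec_bound hS hlam hδ hΛ (sq_nonneg K) hbK
  rw [← ha] at hb1
  have hSa : ∀ d, ((S *ᵥ a) ⬝ᵥ d) ^ 2 ≤ (Λ ^ 2 * K ^ 2) * (d ⬝ᵥ (S *ᵥ d)) := fun d => by
    rw [dotProduct_comm]
    refine (hS.form_sq_le d a).trans ?_
    rw [mul_comm]
    exact mul_le_mul_of_nonneg_right hb1 (hS.form_nonneg d)
  have e6 := hz.abs_integral_form_fullRidge_sub_le hg hlam hν1 hMν hK hρ hr hH' (by linarith)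
  have e7 := hz.abs_integral_dotProduct_fullRidge_sub_le hg hν0 hlam (by positivity) hρ hr hSa
  have e8 := hz.abs_integral_dotProduct_fullRidge_le hg hν hlam hδ hΛ (by positivity) hρ hr hs hSa
  have e9 : (qBar S lam δ *ᵥ (S *ᵥ a)) ⬝ᵥ b = a ⬝ᵥ (S *ᵥ a) := by
    rw [dotProduct_comm, dotProduct_mulVec_comm (qBar_posSemidef hS hlam hδ).transpose_eq,
      ← ha, dotProduct_comm]
  rw [← hSdef, ← hb, e9] at e8
  rw [← hSdef] at e6
  rw [e5, e1]
  rw [e4] at e2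
  rw [abs_sub_comm] at e7
  have hmul : ∀ t B : ℝ, |t| ≤ B → |(1 + δ)⁻¹ * t| ≤ B := fun t B h => by
    rw [abs_mul, abs_of_nonneg hu0]
    exact (mul_le_of_le_one_left (abs_nonneg _) hu1).trans h
  have := (abs_add_le _ _).trans (add_le_add ((abs_add_le _ _).trans (add_le_add
    ((abs_add_le _ _).trans (add_le_add ((abs_add_le _ _).trans (add_le_add e2 e3))
    (hmul _ _ e6))) (hmul _ _ e7))) (hmul _ _ e8))
  refine le_trans (le_of_eq ?_) (this.trans (le_of_eq ?_))
  · congr 1; ring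
  · ring

/-- The leave-one-out estimate for the error of the ridge predictor with bounded labels, in terms of
moment bounds. -/
lemma Concentrated.abs_integral_predRisk_le (hz : Concentrated c μ z)
    (hg : AllLp g μ) (hν : ν = (M + 1 : ℕ)) (hlam : 0 < lam) {δ Λ D F K α : ℝ}
    (hδ : 0 ≤ δ) (hΛ : 1 + δ ≤ Λ) (hK : ∀ x, |g x| ≤ K) (hα1 : |α| ≤ 1)
    (hρ : ∫ V : Fin M → X, rho c ν lam μ z V ^ 2 ∂(Measure.pi fun _ => μ) ≤ D)
    (hw4 : ∫ p : X × (Fin M → X), (((secondMoment μ z * qBar (secondMoment μ z) lam δ) *ᵥ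
      sampleRidge ν lam z g p.2) ⬝ᵥ leftOut z p) ^ 4 ∂(μ.prod (Measure.pi fun _ => μ)) ≤ D)
    (hr : ∫ p : X × (Fin M → X), resid ν lam z g p ^ 4 ∂(μ.prod (Measure.pi fun _ => μ)) ≤ D)
    (hs : ∫ p : X × (Fin M → X), (shrink ν lam z p - (1 + δ)⁻¹) ^ 2
      ∂(μ.prod (Measure.pi fun _ => μ)) ≤ F * ν⁻¹)
    (hα : ∫ p : X × (Fin M → X), (lev ν lam z
        (secondMoment μ z * qBar (secondMoment μ z) lam δ) p * shrink ν lam z p ^ 2 - α) ^ 2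
      ∂(μ.prod (Measure.pi fun _ => μ)) ≤ F * ν⁻¹) :
    |(1 - α) * ∫ U : Fin (M + 1) → X, predRisk μ z g (sampleRidge ν lam z g U)
        ∂(Measure.pi fun _ => μ) - equivRisk μ z g lam δ| ≤
      rate ν * (2 * linearBound c lam Λ D F (K ^ 2) +
        ((D + D + F) + (D + F) + Λ ^ 2 * (K ^ 2 * (1 + D) + 2 * D) +
        (1 + Λ ^ 2 * K ^ 2 * D) + linearBound c lam Λ D F (Λ ^ 2 * K ^ 2)) +
        (2 * (1 + K ^ 2 * D) + (K ^ 2 * (1 + D) + 2 * D))) := by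
  have hν0 : 0 < ν := by rw [hν]; positivity
  have hν1 : 1 ≤ ν := by rw [hν]; push_cast; linarith [(Nat.cast_nonneg M : (0 : ℝ) ≤ M)]
  have hMν : M ≤ ν := by rw [hν]; push_cast; linarith
  have hzz := hz.allLp
  have hS := secondMoment_posSemidef hzz
  have hw := allLp_sampleRidge_snd (M := M) hzz hg hν0 hlam
  have hw0 := allLp_sampleRidge (M := M) hzz hg hν0 hlam
  have hf := allLp_fullRidge (M := M) hzz hg hν0 hlam
  have hres := allLp_resid (M := M) hzz hg hν0 hlam
  have hbK : ∀ d, (crossMoment μ g z ⬝ᵥ d) ^ 2 ≤ K ^ 2 * (d ⬝ᵥ (secondMoment μ z *ᵥ d)) :=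
    fun d => by
    refine (crossMoment_sq_le hzz (hg.pow 2).integrable hg.1 d).trans ?_
    refine mul_le_mul_of_nonneg_right ?_ (hS.form_nonneg d)
    refine ((hg.pow 2).integral_mono (.const (K ^ 2)) fun x =>
      sq_le_sq.2 ((hK x).trans (le_abs_self K))).trans (by simp)
  have e1 := hz.abs_integral_form_fullRidge_le hg hν hlam hδ hΛ hK hρ hw4 hr hs hα
  have e2 := hz.abs_integral_dotProduct_fullRidge_le hg hν hlam hδ hΛ (by positivity) hρ hr hs hbK
  have e3 := hz.abs_integral_dotProduct_fullRidge_sub_le hg hν0 hlam (by positivity) hρ hr hbK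
  have e4 := hz.abs_integral_form_fullRidge_sub_le hg hlam hν1 hMν hK hρ hr
    (Multiplier.one (secondMoment μ z)) le_rfl
  simp only [Matrix.one_mulVec, one_pow, one_mul] at e4
  have hexp : ∀ w : X × (Fin M → X) → Fin n → ℝ,
      (∀ i, AllLp (fun p => w p i) (μ.prod (Measure.pi fun _ => μ))) →
      ∫ p, predRisk μ z g (w p) ∂(μ.prod (Measure.pi fun _ => μ)) = ∫ x, g x ^ 2 ∂μ -
        2 * ∫ p, crossMoment μ g z ⬝ᵥ w p ∂(μ.prod (Measure.pi fun _ => μ)) +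
        ∫ p, w p ⬝ᵥ (secondMoment μ z *ᵥ w p) ∂(μ.prod (Measure.pi fun _ => μ)) :=
    fun w hw => by
    have h1 : AllLp (fun p => crossMoment μ g z ⬝ᵥ w p) (μ.prod (Measure.pi fun _ => μ)) :=
      AllLp.dotProduct (fun _ => .const _) hw
    have h2 : AllLp (fun p => w p ⬝ᵥ (secondMoment μ z *ᵥ w p))
        (μ.prod (Measure.pi fun _ => μ)) :=
      AllLp.dotProduct hw (AllLp.mulVec (fun _ _ => .const _) hw)
    simp only [predRisk_eq hzz hg.memLp_two]
    rw [AllLp.integral_add ((AllLp.const _).sub (h1.const_mul _)) h2,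
      AllLp.integral_sub (.const _) (h1.const_mul _), integral_const_mul]
    simp
  -- the squared residual is the error of the leave-one-out weights, so that `α` multiplies, up to a
  -- small error, the quantity on the left-hand side
  have e5 : ∫ p : X × (Fin M → X), resid ν lam z g p ^ 2 ∂(μ.prod (Measure.pi fun _ => μ)) =
      ∫ p : X × (Fin M → X), predRisk μ z g (sampleRidge ν lam z g p.2)
        ∂(μ.prod (Measure.pi fun _ => μ)) := by
    rw [integral_prod_symm _ (hres.pow 2).integrable,
      integral_fun_snd (fun V => predRisk μ z g (sampleRidge ν lam z g V))]
    simp [predRisk, resid, leftOut, dotProduct_comm]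
  rw [hexp _ hw] at e5
  rw [← integral_fullRidge hν0 hlam (fun w => predRisk μ z g w), hexp _ hf, equivRisk]
  rw [e5] at e1
  have e6 := (abs_add_le _ _).trans (add_le_add
    ((abs_mul _ _).trans_le (mul_le_mul_of_nonneg_left e3 (abs_nonneg (2 : ℝ)))) 
      ((abs_sub_comm _ _).trans_le e4))
  have hα' : ∀ t B : ℝ, |t| ≤ B → |α * t| ≤ B := fun t B h => by
    rw [abs_mul]
    exact (mul_le_of_le_one_left (abs_nonneg _) hα1).trans h
  have := (abs_add_le _ _).trans (add_le_add ((abs_add_le _ _).trans (add_le_add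
    ((abs_mul _ _).trans_le (mul_le_mul_of_nonneg_left e2 (abs_nonneg (-2 : ℝ)))) e1))
    (hα' _ _ e6))
  rw [abs_neg, abs_two] at this
  refine le_trans (le_of_eq ?_) (this.trans (le_of_eq ?_))
  · congr 1; ring
  · ring

end QuadraticFunctionals

/-! ### The coefficient `α` -/

section FixedPoint

variable {n N : ℕ} {S : Matrix (Fin n) (Fin n) ℝ} {lam d : ℝ}

lemma alpha_nonneg (N : ℕ) (S : Matrix (Fin n) (Fin n) ℝ) (lam d : ℝ) :
    0 ≤ alpha N S lam d := by
  rw [alpha, frobeniusSq]; positivity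

/-- `α ≤ δ / (1 + δ)`. -/
lemma alpha_le (hS : S.PosSemidef) (hlam : 0 < lam) (hδ : IsDelta N S lam d) :
    alpha N S lam d ≤ d * (1 + d)⁻¹ := by
  have hd := hδ.1
  rcases Nat.eq_zero_or_pos N with rfl | hN
  · rw [alpha]; simp; positivity
  · have hN' : (0 : ℝ) < N := by exact_mod_cast hN
    have h := (le_abs_self _).trans (abs_normTrace_le hN' (multiplier_mul_qBar hS hlam hd) hS
      (qBar_posSemidef hS hlam hd))
    rw [isDelta_eq_normTrace hδ] at h
    rw [alpha_eq N hS hlam hd]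
    calc _ ≤ ((1 + d) * d) * (1 + d)⁻¹ ^ 2 := by gcongr
      _ = _ := by field_simp

lemma inv_le_one_sub_alpha (hS : S.PosSemidef) (hlam : 0 < lam) (hδ : IsDelta N S lam d) :
    (1 + d)⁻¹ ≤ 1 - alpha N S lam d := by
  have h := alpha_le hS hlam hδ
  have hd := hδ.1
  have h1 : d * (1 + d)⁻¹ = 1 - (1 + d)⁻¹ := by field_simp; ring
  linarith

lemma alpha_lt_one (hS : S.PosSemidef) (hlam : 0 < lam) (hδ : IsDelta N S lam d) :
    alpha N S lam d < 1 := by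
  have h := inv_le_one_sub_alpha hS hlam hδ
  have hd := hδ.1
  have : 0 < (1 + d)⁻¹ := by positivity
  linarith

end FixedPoint

/-! ### The error of the ridge predictor for bounded labels -/

section BoundedLabels

variable {X : Type*} [MeasurableSpace X] {n M : ℕ} {μ : Measure X} [IsProbabilityMeasure μ]
  {z : X → Fin n → ℝ} {g : X → ℝ} {c lam : ℝ}

/-- A bound for `1 + δ` in the proportional regime. The feature mean contributes at most `1 + δ` to
`N δ`, whatever its norm, and this contribution is absorbed on the left-hand side. -/
def deltaBound (c lam Γ : ℝ) : ℝ := 2 * (lam⁻¹ * (c * Γ)) + 2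

lemma Concentrated.one_add_delta_le (hz : Concentrated c μ z) (hlam : 0 < lam) {Γ δ : ℝ}
    (hM : 0 < M) (hn : n ≤ Γ * M) (hΓ : 0 ≤ Γ)
    (hδ : IsDelta (M + 1) (secondMoment μ z) lam δ) : 1 + δ ≤ deltaBound c lam Γ := by
  have hS := secondMoment_posSemidef hz.allLp
  have hδ0 := hδ.1
  have hB := qBar_coercive (lam := lam) hS hδ0
  have h1 := hz.trace_le (qBar_posSemidef hS hlam hδ0) (inv_nonneg.2 hlam.le)
    (hB.form_inv_le hlam)
  have h2 : (1 + δ)⁻¹ * (meanVec μ z ⬝ᵥ (qBar (secondMoment μ z) lam δ *ᵥ meanVec μ z)) ≤ 1 :=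
    hB.form_inv_le_one hlam _ fun a => by
      have h3 := meanVec_sq_le hz.allLp a
      have h4 := mul_nonneg hlam.le (dotProduct_self_nonneg' a)
      simp only [Matrix.add_mulVec, Matrix.smul_mulVec, Matrix.one_mulVec, dotProduct_add,
        dotProduct_smul, smul_eq_mul]
      rw [dotProduct_comm]
      have : (1 + δ)⁻¹ * (a ⬝ᵥ meanVec μ z) ^ 2 ≤
        (1 + δ)⁻¹ * (a ⬝ᵥ (secondMoment μ z *ᵥ a)) := by gcongr
      linarith
  rw [inv_mul_le_iff₀ (by positivity), mul_one] at h2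
  have hM1 : (1 : ℝ) ≤ M := by exact_mod_cast hM
  have h5 := hδ.2
  push_cast at h5
  have h6 : δ * (M + 1) = (secondMoment μ z * qBar (secondMoment μ z) lam δ).trace := by
    have : ((M : ℝ) + 1) ≠ 0 := by positivity
    conv_lhs => rw [h5]
    field_simp
  have h7 : lam⁻¹ * (c * n) ≤ lam⁻¹ * (c * Γ) * M := by
    have := hz.pos
    calc _ ≤ lam⁻¹ * (c * (Γ * M)) := by gcongr
      _ = _ := by ring
  rw [deltaBound]
  have h8 : 0 ≤ lam⁻¹ * (c * Γ) := by have := hz.pos; positivity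
  nlinarith

/-- A bound for the moments that enter the leave-one-out estimate. -/
def momentBound (c lam Γ Λ K : ℝ) : ℝ :=
  let B := 2 * (c * lam⁻¹) ^ 2 + 2 * meanFormBound c lam Γ
  B + (Λ ^ 2 * K ^ 2) ^ 2 * (8 * (c * lam⁻¹ ^ 2 + B)) +
    (8 * K ^ 4 + 8 * (K ^ 4 * (8 * (c * lam⁻¹ ^ 2 + B))))

/-- The constant of the leave-one-out estimate. -/
def leaveOneOutBound (c lam Γ Λ K : ℝ) : ℝ :=
  let D := momentBound c lam Γ Λ K
  let F := 48 * Λ ^ 4 * fluctBound c lam Γ (meanFormBound c lam Γ) (Λ ^ 2)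
  2 * linearBound c lam Λ D F (K ^ 2) +
    ((D + D + F) + (D + F) + Λ ^ 2 * (K ^ 2 * (1 + D) + 2 * D) +
    (1 + Λ ^ 2 * K ^ 2 * D) + linearBound c lam Λ D F (Λ ^ 2 * K ^ 2)) +
    (2 * (1 + K ^ 2 * D) + (K ^ 2 * (1 + D) + 2 * D))

/-- For bounded labels, the expected error of the ridge predictor is within `O(N^(-1/2))` of its
deterministic equivalent. -/
theorem Concentrated.abs_integral_predRisk_sub_le (hz : Concentrated c μ z) (hg : AllLp g μ)
    (hlam : 0 < lam) {K Γ δ : ℝ} (hK : ∀ x, |g x| ≤ K) (hM : 0 < M) (hn : n ≤ Γ * M)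
    (hΓ : 0 ≤ Γ) (hδ : IsDelta (M + 1) (secondMoment μ z) lam δ) :
    |∫ U : Fin (M + 1) → X, predRisk μ z g (sampleRidge (M + 1 : ℕ) lam z g U)
        ∂(Measure.pi fun _ => μ) -
      (1 - alpha (M + 1) (secondMoment μ z) lam δ)⁻¹ * equivRisk μ z g lam δ| ≤
      deltaBound c lam Γ * (rate (M + 1 : ℕ) *
        leaveOneOutBound c lam Γ (deltaBound c lam Γ) K) := by
  have hΛ := hz.one_add_delta_le hlam hM hn hΓ hδ
  set Λ := deltaBound c lam Γ
  have hzz := hz.allLp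
  have hc := hz.pos
  have hS := secondMoment_posSemidef hzz
  have hδ0 := hδ.1
  have hM1 : (1 : ℝ) ≤ M := by exact_mod_cast hM
  have hν : (0 : ℝ) < (M + 1 : ℕ) := by positivity
  have hν2 : ((M + 1 : ℕ) : ℝ) ≤ 2 * M := by push_cast; linarith
  have hMν : (M : ℝ) ≤ (M + 1 : ℕ) := by push_cast; linarith
  have hn' : n ≤ Γ * (M + 1 : ℕ) := hn.trans (by gcongr)
  have hR1 : 1 ≤ meanFormBound c lam Γ := meanFormBound_one_le hc
  have hR := hz.integral_meanForm_sq_le hν hlam hM hν2 hn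
  obtain ⟨hs, hα⟩ := hz.integral_shrink_sub_sq_le hlam hδ hΛ hΓ hn' hR1 hR
  have hα0 := alpha_nonneg (M + 1) (secondMoment μ z) lam δ
  have hα1 := alpha_lt_one hS hlam hδ
  have hH : Multiplier (secondMoment μ z) (secondMoment μ z * qBar (secondMoment μ z) lam δ)
    (1 + δ) := multiplier_mul_qBar hS hlam hδ0
  have hw2 : ∀ V : Fin M → X, sampleRidge (M + 1 : ℕ) lam z g V ⬝ᵥ
      sampleRidge (M + 1 : ℕ) lam z g V ≤ K ^ 2 * lam⁻¹ := fun V => by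
    have := ridge_normSq_le hν hlam (fun j => z (V j)) (fun j => g (V j))
    rw [← div_eq_mul_inv, le_div_iff₀ hlam, mul_comm]
    exact this.trans (mean_sq_le hK hν hMν V)
  have hwS : ∀ V : Fin M → X, sampleRidge (M + 1 : ℕ) lam z g V ⬝ᵥ
      (secondMoment μ z *ᵥ sampleRidge (M + 1 : ℕ) lam z g V) ≤
      K ^ 2 * rho c (M + 1 : ℕ) lam μ z V := fun V =>
    (hz.sampleRidge_form_le hν hlam V).trans (by
      rw [mul_comm]
      exact mul_le_mul_of_nonneg_right (mean_sq_le hK hν hMν V) (rho_nonneg hz.pos hν hlam V))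
  have hsq : (1 + δ) ^ 2 ≤ Λ ^ 2 := by gcongr
  have b1 := hz.integral_rho_sq_le hν hlam hR
  have b2 := hz.integral_resid_four_le hν hlam hg hK hMν hR
  have b3 := hz.integral_dotProduct_four_le (a := fun V : Fin M → X =>
      (secondMoment μ z * qBar (secondMoment μ z) lam δ) *ᵥ sampleRidge (M + 1 : ℕ) lam z g V)
    (A := Λ ^ 2 * K ^ 2) hν hlam
    (AllLp.mulVec (fun _ _ => .const _) (allLp_sampleRidge hzz hg hν hlam))
    (fun V => by
      refine (hH.normSq_le _).trans ?_
      rw [mul_assoc]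
      exact mul_le_mul hsq (hw2 V) (dotProduct_self_nonneg' _) (sq_nonneg _))
    (fun V => by
      refine (hH.form_le _).trans ?_
      rw [mul_assoc]
      exact mul_le_mul hsq (hwS V) (hS.form_nonneg _) (sq_nonneg _)) hR
  have hD1 : 0 ≤ 2 * (c * lam⁻¹) ^ 2 + 2 * meanFormBound c lam Γ := by
    have : 0 ≤ (c * lam⁻¹) ^ 2 := sq_nonneg _
    linarith
  have hD2 : 0 ≤ (Λ ^ 2 * K ^ 2) ^ 2 *
      (8 * (c * lam⁻¹ ^ 2 + (2 * (c * lam⁻¹) ^ 2 + 2 * meanFormBound c lam Γ))) := by positivity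
  have hD3 : 0 ≤ 8 * K ^ 4 + 8 * (K ^ 4 *
      (8 * (c * lam⁻¹ ^ 2 + (2 * (c * lam⁻¹) ^ 2 + 2 * meanFormBound c lam Γ)))) := by
    positivity
  have key := hz.abs_integral_predRisk_le (D := momentBound c lam Γ Λ K) hg rfl hlam hδ0 hΛ hK
    (abs_le.2 ⟨by linarith, hα1.le⟩)
    (b1.trans (by rw [momentBound]; linarith)) (b3.trans (by rw [momentBound]; linarith))
    (b2.trans (by rw [momentBound]; linarith)) hs hα
  have h1 : 0 < 1 - alpha (M + 1) (secondMoment μ z) lam δ := by linarith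
  have h2 : (1 - alpha (M + 1) (secondMoment μ z) lam δ)⁻¹ ≤ Λ := by
    refine le_trans ?_ hΛ
    rw [inv_le_comm₀ h1 (by positivity)]
    exact inv_le_one_sub_alpha hS hlam hδ
  set J := ∫ U : Fin (M + 1) → X, predRisk μ z g (sampleRidge (M + 1 : ℕ) lam z g U)
        ∂(Measure.pi fun _ => μ)
  have h3 : J - (1 - alpha (M + 1) (secondMoment μ z) lam δ)⁻¹ * equivRisk μ z g lam δ =
      (1 - alpha (M + 1) (secondMoment μ z) lam δ)⁻¹ *
      ((1 - alpha (M + 1) (secondMoment μ z) lam δ) * J - equivRisk μ z g lam δ) := by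
    field_simp
  rw [h3, abs_mul, abs_of_pos (inv_pos.2 h1)]
  exact mul_le_mul h2 key (abs_nonneg _) (by linarith)

end BoundedLabels

/-! ### The error of the ridge predictor for square integrable labels -/

section SquareIntegrableLabels

variable {X : Type*} [MeasurableSpace X] {n N M : ℕ} {μ : Measure X} [IsProbabilityMeasure μ]
  {z : X → Fin n → ℝ} {g h : X → ℝ} {c ν lam : ℝ}

/-- The prediction at the test input `p.2` of the ridge predictor fitted on `p.1`. -/
def ridgePrediction (ν lam : ℝ) (z : X → Fin n → ℝ) (g : X → ℝ) (p : (Fin N → X) × X) : ℝ :=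
  sampleRidge ν lam z g p.1 ⬝ᵥ z p.2

omit [MeasurableSpace X] in
lemma sampleRidge_sub (ν lam : ℝ) (z : X → Fin n → ℝ) (g h : X → ℝ) (U : Fin N → X) :
    sampleRidge ν lam z (fun x => g x - h x) U =
      sampleRidge ν lam z g U - sampleRidge ν lam z h U := by
  simp only [sampleRidge, ridge, sub_smul, Finset.sum_sub_distrib, smul_sub, Matrix.mulVec_sub]

lemma ridgePrediction_sub (ν lam : ℝ) (z : X → Fin n → ℝ) (g h : X → ℝ) (p : (Fin N → X) × X) :
    ridgePrediction ν lam z (fun x => g x - h x) p =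
      ridgePrediction ν lam z g p - ridgePrediction ν lam z h p := by
  simp only [ridgePrediction, sampleRidge_sub, sub_dotProduct]

lemma aestronglyMeasurable_ridgePrediction (hz : ∀ i, AllLp (fun x => z x i) μ)
    (hg : AEStronglyMeasurable g μ) (hν : 0 ≤ ν) (hlam : 0 < lam) :
    AEStronglyMeasurable (ridgePrediction (N := N) ν lam z g)
      ((Measure.pi fun _ => μ).prod μ) := by
  have hQ : ∀ i j, AEStronglyMeasurable
      (fun p : (Fin N → X) × X => (gram ν lam fun k => z (p.1 k))⁻¹ i j)
      ((Measure.pi fun _ => μ).prod μ) := fun i j =>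
    ((AllLp.inv_gram (fun j i => allLp_sample hz j i) hν hlam i j).comp measurePreserving_fst).1
  have hgU : ∀ j, AEStronglyMeasurable (fun p : (Fin N → X) × X => g (p.1 j))
      ((Measure.pi fun _ => μ).prod μ) := fun j =>
    (hg.comp_measurePreserving (measurePreserving_eval (fun _ : Fin N => μ) j)
      ).comp_measurePreserving measurePreserving_fst
  have hzU : ∀ j i, AEStronglyMeasurable (fun p : (Fin N → X) × X => z (p.1 j) i)
      ((Measure.pi fun _ => μ).prod μ) := fun j i =>
    ((allLp_sample hz j i).comp measurePreserving_fst).1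
  have hzx : ∀ i, AEStronglyMeasurable (fun p : (Fin N → X) × X => z p.2 i)
      ((Measure.pi fun _ => μ).prod μ) := fun i => ((hz i).comp measurePreserving_snd).1
  unfold ridgePrediction sampleRidge ridge
  simp only [Matrix.mulVec, dotProduct, Pi.smul_apply, Finset.sum_apply, smul_eq_mul]
  exact Finset.aestronglyMeasurable_fun_sum _ fun i _ =>
    (Finset.aestronglyMeasurable_fun_sum _ fun j _ => (hQ i j).mul
      ((Finset.aestronglyMeasurable_fun_sum _ fun k _ => (hgU k).mul (hzU k j)).const_mul _)).mul
    (hzx i)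

/-- The prediction is square integrable as soon as the labels are. -/
lemma memLp_ridgePrediction (hz : ∀ i, AllLp (fun x => z x i) μ) (hg : MemLp g 2 μ)
    (hν : 0 ≤ ν) (hlam : 0 < lam) :
    MemLp (ridgePrediction (N := N) ν lam z g) 2 ((Measure.pi fun _ => μ).prod μ) := by
  have hm := aestronglyMeasurable_ridgePrediction (N := N) hz hg.1 hν hlam
  rw [memLp_two_iff_integrable_sq hm]
  rcases hν.eq_or_lt with rfl | hν
  -- for `ν = 0` the inverse of `ν` is `0`, and so are the weights
  · have : ∀ p : (Fin N → X) × X, ridgePrediction 0 lam z g p = 0 := fun p => by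
      simp [ridgePrediction, sampleRidge, ridge]
    simp [this]
  have hz2 : AllLp (fun x => z x ⬝ᵥ z x) μ := AllLp.dotProduct hz hz
  have hgU : Integrable (fun U : Fin N → X => lam⁻¹ * (ν⁻¹ * ∑ j, g (U j) ^ 2))
      (Measure.pi fun _ => μ) :=
    ((integrable_finsetSum _ fun j _ =>
      (measurePreserving_eval (fun _ : Fin N => μ) j).integrable_comp_of_integrable
        hg.integrable_sq).const_mul _).const_mul _
  refine (hgU.mul_prod hz2.integrable).mono (hm.pow 2) (.of_forall fun p => ?_)
  rw [Real.norm_of_nonneg (sq_nonneg _)]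
  refine le_trans ?_ (le_abs_self _)
  refine (dotProduct_sq_le _ _).trans
    (mul_le_mul_of_nonneg_right ?_ (dotProduct_self_nonneg' _))
  rw [inv_mul_eq_div, le_div_iff₀ hlam, mul_comm]
  exact ridge_normSq_le hν hlam _ _

lemma integral_ridgePrediction_sq (hz : ∀ i, AllLp (fun x => z x i) μ) (hg : MemLp g 2 μ)
    (hν : 0 ≤ ν) (hlam : 0 < lam) :
    ∫ p : (Fin N → X) × X, ridgePrediction ν lam z g p ^ 2 ∂((Measure.pi fun _ => μ).prod μ) =
      ∫ U : Fin N → X, sampleRidge ν lam z g U ⬝ᵥ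
        (secondMoment μ z *ᵥ sampleRidge ν lam z g U) ∂(Measure.pi fun _ => μ) := by
  rw [integral_prod _ (memLp_ridgePrediction hz hg hν hlam).integrable_sq]
  congr 1; funext U
  exact integral_dotProduct_sq hz (sampleRidge ν lam z g U)

omit [IsProbabilityMeasure μ] in
/-- The compressed second moment matrix decreases when a sample is added. -/
lemma rho_le_rho_removeNth (hν : 0 < ν) (hlam : 0 < lam) (U : Fin (M + 1) → X)
    (i : Fin (M + 1)) :
    rho c ν lam μ z U ≤ rho c ν lam μ z (fun j => U (i.succAbove j)) := by
  rw [rho, rho, meanForm, meanForm, sampleInv, gram_succAbove ν lam (fun j => z (U j)) i]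
  gcongr
  exact (gram_coercive hν.le lam _).form_inv_add_rank_one_le hlam (inv_nonneg.2 hν.le) _ _

/-- The ridge predictor is stable in mean square, uniformly in the dimensions. The labels are only
square integrable, so each squared label has to be independent of the factor `rho` that multiplies
it: this is why its sample is removed from `rho`. -/
lemma Concentrated.integral_ridgePrediction_sq_le (hz : Concentrated c μ z) (hg : MemLp g 2 μ)
    (hlam : 0 < lam) {Γ : ℝ} (hM : 0 < M) (hn : n ≤ Γ * M) :
    ∫ p : (Fin (M + 1) → X) × X, ridgePrediction (M + 1 : ℕ) lam z g p ^ 2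
      ∂((Measure.pi fun _ => μ).prod μ) ≤
      (c * lam⁻¹ + meanFormBound c lam Γ) * ∫ x, g x ^ 2 ∂μ := by
  have hM1 : (1 : ℝ) ≤ M := by exact_mod_cast hM
  obtain ⟨ν, hνdef⟩ : ∃ ν : ℝ, ν = (M + 1 : ℕ) := ⟨_, rfl⟩
  have hν : 0 < ν := by rw [hνdef]; positivity
  have hν2 : ν ≤ 2 * M := by rw [hνdef]; push_cast; linarith
  have hzz := hz.allLp
  have hR := hz.integral_meanForm_sq_le hν hlam hM hν2 hn
  have hR' := integral_meanForm_le hzz hν hlam (meanFormBound_one_le hz.pos) hR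
  have hρ := allLp_rho (c := c) (M := M) hzz hν hlam
  rw [← hνdef, integral_ridgePrediction_sq hzz hg hν.le hlam]
  have hf : Integrable (fun p : X × (Fin M → X) => g p.1 ^ 2 * rho c ν lam μ z p.2)
      (μ.prod (Measure.pi fun _ => μ)) := hg.integrable_sq.mul_prod hρ.integrable
  have hfi : ∀ i : Fin (M + 1), Integrable (fun U : Fin (M + 1) → X => g (U i) ^ 2 *
      rho c ν lam μ z fun j => U (i.succAbove j)) (Measure.pi fun _ => μ) := fun i =>
    (measurePreserving_removeNth μ i).integrable_comp_of_integrable hf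
  have hval : ∀ i : Fin (M + 1), ∫ U : Fin (M + 1) → X, g (U i) ^ 2 *
      rho c ν lam μ z (fun j => U (i.succAbove j)) ∂(Measure.pi fun _ => μ) =
      (∫ x, g x ^ 2 ∂μ) * ∫ V : Fin M → X, rho c ν lam μ z V ∂(Measure.pi fun _ => μ) :=
    fun i => by
    rw [integral_removeNth i fun p : X × (Fin M → X) => g p.1 ^ 2 * rho c ν lam μ z p.2]
    exact integral_prod_mul (fun x => g x ^ 2) fun V => rho c ν lam μ z V
  calc _ ≤ ∫ U : Fin (M + 1) → X, ν⁻¹ * ∑ i, (g (U i) ^ 2 *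
          rho c ν lam μ z fun j => U (i.succAbove j)) ∂(Measure.pi fun _ => μ) := by
        refine integral_mono_of_nonneg (.of_forall fun U =>
          (secondMoment_posSemidef hzz).form_nonneg _)
          ((integrable_finsetSum _ fun i _ => hfi i).const_mul _) (.of_forall fun U => ?_)
        refine (hz.sampleRidge_form_le hν hlam U).trans ?_
        rw [mul_left_comm, Finset.mul_sum]
        refine mul_le_mul_of_nonneg_left (Finset.sum_le_sum fun i _ => ?_) (inv_nonneg.2 hν.le)
        rw [mul_comm]
        exact mul_le_mul_of_nonneg_left (rho_le_rho_removeNth hν hlam U i) (sq_nonneg _)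
    _ = (∫ x, g x ^ 2 ∂μ) * ∫ V : Fin M → X, rho c ν lam μ z V ∂(Measure.pi fun _ => μ) := by
        rw [integral_const_mul, integral_finsetSum _ fun i _ => hfi i]
        simp only [hval]
        rw [Finset.sum_const, Finset.card_univ, Fintype.card_fin, nsmul_eq_mul, ← mul_assoc,
          hνdef, inv_mul_cancel₀ (by positivity), one_mul]
    _ ≤ _ := by
        rw [mul_comm]
        refine mul_le_mul_of_nonneg_right ?_ (integral_nonneg fun x => sq_nonneg _)
        simp only [rho]
        rw [AllLp.integral_add (.const _) (allLp_meanForm hzz hν hlam)]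
        simpa using hR'

/-- The deterministic equivalent of the weights. -/
def equivRidge (μ : Measure X) (z : X → Fin n → ℝ) (g : X → ℝ) (lam δ : ℝ) : Fin n → ℝ :=
  (1 + δ)⁻¹ • (qBar (secondMoment μ z) lam δ *ᵥ crossMoment μ g z)

lemma equivRisk_eq (hz : ∀ i, AllLp (fun x => z x i) μ) (hg : MemLp g 2 μ) (δ : ℝ) :
    equivRisk μ z g lam δ = ∫ x, (g x - equivRidge μ z g lam δ ⬝ᵥ z x) ^ 2 ∂μ := by
  have h := predRisk_eq hz hg (equivRidge μ z g lam δ)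
  rw [predRisk] at h
  rw [h, equivRisk, equivRidge, dotProduct_smul, smul_dotProduct, Matrix.mulVec_smul,
    dotProduct_smul, dotProduct_comm (crossMoment μ g z)]
  simp only [smul_eq_mul]
  ring

lemma crossMoment_sub (hz : ∀ i, AllLp (fun x => z x i) μ) (hg : MemLp g 2 μ)
    (hh : MemLp h 2 μ) :
    crossMoment μ (fun x => g x - h x) z = crossMoment μ g z - crossMoment μ h z := by
  ext i
  simp only [crossMoment, Pi.sub_apply, sub_mul]
  exact integral_sub (integrable_mul_apply hz hg i) (integrable_mul_apply hz hh i)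

lemma equivRidge_sub (hz : ∀ i, AllLp (fun x => z x i) μ) (hg : MemLp g 2 μ)
    (hh : MemLp h 2 μ) (δ : ℝ) :
    equivRidge μ z (fun x => g x - h x) lam δ =
      equivRidge μ z g lam δ - equivRidge μ z h lam δ := by
  rw [equivRidge, crossMoment_sub hz hg hh, Matrix.mulVec_sub, smul_sub]; rfl

lemma integral_equivRidge_sq_le (hz : ∀ i, AllLp (fun x => z x i) μ) (hg : MemLp g 2 μ)
    (hlam : 0 < lam) {δ Λ : ℝ} (hδ : 0 ≤ δ) (hΛ : 1 + δ ≤ Λ) :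
    ∫ x, (equivRidge μ z g lam δ ⬝ᵥ z x) ^ 2 ∂μ ≤ Λ ^ 2 * ∫ x, g x ^ 2 ∂μ := by
  have hS := secondMoment_posSemidef hz
  have h0 : 0 ≤ ∫ x, g x ^ 2 ∂μ := integral_nonneg fun x => sq_nonneg _
  obtain ⟨h1, -⟩ := qBar_mulVec_bound hS hlam hδ hΛ h0
    (crossMoment_sq_le hz hg.integrable_sq hg.1)
  rw [integral_dotProduct_sq hz, equivRidge, Matrix.mulVec_smul, dotProduct_smul,
    smul_dotProduct, smul_eq_mul, smul_eq_mul]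
  have hu0 : 0 ≤ (1 + δ)⁻¹ := by positivity
  have hu1 : (1 + δ)⁻¹ ≤ 1 := inv_le_one_of_one_le₀ (by linarith)
  have h2 := hS.form_nonneg (qBar (secondMoment μ z) lam δ *ᵥ crossMoment μ g z)
  rw [← mul_assoc]
  exact (mul_le_of_le_one_left h2 (mul_le_one₀ hu1 hu0 hu1)).trans h1

/-- The squared norms of two random variables are close if their difference is small. -/
lemma abs_integral_sq_sub_le {Ω : Type*} [MeasurableSpace Ω] {P : Measure Ω} {e f : Ω → ℝ}
    (hf : MemLp f 2 P) (he : MemLp e 2 P) {t : ℝ} (ht : 0 < t) :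
    |∫ ω, f ω ^ 2 ∂P - ∫ ω, (f ω - e ω) ^ 2 ∂P| ≤
      t * ∫ ω, f ω ^ 2 ∂P + (1 + t⁻¹) * ∫ ω, e ω ^ 2 ∂P := by
  have hfe : MemLp (fun ω => f ω - e ω) 2 P := hf.sub he
  rw [← integral_sub hf.integrable_sq hfe.integrable_sq, ← integral_const_mul,
    ← integral_const_mul, ← integral_add (hf.integrable_sq.const_mul _)
      (he.integrable_sq.const_mul _)]
  refine abs_integral_le_integral_abs.trans (integral_mono
    (hf.integrable_sq.sub (hf.sub he).integrable_sq).abs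
    ((hf.integrable_sq.const_mul _).add (he.integrable_sq.const_mul _)) fun ω => ?_)
  have h1 := abs_mul_le_weighted_sq_add_sq ht (f ω) (e ω)
  rw [abs_le] at h1
  simp only
  rw [abs_le]
  constructor <;> nlinarith [sq_nonneg (e ω)]

lemma integral_sub_sq_le {Ω : Type*} [MeasurableSpace Ω] {P : Measure Ω} {e f : Ω → ℝ}
    (hf : MemLp f 2 P) (he : MemLp e 2 P) {A B : ℝ} (hA : ∫ ω, f ω ^ 2 ∂P ≤ A)
    (hB : ∫ ω, e ω ^ 2 ∂P ≤ B) : ∫ ω, (f ω - e ω) ^ 2 ∂P ≤ 2 * A + 2 * B := by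
  calc _ ≤ ∫ ω, (2 * f ω ^ 2 + 2 * e ω ^ 2) ∂P :=
        integral_mono (hf.sub he).integrable_sq
          ((hf.integrable_sq.const_mul _).add (he.integrable_sq.const_mul _)) fun ω => by
          have := add_sq_le_two (f ω) (-e ω)
          simpa [sub_eq_add_neg] using this
    _ ≤ _ := by
        rw [integral_add (hf.integrable_sq.const_mul _) (he.integrable_sq.const_mul _),
          integral_const_mul, integral_const_mul]
        linarith

/-- The error of the ridge predictor at the test input `p.2`. -/
def ridgeError (ν lam : ℝ) (z : X → Fin n → ℝ) (g : X → ℝ) (p : (Fin N → X) × X) : ℝ :=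
  g p.2 - ridgePrediction ν lam z g p

lemma memLp_ridgeError (hz : ∀ i, AllLp (fun x => z x i) μ) (hg : MemLp g 2 μ)
    (hν : 0 ≤ ν) (hlam : 0 < lam) :
    MemLp (ridgeError (N := N) ν lam z g) 2 ((Measure.pi fun _ => μ).prod μ) :=
  (hg.comp_measurePreserving measurePreserving_snd).sub (memLp_ridgePrediction hz hg hν hlam)

lemma integral_ridgeError_sq (hz : ∀ i, AllLp (fun x => z x i) μ) (hg : MemLp g 2 μ)
    (hν : 0 ≤ ν) (hlam : 0 < lam) :
    ∫ p : (Fin N → X) × X, ridgeError ν lam z g p ^ 2 ∂((Measure.pi fun _ => μ).prod μ) =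
      ∫ U : Fin N → X, predRisk μ z g (sampleRidge ν lam z g U) ∂(Measure.pi fun _ => μ) := by
  rw [integral_prod _ (memLp_ridgeError hz hg hν hlam).integrable_sq]
  rfl

lemma ridgeError_sub (ν lam : ℝ) (z : X → Fin n → ℝ) (g h : X → ℝ) (p : (Fin N → X) × X) :
    ridgeError ν lam z (fun x => g x - h x) p =
      ridgeError ν lam z g p - ridgeError ν lam z h p := by
  simp only [ridgeError, ridgePrediction_sub]; ring

/-- The mean square stability constant of the error and of its deterministic equivalent. -/
def stabilityBound (c lam Γ : ℝ) : ℝ :=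
  (2 + 2 * (c * lam⁻¹ + meanFormBound c lam Γ)) +
    deltaBound c lam Γ * (2 + 2 * deltaBound c lam Γ ^ 2)

lemma measurable_truncation (hg : Measurable g) (K : ℝ) :
    Measurable ({x | K ≤ |g x|}.indicator g) :=
  hg.indicator (measurableSet_le measurable_const hg.abs)

/-- The estimate for labels that are merely square integrable, in terms of the mass of the labels
above a truncation level `K`. -/
theorem Concentrated.abs_integral_ridgeError_sq_sub_le (hz : Concentrated c μ z)
    (hgm : Measurable g) (hg : MemLp g 2 μ) (hlam : 0 < lam) {K Γ δ t G η : ℝ} (ht : 0 < t)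
    (hN : 2 ≤ N) (hn : n ≤ Γ * N) (hΓ : 0 ≤ Γ) (hδ : IsDelta N (secondMoment μ z) lam δ)
    (hK : 0 ≤ K) (hG : ∫ x, g x ^ 2 ∂μ ≤ G) (hη : ∫ x in {x | K ≤ |g x|}, g x ^ 2 ∂μ ≤ η) :
    |∫ p : (Fin N → X) × X, ridgeError N lam z g p ^ 2 ∂((Measure.pi fun _ => μ).prod μ) -
      (1 - alpha N (secondMoment μ z) lam δ)⁻¹ * equivRisk μ z g lam δ| ≤
      stabilityBound c lam (2 * Γ) * (t * G + (1 + t⁻¹) * η) +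
      deltaBound c lam (2 * Γ) * (rate N *
        leaveOneOutBound c lam (2 * Γ) (deltaBound c lam (2 * Γ)) K) := by
  obtain ⟨M, rfl⟩ : ∃ M, N = M + 1 := ⟨N - 1, by omega⟩
  have hM : 0 < M := by omega
  have hM1 : (1 : ℝ) ≤ M := by exact_mod_cast hM
  have hn' : n ≤ (2 * Γ) * M := hn.trans (by push_cast; nlinarith)
  have hΓ' : 0 ≤ 2 * Γ := by positivity
  have hzz := hz.allLp
  have hS := secondMoment_posSemidef hzz
  have hν : (0 : ℝ) ≤ (M + 1 : ℕ) := by positivity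
  have hΛ := hz.one_add_delta_le hlam hM hn' hΓ' hδ
  -- `g - h` is bounded; both sides of the estimate depend continuously on the labels
  set h : X → ℝ := {x | K ≤ |g x|}.indicator g with hh
  have hsq : ∀ x, h x ^ 2 = {x | K ≤ |g x|}.indicator (fun x => g x ^ 2) x := fun x => by
    by_cases hx : x ∈ {x | K ≤ |g x|} <;> simp [hh, hx]
  have hh2 : MemLp h 2 μ := hg.indicator (measurableSet_le measurable_const hgm.abs)
  have hhη : ∫ x, h x ^ 2 ∂μ ≤ η := by
    simp only [hsq]
    rwa [integral_indicator (measurableSet_le measurable_const hgm.abs)]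
  have hb : ∀ x, |g x - h x| ≤ K := fun x => by
    by_cases hx : K ≤ |g x|
    · simpa [hh, hx] using hK
    · simpa [hh, hx] using (not_le.1 hx).le
  have hbm : AllLp (fun x => g x - h x) μ :=
    .of_bounded (hgm.sub (measurable_truncation hgm K)).aestronglyMeasurable hb
  have e1 := hz.abs_integral_predRisk_sub_le hbm hlam hb hM hn' hΓ' hδ
  rw [← integral_ridgeError_sq hzz hbm.memLp_two hν hlam] at e1
  simp only [ridgeError_sub] at e1
  have hmg := memLp_ridgeError (N := M + 1) hzz hg hν hlam
  have hmh := memLp_ridgeError (N := M + 1) hzz hh2 hν hlam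
  have e2 := abs_integral_sq_sub_le hmg hmh ht
  set B := c * lam⁻¹ + meanFormBound c lam (2 * Γ) with hB
  have hB0 : 0 ≤ B := by
    have := hz.pos
    have h1 := meanFormBound_one_le (lam := lam) (Γ := 2 * Γ) hz.pos
    positivity
  have hG0 : 0 ≤ ∫ x, g x ^ 2 ∂μ := integral_nonneg fun x => sq_nonneg _
  have hη0 : 0 ≤ ∫ x, h x ^ 2 ∂μ := integral_nonneg fun x => sq_nonneg _
  have hstab : ∀ f : X → ℝ, MemLp f 2 μ → ∀ A, ∫ x, f x ^ 2 ∂μ ≤ A →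
      ∫ p : (Fin (M + 1) → X) × X, ridgeError (M + 1 : ℕ) lam z f p ^ 2
        ∂((Measure.pi fun _ => μ).prod μ) ≤ (2 + 2 * B) * A := fun f hf A hA => by
    have h1 := hz.integral_ridgePrediction_sq_le hf hlam hM hn'
    have h2 : ∫ p : (Fin (M + 1) → X) × X, f p.2 ^ 2 ∂((Measure.pi fun _ => μ).prod μ) =
        ∫ x, f x ^ 2 ∂μ := by
      rw [integral_fun_snd (fun x => f x ^ 2)]; simp
    refine (integral_sub_sq_le (hf.comp_measurePreserving measurePreserving_snd)
      (memLp_ridgePrediction hzz hf hν hlam) h2.le h1).trans ?_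
    rw [← hB]
    calc _ = (2 + 2 * B) * ∫ x, f x ^ 2 ∂μ := by ring
      _ ≤ _ := by gcongr
  have hequiv : ∀ f : X → ℝ, MemLp f 2 μ →
      MemLp (fun x => f x - equivRidge μ z f lam δ ⬝ᵥ z x) 2 μ := fun f hf =>
    hf.sub (AllLp.memLp_two (AllLp.dotProduct (u := fun _ => equivRidge μ z f lam δ)
      (fun i => .const (equivRidge μ z f lam δ i)) hzz))
  have hstab' : ∀ f : X → ℝ, MemLp f 2 μ → ∀ A, ∫ x, f x ^ 2 ∂μ ≤ A →
      ∫ x, (f x - equivRidge μ z f lam δ ⬝ᵥ z x) ^ 2 ∂μ ≤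
        (2 + 2 * deltaBound c lam (2 * Γ) ^ 2) * A := fun f hf A hA => by
    refine (integral_sub_sq_le hf (AllLp.memLp_two (AllLp.dotProduct
      (u := fun _ => equivRidge μ z f lam δ)
      (fun i => .const (equivRidge μ z f lam δ i)) hzz)) le_rfl
      (integral_equivRidge_sq_le hzz hf hlam hδ.1 hΛ)).trans ?_
    calc _ = (2 + 2 * deltaBound c lam (2 * Γ) ^ 2) * ∫ x, f x ^ 2 ∂μ := by ring
      _ ≤ _ := by gcongr
  have e3 := abs_integral_sq_sub_le (hequiv g hg) (hequiv h hh2) ht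
  rw [← equivRisk_eq hzz hg] at e3
  have e4 : ∫ x, ((g x - equivRidge μ z g lam δ ⬝ᵥ z x) -
      (h x - equivRidge μ z h lam δ ⬝ᵥ z x)) ^ 2 ∂μ =
      equivRisk μ z (fun x => g x - h x) lam δ := by
    rw [equivRisk_eq hzz hbm.memLp_two, equivRidge_sub hzz hg hh2]
    congr 1; funext x
    rw [sub_dotProduct]; ring
  rw [e4] at e3
  have ht0 : 0 ≤ 1 + t⁻¹ := by positivity
  have f2 : t * ∫ p : (Fin (M + 1) → X) × X, ridgeError (M + 1 : ℕ) lam z g p ^ 2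
        ∂((Measure.pi fun _ => μ).prod μ) +
      (1 + t⁻¹) * ∫ p : (Fin (M + 1) → X) × X, ridgeError (M + 1 : ℕ) lam z h p ^ 2
        ∂((Measure.pi fun _ => μ).prod μ) ≤ (2 + 2 * B) * (t * G + (1 + t⁻¹) * η) := by
    have h1 := mul_le_mul_of_nonneg_left (hstab g hg G hG) ht.le
    have h2 := mul_le_mul_of_nonneg_left (hstab h hh2 η hhη) ht0
    linarith
  have f3 : t * equivRisk μ z g lam δ +
      (1 + t⁻¹) * ∫ x, (h x - equivRidge μ z h lam δ ⬝ᵥ z x) ^ 2 ∂μ ≤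
      (2 + 2 * deltaBound c lam (2 * Γ) ^ 2) * (t * G + (1 + t⁻¹) * η) := by
    rw [equivRisk_eq hzz hg]
    have h1 := mul_le_mul_of_nonneg_left (hstab' g hg G hG) ht.le
    have h2 := mul_le_mul_of_nonneg_left (hstab' h hh2 η hhη) ht0
    linarith
  have hα1 := alpha_lt_one hS hlam hδ
  have h1 : 0 < 1 - alpha (M + 1) (secondMoment μ z) lam δ := by linarith
  have h2 : (1 - alpha (M + 1) (secondMoment μ z) lam δ)⁻¹ ≤ deltaBound c lam (2 * Γ) := by
    refine le_trans ?_ hΛ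
    have := hδ.1
    rw [inv_le_comm₀ h1 (by positivity)]
    exact inv_le_one_sub_alpha hS hlam hδ
  have hΛ0 : 0 ≤ deltaBound c lam (2 * Γ) := (inv_pos.2 h1).le.trans h2
  have e5 : |(1 - alpha (M + 1) (secondMoment μ z) lam δ)⁻¹ *
      (equivRisk μ z g lam δ - equivRisk μ z (fun x => g x - h x) lam δ)| ≤
      deltaBound c lam (2 * Γ) *
        ((2 + 2 * deltaBound c lam (2 * Γ) ^ 2) * (t * G + (1 + t⁻¹) * η)) := by
    rw [abs_mul, abs_of_pos (inv_pos.2 h1)]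
    exact mul_le_mul h2 (e3.trans f3) (abs_nonneg _) hΛ0
  rw [mul_sub, abs_sub_comm] at e5
  have := (abs_add_le _ _).trans (add_le_add ((abs_add_le _ _).trans
    (add_le_add (e2.trans f2) e5)) e1)
  refine le_trans (le_of_eq ?_) (this.trans (le_of_eq ?_))
  · congr 1; ring
  · rw [stabilityBound]; ring

end SquareIntegrableLabels

/-! ### The proportional limit -/

section Sequences

lemma tendsto_rate {N : ℕ → ℕ} (hN : Tendsto N atTop atTop) :
    Tendsto (fun k => rate (N k)) atTop (𝓝 0) :=
  tendsto_inv_atTop_zero.comp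
    (Real.tendsto_sqrt_atTop.comp (tendsto_natCast_atTop_atTop.comp hN))

lemma integral_sq_le_of_truncation {X : Type*} [MeasurableSpace X] {μ : Measure X}
    [IsProbabilityMeasure μ] {g : X → ℝ} (hgm : Measurable g) (hg : MemLp g 2 μ) {K η : ℝ}
    (hη : ∫ x in {x | K ≤ |g x|}, g x ^ 2 ∂μ ≤ η) : ∫ x, g x ^ 2 ∂μ ≤ η + K ^ 2 := by
  have hA : MeasurableSet {x | K ≤ |g x|} := measurableSet_le measurable_const hgm.abs
  rw [← integral_indicator hA] at hη
  have hi : Integrable ({x | K ≤ |g x|}.indicator fun x => g x ^ 2) μ :=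
    hg.integrable_sq.indicator hA
  calc _ ≤ ∫ x, ({x | K ≤ |g x|}.indicator (fun x => g x ^ 2) x + K ^ 2) ∂μ := by
        refine integral_mono hg.integrable_sq (hi.add (integrable_const _)) fun x => ?_
        by_cases hx : K ≤ |g x|
        · simp only [Set.indicator, Set.mem_ofPred_eq, hx, if_true]
          linarith [sq_nonneg K]
        · simp only [Set.indicator, Set.mem_ofPred_eq, hx, if_false, zero_add]
          exact sq_le_sq.2 ((not_le.1 hx).le.trans (le_abs_self K))
    _ ≤ _ := by
        rw [integral_add hi (integrable_const _)]
        simpa using hη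

/-- In the proportional regime, the mean squared error of the ridge predictor with uniformly square
integrable labels is asymptotic to its deterministic equivalent. -/
theorem tendsto_integral_ridgeError_sq {X : ℕ → Type*} [∀ k, MeasurableSpace (X k)]
    {μ : (k : ℕ) → Measure (X k)} [∀ k, IsProbabilityMeasure (μ k)] {n N : ℕ → ℕ}
    {z : (k : ℕ) → X k → Fin (n k) → ℝ} {g : (k : ℕ) → X k → ℝ} {c lam Γ : ℝ} {δ : ℕ → ℝ}
    (hz : ∀ k, Concentrated c (μ k) (z k)) (hgm : ∀ k, Measurable (g k))
    (hg : ∀ k, MemLp (g k) 2 (μ k))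
    (hui : ∀ ε : ℝ, 0 < ε → ∃ K : ℝ, ∀ k, ∫ x in {x | K ≤ |g k x|}, g k x ^ 2 ∂(μ k) ≤ ε)
    (hlam : 0 < lam) (hN : Tendsto N atTop atTop) (hΓ : 0 ≤ Γ)
    (hn : ∀ᶠ k in atTop, (n k : ℝ) ≤ Γ * N k)
    (hδ : ∀ k, IsDelta (N k) (secondMoment (μ k) (z k)) lam (δ k)) :
    Tendsto (fun k => ∫ p : (Fin (N k) → X k) × X k, ridgeError (N k) lam (z k) (g k) p ^ 2
        ∂((Measure.pi fun _ => μ k).prod (μ k)) -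
      (1 - alpha (N k) (secondMoment (μ k) (z k)) lam (δ k))⁻¹ *
        equivRisk (μ k) (z k) (g k) lam (δ k)) atTop (𝓝 0) := by
  obtain ⟨K₁, hK₁⟩ := hui 1 one_pos
  have hG := fun k => integral_sq_le_of_truncation (hgm k) (hg k) (hK₁ k)
  set G := 1 + K₁ ^ 2
  have hG0 : 0 < G := by positivity
  set B := |stabilityBound c lam (2 * Γ)| + 1
  have hB0 : 0 < B := by positivity
  rw [Metric.tendsto_atTop']
  intro ε hε
  -- the three error terms are each at most `ε / 3`
  set t := ε / (3 * B * G) with ht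
  have ht0 : 0 < t := by positivity
  set η := ε / (3 * B * (1 + t⁻¹)) with hη
  have hη0 : 0 < η := by positivity
  obtain ⟨K, hK⟩ := hui η hη0
  have hset : ∀ k, {x | max K 0 ≤ |g k x|} = {x | K ≤ |g k x|} := fun k => by
    ext x; simp
  have hlim := (tendsto_rate hN).const_mul (deltaBound c lam (2 * Γ) *
    leaveOneOutBound c lam (2 * Γ) (deltaBound c lam (2 * Γ)) (max K 0))
  rw [mul_zero] at hlim
  have hsmall := hlim.eventually (gt_mem_nhds (show (0 : ℝ) < ε / 3 by positivity))
  obtain ⟨k₀, hk₀⟩ := eventually_atTop.1 (hsmall.and (hn.and (hN.eventually_ge_atTop 2)))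
  refine ⟨k₀, fun k hk => ?_⟩
  obtain ⟨h1, h2, h3⟩ := hk₀ k hk.le
  have key := (hz k).abs_integral_ridgeError_sq_sub_le (η := η) (hgm k) (hg k) hlam ht0 h3 h2 hΓ (hδ k)
    (le_max_right K 0) (hG k) (by rw [hset]; exact hK k)
  rw [dist_zero_right, Real.norm_eq_abs]
  refine key.trans_lt ?_
  have e1 : B * (t * G) = ε / 3 := by rw [ht]; field_simp
  have e2 : B * ((1 + t⁻¹) * η) = ε / 3 := by
    rw [hη]
    field_simp
  have e3 : stabilityBound c lam (2 * Γ) * (t * G + (1 + t⁻¹) * η) ≤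
      B * (t * G + (1 + t⁻¹) * η) := by
    have : stabilityBound c lam (2 * Γ) ≤ B := (le_abs_self _).trans (by simp [B])
    gcongr
  have e4 : deltaBound c lam (2 * Γ) * (rate (N k) * leaveOneOutBound c lam (2 * Γ)
      (deltaBound c lam (2 * Γ)) (max K 0)) < ε / 3 := by
    refine lt_of_eq_of_lt ?_ h1
    ring
  linarith

end Sequences

/-! ### The fixed-point equation -/

section FixedPointExistence

variable {n N : ℕ} {S : Matrix (Fin n) (Fin n) ℝ} {lam : ℝ}

lemma continuousOn_qBar_apply (hS : S.PosSemidef) (hlam : 0 < lam) (i j : Fin n) :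
    ContinuousOn (fun d => qBar S lam d i j) (Set.Ici 0) := by
  have hinv : ContinuousOn (fun d : ℝ => (1 + d)⁻¹) (Set.Ici 0) :=
    (continuousOn_const.add continuousOn_id).inv₀ fun d hd => by
      have : (0 : ℝ) ≤ d := hd
      have h1 : (0 : ℝ) < 1 + d := by linarith
      exact h1.ne'
  have hmat : Continuous fun t : ℝ => t • S + lam • (1 : Matrix (Fin n) (Fin n) ℝ) := by
    fun_prop
  have hq : ContinuousOn (fun t : ℝ => (t • S + lam • (1 : Matrix (Fin n) (Fin n) ℝ))⁻¹ i j)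
      (Set.Ici 0) := by
    have h : ∀ t : ℝ, (t • S + lam • (1 : Matrix (Fin n) (Fin n) ℝ))⁻¹ i j =
        (t • S + lam • (1 : Matrix (Fin n) (Fin n) ℝ)).det⁻¹ *
          (t • S + lam • (1 : Matrix (Fin n) (Fin n) ℝ)).adjugate i j := fun t => by
      rw [Matrix.inv_def, Ring.inverse_eq_inv', Matrix.smul_apply, smul_eq_mul]
    simp only [h]
    refine (hmat.matrix_det.continuousOn.inv₀ fun t ht => ?_).mul
      (hmat.matrix_adjugate.matrix_elem i j).continuousOn
    exact ((Matrix.isUnit_iff_isUnit_det _).1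
      ((coercive_add (hS.smul ht)).isUnit hlam)).ne_zero
  exact hq.comp hinv fun d hd => by
    have : (0 : ℝ) ≤ d := hd
    exact Set.mem_Ici.2 (by positivity)

lemma trace_mul_qBar_le (hS : S.PosSemidef) (hlam : 0 < lam) {d : ℝ} (hd : 0 ≤ d) :
    (S * qBar S lam d).trace ≤ lam⁻¹ * S.trace := by
  have h : (lam⁻¹ • (1 : Matrix (Fin n) (Fin n) ℝ) - qBar S lam d).PosSemidef := by
    refine posSemidef_of_form ?_ fun v => ?_
    · rw [Matrix.transpose_sub, (qBar_posSemidef hS hlam hd).transpose_eq]; simp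
    · rw [Matrix.sub_mulVec, dotProduct_sub, Matrix.smul_mulVec, Matrix.one_mulVec,
        dotProduct_smul, smul_eq_mul, sub_nonneg]
      exact (qBar_coercive hS hd).form_inv_le hlam v
  have := trace_mul_nonneg hS h
  rw [Matrix.mul_sub, Matrix.trace_sub, Matrix.mul_smul, Matrix.mul_one, Matrix.trace_smul,
    smul_eq_mul] at this
  linarith

/-- The fixed-point equation has a solution, by the intermediate value theorem. -/
lemma exists_isDelta (N : ℕ) (hS : S.PosSemidef) (hlam : 0 < lam) : ∃ δ, IsDelta N S lam δ := by
  have hN : (0 : ℝ) ≤ (N : ℝ)⁻¹ := by positivity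
  have htr : 0 ≤ S.trace := by
    simpa using trace_mul_nonneg hS (Matrix.PosSemidef.one (n := Fin n) (R := ℝ))
  set D := (N : ℝ)⁻¹ * (lam⁻¹ * S.trace)
  have hD : 0 ≤ D := by positivity
  have hcont : ContinuousOn (fun d => (N : ℝ)⁻¹ * (S * qBar S lam d).trace - d)
      (Set.Icc 0 D) := by
    refine ContinuousOn.sub (continuousOn_const.mul ?_) continuousOn_id
    simp only [Matrix.trace, Matrix.diag, Matrix.mul_apply]
    exact continuousOn_finsetSum _ fun i _ => continuousOn_finsetSum _ fun j _ =>
      continuousOn_const.mul ((continuousOn_qBar_apply hS hlam j i).mono Set.Icc_subset_Ici_self)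
  obtain ⟨δ, hδ, h0⟩ := intermediate_value_Icc' hD hcont (show (0 : ℝ) ∈ Set.Icc _ _ from
    ⟨sub_nonpos.2 (mul_le_mul_of_nonneg_left (trace_mul_qBar_le hS hlam hD) hN), by
      rw [sub_zero]
      exact mul_nonneg hN (trace_mul_nonneg hS (qBar_posSemidef hS hlam le_rfl))⟩)
  exact ⟨δ, hδ.1, (sub_eq_zero.1 h0).symm⟩

/-- Two solutions `d` and `d'` satisfy `|d - d'| ≤ d / (1 + d) * |d - d'|`, by the resolvent
identity. -/
lemma IsDelta.eq (hS : S.PosSemidef) (hlam : 0 < lam) {d d' : ℝ} (h : IsDelta N S lam d)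
    (h' : IsDelta N S lam d') : d = d' := by
  have hd := h.1
  have hd' := h'.1
  rcases Nat.eq_zero_or_pos N with rfl | hN
  -- without samples `N⁻¹ = 0`, and `0` is the only solution
  · have e := h.2
    have e' := h'.2
    simp at e e'
    rw [e, e']
  have hν : (0 : ℝ) < N := by exact_mod_cast hN
  have h1 := (qBar_coercive (lam := lam) hS hd).inv_sub_inv (qBar_coercive (lam := lam) hS hd')
    hlam hlam
  change qBar S lam d - qBar S lam d' = qBar S lam d' * _ * qBar S lam d at h1
  rw [add_sub_add_right_eq_sub, ← sub_smul, Matrix.mul_smul, Matrix.smul_mul,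
    ← mul_qBar_comm hS hlam hd'] at h1
  have h2 : d - d' = ((1 + d')⁻¹ - (1 + d)⁻¹) *
      normTrace N S ((S * qBar S lam d') * qBar S lam d) := by
    conv_lhs => rw [h.2, h'.2]
    rw [← mul_sub, ← Matrix.trace_sub, ← Matrix.mul_sub, h1, Matrix.mul_smul, Matrix.trace_smul,
      smul_eq_mul, normTrace]
    ring
  have h3 := abs_normTrace_le hν (multiplier_mul_qBar hS hlam hd') hS
    (qBar_posSemidef hS hlam hd)
  rw [isDelta_eq_normTrace h] at h3
  have h4 : (1 + d')⁻¹ - (1 + d)⁻¹ = (d - d') * ((1 + d)⁻¹ * (1 + d')⁻¹) := by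
    field_simp; ring
  have h5 : |d - d'| ≤ |d - d'| * (d * (1 + d)⁻¹) := by
    calc |d - d'| = |d - d'| * ((1 + d)⁻¹ * (1 + d')⁻¹) *
          |normTrace N S ((S * qBar S lam d') * qBar S lam d)| := by
          conv_lhs => rw [h2, h4]
          rw [abs_mul, abs_mul, abs_of_nonneg (a := (1 + d)⁻¹ * (1 + d')⁻¹) (by positivity)]
      _ ≤ |d - d'| * ((1 + d)⁻¹ * (1 + d')⁻¹) * ((1 + d') * d) := by gcongr
      _ = _ := by field_simp
  have h6 : d * (1 + d)⁻¹ < 1 := by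
    rw [← div_eq_mul_inv, div_lt_one (by positivity)]; linarith
  by_contra hne
  have h7 : 0 < |d - d'| := abs_pos.2 (sub_ne_zero.2 hne)
  nlinarith

/-- If `Tr (S Q̄)` vanishes then so does `S`, as `Q̄` is positive definite. -/
lemma IsDelta.pos (hS : S.PosSemidef) (hlam : 0 < lam) {d : ℝ} (h : IsDelta N S lam d)
    (hN : N ≠ 0) (hS0 : S ≠ 0) : 0 < d := by
  refine h.1.lt_of_ne fun h0 => hS0 ?_
  have hd := h.1
  have hB := qBar_coercive (lam := lam) hS hd
  have hQ := qBar_posSemidef hS hlam hd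
  have htr : (qBar S lam d * S).trace = 0 := by
    have h1 := h.2
    rw [← h0, Matrix.trace_mul_comm] at h1
    have hN' : (N : ℝ)⁻¹ ≠ 0 := inv_ne_zero (by exact_mod_cast hN)
    rw [← h0]
    exact (mul_eq_zero.1 h1.symm).resolve_left hN'
  obtain ⟨m, w, hw⟩ := Matrix.posSemidef_iff_eq_sum_vecMulVec.mp hS
  have h2 : ∑ i, w i ⬝ᵥ (qBar S lam d *ᵥ w i) = 0 := by
    rw [← htr]
    conv_rhs => rw [hw, Finset.mul_sum, Matrix.trace_sum]
    rw [← hw]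
    exact Finset.sum_congr rfl fun i _ => by rw [trace_mul_vecMulVec]; simp
  have h3 : ∀ i, w i = 0 := fun i => by
    have h4 := (Finset.sum_eq_zero_iff_of_nonneg fun i _ => hQ.form_nonneg (w i)).1 h2 i
      (Finset.mem_univ i)
    have h5 := hB.normSq_inv_le hlam (w i)
    change _ ≤ w i ⬝ᵥ (qBar S lam d *ᵥ w i) at h5
    rw [h4] at h5
    have h6 : qBar S lam d *ᵥ w i = 0 := dotProduct_self_eq_zero.1
      (le_antisymm (nonpos_of_mul_nonpos_right h5 hlam) (dotProduct_self_nonneg' _))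
    have h7 := hB.mulVec_inv hlam (w i)
    change _ *ᵥ (qBar S lam d *ᵥ w i) = w i at h7
    rw [← h7, h6, Matrix.mulVec_zero]
  rw [hw]
  exact Finset.sum_eq_zero fun i _ => by rw [h3 i]; simp

end FixedPointExistence

/-! ### Moments of exponentially concentrated features -/

section ExponentialConcentration

/-- The bound for the absolute moment of order `p` that follows from an exponential tail. -/
def tailMoment (q C s : ℝ) (p : ℕ) : ℝ :=
  p * ∫ t in Set.Ioi (0 : ℝ), C * Real.exp (-(t / s) ^ q) * t ^ ((p : ℝ) - 1)

lemma integrableOn_tail {q C s : ℝ} (hq : 0 < q) (hs : 0 < s) {p : ℕ} (hp : 0 < p) :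
    IntegrableOn (fun t : ℝ => C * Real.exp (-(t / s) ^ q) * t ^ ((p : ℝ) - 1))
      (Set.Ioi 0) := by
  have hp' : (1 : ℝ) ≤ p := by exact_mod_cast hp
  have h := (integrableOn_rpow_mul_exp_neg_mul_rpow (s := (p : ℝ) - 1) (p := q) (b := (s ^ q)⁻¹)
    (by linarith) hq (by positivity)).const_mul C
  refine IntegrableOn.congr_fun h (fun t ht => ?_) measurableSet_Ioi
  have ht' : (0 : ℝ) ≤ t := le_of_lt ht
  rw [Real.div_rpow ht' hs.le, neg_mul, inv_mul_eq_div]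
  ring

lemma tailMoment_nonneg {q C s : ℝ} (hC : 0 ≤ C) (p : ℕ) : 0 ≤ tailMoment q C s p :=
  mul_nonneg (Nat.cast_nonneg _) (setIntegral_nonneg measurableSet_Ioi fun t ht => by
    have : (0 : ℝ) ≤ t := le_of_lt ht
    positivity)

/-- The moments of a random variable with an exponential tail, by the layer cake formula. -/
lemma lintegral_abs_pow_le_tailMoment {Ω : Type*} [MeasurableSpace Ω] {P : Measure Ω}
    [IsFiniteMeasure P] {Y : Ω → ℝ} (hY : AEMeasurable Y P) {q C s : ℝ} (hq : 0 < q) (hC : 0 < C)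
    (hs : 0 < s)
    (htail : ∀ t : ℝ, 0 < t → P.real {ω | t ≤ |Y ω|} ≤ C * Real.exp (-(t / s) ^ q))
    {p : ℕ} (hp : 0 < p) :
    ∫⁻ ω, ENNReal.ofReal (|Y ω| ^ p) ∂P ≤ ENNReal.ofReal (tailMoment q C s p) := by
  have hp' : (0 : ℝ) < p := by exact_mod_cast hp
  have h := lintegral_rpow_eq_lintegral_meas_le_mul P (f := fun ω => |Y ω|)
    (.of_forall fun ω => abs_nonneg _) hY.abs hp'
  simp only [Real.rpow_natCast] at h
  rw [h, tailMoment, ENNReal.ofReal_mul hp'.le]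
  gcongr
  rw [ofReal_integral_eq_lintegral_ofReal (integrableOn_tail hq hs hp)
    ((ae_restrict_mem measurableSet_Ioi).mono fun t ht => by
      have : (0 : ℝ) ≤ t := le_of_lt ht
      simp only [Pi.zero_apply]
      positivity)]
  refine setLIntegral_mono' measurableSet_Ioi fun t ht => ?_
  rw [ENNReal.ofReal_mul (by positivity)]
  gcongr
  rw [← ofReal_measureReal]
  exact ENNReal.ofReal_le_ofReal (htail t ht)

lemma integrable_abs_pow_of_tail {Ω : Type*} [MeasurableSpace Ω] {P : Measure Ω}
    [IsFiniteMeasure P] {Y : Ω → ℝ} (hY : AEMeasurable Y P) {q C s : ℝ} (hq : 0 < q) (hC : 0 < C)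
    (hs : 0 < s)
    (htail : ∀ t : ℝ, 0 < t → P.real {ω | t ≤ |Y ω|} ≤ C * Real.exp (-(t / s) ^ q))
    {p : ℕ} (hp : 0 < p) :
    Integrable (fun ω => |Y ω| ^ p) P ∧ ∫ ω, |Y ω| ^ p ∂P ≤ tailMoment q C s p := by
  have h := lintegral_abs_pow_le_tailMoment hY hq hC hs htail hp
  have hm : AEStronglyMeasurable (fun ω => |Y ω| ^ p) P := (hY.abs.pow_const p).aestronglyMeasurable
  have hint : Integrable (fun ω => |Y ω| ^ p) P := by
    refine ⟨hm, ?_⟩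
    rw [hasFiniteIntegral_iff_ofReal (.of_forall fun ω => by positivity)]
    exact h.trans_lt ENNReal.ofReal_lt_top
  refine ⟨hint, ?_⟩
  rw [← ofReal_integral_eq_lintegral_ofReal hint (.of_forall fun ω => by positivity)] at h
  exact (ENNReal.ofReal_le_ofReal_iff (tailMoment_nonneg hC.le p)).1 h

lemma dotProduct_sub_eq_dist {n : ℕ} (a b : EuclideanSpace ℝ (Fin n)) :
    √((a.ofLp - b.ofLp) ⬝ᵥ (a.ofLp - b.ofLp)) = dist a b := by
  rw [EuclideanSpace.dist_eq]
  simp [dotProduct, Real.dist_eq, sq]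

/-- The constant of `Concentrated` for exponentially concentrated features. -/
def concentrationBound (q C s : ℝ) : ℝ := 1 + tailMoment q C s 4

lemma ExpConcentrated.concentrated {X : Type*} [MeasurableSpace X] {μ : Measure X}
    [IsProbabilityMeasure μ] {n : ℕ} {F : X → EuclideanSpace ℝ (Fin n)} (hF : Measurable F)
    {q C s : ℝ} (hq : 0 < q) (hC : 0 < C) (hs : 0 < s)
    (h : ExpConcentrated q C s (μ.map F)) :
    Concentrated (concentrationBound q C s) μ (fun x => (F x).ofLp) := by
  have htail : ∀ φ : EuclideanSpace ℝ (Fin n) → ℝ, LipschitzWith 1 φ → ∀ t : ℝ, 0 < t →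
      μ.real {x | t ≤ |φ (F x) - ∫ y, φ (F y) ∂μ|} ≤ C * Real.exp (-(t / s) ^ q) :=
    fun φ hφ t ht => by
    have h1 := h φ hφ t ht
    have hφm : Measurable φ := hφ.continuous.measurable
    have hset : MeasurableSet {z | t ≤ |φ z - ∫ y, φ (F y) ∂μ|} :=
      measurableSet_le measurable_const (hφm.sub measurable_const).abs
    rw [integral_map hF.aemeasurable hφm.aestronglyMeasurable,
      map_measureReal_apply hF hset] at h1
    exact h1
  have hmom : ∀ φ : EuclideanSpace ℝ (Fin n) → ℝ, LipschitzWith 1 φ → ∀ p : ℕ, 0 < p →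
      Integrable (fun x => |φ (F x) - ∫ y, φ (F y) ∂μ| ^ p) μ ∧
      ∫ x, |φ (F x) - ∫ y, φ (F y) ∂μ| ^ p ∂μ ≤ tailMoment q C s p := fun φ hφ p hp =>
    integrable_abs_pow_of_tail
      ((hφ.continuous.measurable.comp hF).sub measurable_const).aemeasurable hq hC hs
      (htail φ hφ) hp
  refine ⟨?_, fun i => ?_, fun φ hφ => ?_⟩
  · rw [concentrationBound]
    linarith [tailMoment_nonneg (q := q) (s := s) hC.le 4]
  · have hlip : LipschitzWith 1 fun a : EuclideanSpace ℝ (Fin n) => a i :=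
      LipschitzWith.of_dist_le_mul fun a b => by
        rw [NNReal.coe_one, one_mul, Real.dist_eq, dist_eq_norm]
        exact PiLp.norm_apply_le (a - b) i
    have hm : Measurable fun x => F x i := hlip.continuous.measurable.comp hF
    have h1 : AllLp (fun x => F x i - ∫ y, F y i ∂μ) μ := by
      refine ⟨(hm.sub measurable_const).aestronglyMeasurable, fun p => ?_⟩
      rcases Nat.eq_zero_or_pos p with rfl | hp
      · simp
      · exact (hmom _ hlip p hp).1
    simpa using h1.add (.const (∫ y, F y i ∂μ))
  · have hlip : LipschitzWith 1 fun a : EuclideanSpace ℝ (Fin n) => φ a.ofLp :=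
      LipschitzWith.of_dist_le_mul fun a b => by
        rw [NNReal.coe_one, one_mul, Real.dist_eq, ← dotProduct_sub_eq_dist]
        exact hφ _ _
    have h1 := (hmom _ hlip 4 (by norm_num)).2
    simp only [Even.pow_abs (show Even 4 by decide)] at h1
    rw [concentrationBound]
    linarith

end ExponentialConcentration

/-! ### Rearranging products of measures -/

section Rearrangement

variable {α β γ δ : Type*} [MeasurableSpace α] [MeasurableSpace β] [MeasurableSpace γ]
  [MeasurableSpace δ] {P : Measure α} {Q : Measure β} {R : Measure γ} {S : Measure δ}
  [SFinite P] [SFinite Q] [SFinite R] [SFinite S]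

omit [SFinite P] [SFinite Q] in
lemma integral_comp_of_measurePreserving {f : β → ℝ} {T : α → β} (hT : MeasurePreserving T P Q)
    (hf : AEStronglyMeasurable f Q) : ∫ x, f (T x) ∂P = ∫ y, f y ∂Q := by
  rw [← hT.map_eq, integral_map hT.aemeasurable (by rwa [hT.map_eq])]

lemma measurePreserving_prodAssoc :
    MeasurePreserving (MeasurableEquiv.prodAssoc (α := α) (β := β) (γ := γ))
      ((P.prod Q).prod R) (P.prod (Q.prod R)) :=
  ⟨MeasurableEquiv.prodAssoc.measurable, Measure.prodAssoc_prod⟩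

lemma measurePreserving_prod_right_comm :
    MeasurePreserving (fun p : (α × β) × γ => ((p.1.1, p.2), p.1.2)) ((P.prod Q).prod R)
      ((P.prod R).prod Q) :=
  (measurePreserving_prodAssoc.symm MeasurableEquiv.prodAssoc).comp
    (((MeasurePreserving.id P).prod Measure.measurePreserving_swap).comp
      measurePreserving_prodAssoc)

lemma measurePreserving_prod_prod_prod_comm :
    MeasurePreserving (fun p : (α × β) × (γ × δ) => ((p.1.1, p.2.1), (p.1.2, p.2.2)))
      ((P.prod Q).prod (R.prod S)) ((P.prod R).prod (Q.prod S)) :=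
  measurePreserving_prodAssoc.comp ((measurePreserving_prod_right_comm.prod
    (MeasurePreserving.id S)).comp (measurePreserving_prodAssoc.symm MeasurableEquiv.prodAssoc))

end Rearrangement

/-! ### Linear combinations of independent noises -/

section Noise

variable {Ω : Type*} [MeasurableSpace Ω] {P : Measure Ω} [IsProbabilityMeasure P] {N : ℕ}
  {ν : Measure ℝ} [IsProbabilityMeasure ν] {σ : ℝ} {a : Fin N → Ω → ℝ} {f : Ω → ℝ}

lemma integral_noise (hν : MemLp (fun x => x) 2 ν) (hm : ∫ x, x ∂ν = 0) (b : Fin N → ℝ) :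
    ∫ e : Fin N → ℝ, ∑ j, e j * b j ∂(Measure.pi fun _ => ν) = 0 := by
  have hev := fun j => measurePreserving_eval (fun _ : Fin N => ν) j
  have h1 : Integrable (fun x : ℝ => x) ν := hν.integrable (by norm_num)
  have h3 : ∀ j, Integrable (fun e : Fin N → ℝ => e j * b j) (Measure.pi fun _ => ν) := fun j =>
    ((hev j).integrable_comp_of_integrable h1).mul_const (b j)
  rw [integral_finsetSum _ fun j _ => h3 j]
  refine Finset.sum_eq_zero fun j _ => ?_
  rw [integral_mul_const]
  have h2 := integral_comp_of_measurePreserving (hev j) h1.1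
  rw [hm] at h2
  rw [show ∫ e : Fin N → ℝ, e j ∂(Measure.pi fun _ => ν) = 0 from h2, zero_mul]

lemma memLp_noise_const (hν : MemLp (fun x => x) 2 ν) (b : Fin N → ℝ) :
    MemLp (fun e : Fin N → ℝ => ∑ j, e j * b j) 2 (Measure.pi fun _ => ν) :=
  memLp_finsetSum _ fun j _ => MemLp.mul_const
    (hν.comp_measurePreserving (measurePreserving_eval (fun _ : Fin N => ν) j)) (b j)

omit [IsProbabilityMeasure ν] in
lemma integral_sq_eq (hν : MemLp (fun x => x) 2 ν) (hm : ∫ x, x ∂ν = 0)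
    (hv : ProbabilityTheory.variance (fun x => x) ν = σ ^ 2) : ∫ x, x ^ 2 ∂ν = σ ^ 2 := by
  rw [← hv, ProbabilityTheory.variance_of_integral_eq_zero hν.1.aemeasurable hm]

lemma integral_noise_sq (hν : MemLp (fun x => x) 2 ν) (hm : ∫ x, x ∂ν = 0)
    (hv : ProbabilityTheory.variance (fun x => x) ν = σ ^ 2) (b : Fin N → ℝ) :
    ∫ e : Fin N → ℝ, (∑ j, e j * b j) ^ 2 ∂(Measure.pi fun _ => ν) =
      σ ^ 2 * ∑ j, b j ^ 2 := by
  have h1 := ProbabilityTheory.variance_sum_pi (μ := fun _ : Fin N => ν)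
    (X := fun j x => x * b j) fun j => hν.mul_const (b j)
  have h2 : (∑ j, fun e : Fin N → ℝ => e j * b j) = fun e => ∑ j, e j * b j := by
    ext e; simp
  rw [h2, ProbabilityTheory.variance_of_integral_eq_zero
    (memLp_noise_const hν b).1.aemeasurable (integral_noise hν hm b)] at h1
  rw [h1, Finset.mul_sum]
  refine Finset.sum_congr rfl fun j _ => ?_
  rw [show (fun x : ℝ => x * b j) = fun x => b j * x by funext x; ring,
    ProbabilityTheory.variance_const_mul, hv, mul_comm]

lemma memLp_noise (hν : MemLp (fun x => x) 2 ν) (ha : ∀ j, MemLp (a j) 2 P) :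
    MemLp (fun q : Ω × (Fin N → ℝ) => ∑ j, q.2 j * a j q.1) 2
      (P.prod (Measure.pi fun _ => ν)) := by
  refine memLp_finsetSum _ fun j _ => ?_
  have he : MemLp (fun e : Fin N → ℝ => e j) 2 (Measure.pi fun _ => ν) :=
    hν.comp_measurePreserving (measurePreserving_eval (fun _ : Fin N => ν) j)
  have hm : AEStronglyMeasurable (fun q : Ω × (Fin N → ℝ) => q.2 j * a j q.1)
      (P.prod (Measure.pi fun _ => ν)) :=
    (he.1.comp_measurePreserving measurePreserving_snd).mul
      ((ha j).1.comp_measurePreserving measurePreserving_fst)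
  rw [memLp_two_iff_integrable_sq hm]
  refine ((ha j).integrable_sq.mul_prod he.integrable_sq).congr (.of_forall fun q => ?_)
  simp only
  ring

lemma integral_noise_weight_sq (hν : MemLp (fun x => x) 2 ν) (hm : ∫ x, x ∂ν = 0)
    (hv : ProbabilityTheory.variance (fun x => x) ν = σ ^ 2) (ha : ∀ j, MemLp (a j) 2 P) :
    ∫ q : Ω × (Fin N → ℝ), (∑ j, q.2 j * a j q.1) ^ 2 ∂(P.prod (Measure.pi fun _ => ν)) =
      σ ^ 2 * ∫ ω, ∑ j, a j ω ^ 2 ∂P := by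
  rw [integral_prod _ (memLp_noise hν ha).integrable_sq, ← integral_const_mul]
  congr 1; funext ω
  exact integral_noise_sq hν hm hv fun j => a j ω

lemma memLp_total (hν : MemLp (fun x => x) 2 ν) (ha : ∀ j, MemLp (a j) 2 P)
    (hf : MemLp f 2 P) :
    MemLp (fun q : Ω × ((Fin N → ℝ) × ℝ) => f q.1 + ∑ j, q.2.1 j * a j q.1 - q.2.2) 2
      (P.prod ((Measure.pi fun _ => ν).prod ν)) :=
  ((hf.comp_measurePreserving measurePreserving_fst).add
    ((memLp_noise hν ha).comp_measurePreserving
      ((MeasurePreserving.id P).prod measurePreserving_fst))).sub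
    ((hν.comp_measurePreserving measurePreserving_snd).comp_measurePreserving
      measurePreserving_snd)

/-- A signal, a linear combination of centered independent noises and another independent noise are
orthogonal. -/
lemma integral_total_sq (hν : MemLp (fun x => x) 2 ν) (hm : ∫ x, x ∂ν = 0)
    (hv : ProbabilityTheory.variance (fun x => x) ν = σ ^ 2) (ha : ∀ j, MemLp (a j) 2 P)
    (hf : MemLp f 2 P) :
    ∫ q : Ω × ((Fin N → ℝ) × ℝ), (f q.1 + ∑ j, q.2.1 j * a j q.1 - q.2.2) ^ 2
        ∂(P.prod ((Measure.pi fun _ => ν).prod ν)) =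
      ∫ ω, f ω ^ 2 ∂P + σ ^ 2 * ∫ ω, ∑ j, a j ω ^ 2 ∂P + σ ^ 2 := by
  have hinner : ∀ ω, ∫ r : (Fin N → ℝ) × ℝ, (f ω + ∑ j, r.1 j * a j ω - r.2) ^ 2
      ∂((Measure.pi fun _ => ν).prod ν) = f ω ^ 2 + σ ^ 2 * ∑ j, a j ω ^ 2 + σ ^ 2 := fun ω => by
    have h1 := memLp_noise_const hν fun j => a j ω
    have hY : MemLp (fun r : (Fin N → ℝ) × ℝ => ∑ j, r.1 j * a j ω) 2
        ((Measure.pi fun _ => ν).prod ν) := h1.comp_measurePreserving measurePreserving_fst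
    have hE : MemLp (fun r : (Fin N → ℝ) × ℝ => r.2) 2 ((Measure.pi fun _ => ν).prod ν) :=
      hν.comp_measurePreserving measurePreserving_snd
    have iY : ∫ r : (Fin N → ℝ) × ℝ, ∑ j, r.1 j * a j ω ∂((Measure.pi fun _ => ν).prod ν) = 0 := by
      rw [integral_fun_fst (fun e : Fin N → ℝ => ∑ j, e j * a j ω), integral_noise hν hm, smul_zero]
    have iY2 : ∫ r : (Fin N → ℝ) × ℝ, (∑ j, r.1 j * a j ω) ^ 2
        ∂((Measure.pi fun _ => ν).prod ν) = σ ^ 2 * ∑ j, a j ω ^ 2 := by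
      rw [integral_fun_fst (fun e : Fin N → ℝ => (∑ j, e j * a j ω) ^ 2),
        integral_noise_sq hν hm hv]
      simp
    have iE : ∫ r : (Fin N → ℝ) × ℝ, r.2 ∂((Measure.pi fun _ => ν).prod ν) = 0 := by
      rw [integral_fun_snd (fun x : ℝ => x), hm, smul_zero]
    have iE2 : ∫ r : (Fin N → ℝ) × ℝ, r.2 ^ 2 ∂((Measure.pi fun _ => ν).prod ν) = σ ^ 2 := by
      rw [integral_fun_snd (fun x : ℝ => x ^ 2), integral_sq_eq hν hm hv]
      simp
    have iYE : ∫ r : (Fin N → ℝ) × ℝ, (∑ j, r.1 j * a j ω) * r.2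
        ∂((Measure.pi fun _ => ν).prod ν) = 0 := by
      rw [integral_prod_mul (fun e : Fin N → ℝ => ∑ j, e j * a j ω) fun x : ℝ => x, hm, mul_zero]
    have hexp : ∀ r : (Fin N → ℝ) × ℝ, (f ω + ∑ j, r.1 j * a j ω - r.2) ^ 2 =
        f ω ^ 2 + (∑ j, r.1 j * a j ω) ^ 2 + r.2 ^ 2 + (2 * f ω) * (∑ j, r.1 j * a j ω) +
          (-(2 * f ω)) * r.2 + (-2) * ((∑ j, r.1 j * a j ω) * r.2) := fun r => by ring
    simp only [hexp]
    have j1 := hY.integrable (q := 2) (by norm_num)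
    have j2 := hE.integrable (q := 2) (by norm_num)
    have j3 := hY.integrable_sq
    have j4 := hE.integrable_sq
    have j5 : Integrable (fun r : (Fin N → ℝ) × ℝ => (∑ j, r.1 j * a j ω) * r.2)
        ((Measure.pi fun _ => ν).prod ν) := hY.integrable_mul hE
    have k0 : Integrable (fun _ : (Fin N → ℝ) × ℝ => f ω ^ 2)
        ((Measure.pi fun _ => ν).prod ν) := integrable_const _
    have k1 := k0.add j3
    have k2 := k1.add j4
    have k3 := k2.add (j1.const_mul (2 * f ω))
    have k4 := k3.add (j2.const_mul (-(2 * f ω)))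
    refine (integral_add k4 (j5.const_mul (-2))).trans ?_
    rw [integral_const_mul, iYE]
    refine (congrArg (· + _) ((integral_add k3 (j2.const_mul _)).trans (congrArg (· + _)
      ((integral_add k2 (j1.const_mul _)).trans (congrArg (· + _)
      ((integral_add k1 j4).trans (congrArg (· + _) (integral_add k0 j3)))))))).trans ?_
    rw [integral_const_mul, integral_const_mul, iY, iE, iE2, iY2]
    simp
  have ia : Integrable (fun ω => ∑ j, a j ω ^ 2) P :=
    integrable_finsetSum _ fun j _ => (ha j).integrable_sq
  rw [integral_prod _ (memLp_total hν ha hf).integrable_sq]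
  simp only [hinner]
  rw [integral_add (f := fun ω => f ω ^ 2 + σ ^ 2 * ∑ j, a j ω ^ 2)
      (hf.integrable_sq.add (ia.const_mul _)) (integrable_const _),
    integral_add hf.integrable_sq (ia.const_mul _), integral_const_mul]
  simp

end Noise

/-! ### The prediction as a linear combination of the labels -/

section Smoother

variable {X : Type*} [MeasurableSpace X] {n N : ℕ} {μ : Measure X} [IsProbabilityMeasure μ]
  {z : X → Fin n → ℝ} {ν lam : ℝ}

/-- The weight of the `j`-th label in the ridge prediction at the test input `p.2`. -/
def labelWeight (ν lam : ℝ) (z : X → Fin n → ℝ) (j : Fin N) (p : (Fin N → X) × X) : ℝ :=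
  ν⁻¹ * (z (p.1 j) ⬝ᵥ ((gram ν lam fun k => z (p.1 k))⁻¹ *ᵥ z p.2))

omit [MeasurableSpace X] in
lemma ridge_dotProduct (hν : 0 ≤ ν) (y : Fin N → ℝ) (p : (Fin N → X) × X) :
    ridge ν lam (fun k => z (p.1 k)) y ⬝ᵥ z p.2 = ∑ j, y j * labelWeight ν lam z j p := by
  have hA := gram_coercive hν lam (fun k => z (p.1 k))
  rw [ridge, dotProduct_comm, dotProduct_mulVec_comm hA.inv_symm, smul_dotProduct, smul_eq_mul,
    sum_dotProduct, Finset.mul_sum]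
  refine Finset.sum_congr rfl fun j _ => ?_
  rw [smul_dotProduct, smul_eq_mul, labelWeight]
  ring

lemma allLp_labelWeight (hz : ∀ i, AllLp (fun x => z x i) μ) (hν : 0 ≤ ν) (hlam : 0 < lam)
    (j : Fin N) : AllLp (labelWeight ν lam z j) ((Measure.pi fun _ => μ).prod μ) :=
  (AllLp.dotProduct (fun i => (allLp_sample hz j i).comp measurePreserving_fst)
    (AllLp.mulVec (fun i k => (AllLp.inv_gram (fun j i => allLp_sample hz j i) hν hlam i k).comp
      measurePreserving_fst) fun i => (hz i).comp measurePreserving_snd)).const_mul _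

end Smoother

/-! ### The bias-variance decomposition -/

section Decomposition

variable {T n N : ℕ} {μ : Measure (EuclideanSpace ℝ (Fin T))} [IsProbabilityMeasure μ]
  {ν : Measure ℝ} [IsProbabilityMeasure ν] {σ lam : ℝ} {θ : EuclideanSpace ℝ (Fin T)}
  {F : EuclideanSpace ℝ (Fin T) → EuclideanSpace ℝ (Fin n)}

/-- The features, as a vector of coordinates. -/
def features (F : EuclideanSpace ℝ (Fin T) → EuclideanSpace ℝ (Fin n))
    (u : EuclideanSpace ℝ (Fin T)) : Fin n → ℝ := (F u).ofLp

/-- The noiseless outputs. -/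
def teacher (θ u : EuclideanSpace ℝ (Fin T)) : ℝ := inner ℝ θ u

omit [IsProbabilityMeasure μ] in
lemma memLp_teacher (hμ : MemLp (fun u => u) 2 μ) (θ : EuclideanSpace ℝ (Fin T)) :
    MemLp (teacher θ) 2 μ :=
  MemLp.const_inner θ hμ

lemma readout_eq (U : Fin N → EuclideanSpace ℝ (Fin T)) (y : Fin N → ℝ) :
    readout F lam U y = ridge N lam (fun j => features F (U j)) y := by
  have h1 : featureMatrix F U * (featureMatrix F U)ᵀ =
      ∑ j, Matrix.vecMulVec (features F (U j)) (features F (U j)) := by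
    ext i k
    simp [featureMatrix, Matrix.mul_apply, Matrix.sum_apply, Matrix.vecMulVec_apply, features]
  have h2 : featureMatrix F U *ᵥ y = ∑ j, y j • features F (U j) := by
    ext i
    simp [featureMatrix, Matrix.mulVec, dotProduct, features, mul_comm]
  rw [readout, ridge, gram, h1, h2]

lemma prediction_eq (U : Fin N → EuclideanSpace ℝ (Fin T)) (e : Fin N → ℝ)
    (x : EuclideanSpace ℝ (Fin T)) :
    prediction F lam θ U e x = ridgePrediction N lam (features F) (teacher θ) (U, x) +
      ∑ j, e j * labelWeight N lam (features F) j (U, x) := by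
  have hN : (0 : ℝ) ≤ N := Nat.cast_nonneg N
  rw [prediction, readout_eq]
  change ridge _ _ _ _ ⬝ᵥ features F x = _
  rw [ridge_dotProduct hN (labels θ U e) (U, x), ridgePrediction, sampleRidge,
    ridge_dotProduct hN (fun j => teacher θ (U j)) (U, x), ← Finset.sum_add_distrib]
  exact Finset.sum_congr rfl fun j _ => add_mul _ _ _

lemma meanPrediction_eq (hν : MemLp (fun x => x) 2 ν) (hm : ∫ x, x ∂ν = 0)
    (U : Fin N → EuclideanSpace ℝ (Fin T)) (x : EuclideanSpace ℝ (Fin T)) :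
    meanPrediction F lam θ ν U x =
      ridgePrediction N lam (features F) (teacher θ) (U, x) := by
  simp only [meanPrediction, prediction_eq]
  rw [integral_add (integrable_const _)
    ((memLp_noise_const hν fun j => labelWeight N lam (features F) j (U, x)).integrable
      (by norm_num)), integral_noise hν hm]
  simp

lemma biasError_eq (hν : MemLp (fun x => x) 2 ν) (hm : ∫ x, x ∂ν = 0)
    (p : (Fin N → EuclideanSpace ℝ (Fin T)) × EuclideanSpace ℝ (Fin T)) :
    biasError F lam θ ν p = -ridgeError N lam (features F) (teacher θ) p := by
  rw [biasError, meanPrediction_eq hν hm, ridgeError, teacher]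
  ring

lemma varError_eq (hν : MemLp (fun x => x) 2 ν) (hm : ∫ x, x ∂ν = 0)
    (p : ((Fin N → EuclideanSpace ℝ (Fin T)) × (Fin N → ℝ)) × EuclideanSpace ℝ (Fin T)) :
    varError F lam θ ν p =
      ∑ j, p.1.2 j * labelWeight N lam (features F) j (p.1.1, p.2) := by
  rw [varError, meanPrediction_eq hν hm, prediction_eq]
  ring

lemma testError_eq (hν : MemLp (fun x => x) 2 ν) (hm : ∫ x, x ∂ν = 0)
    (p : ((Fin N → EuclideanSpace ℝ (Fin T)) × (Fin N → ℝ)) ×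
      (EuclideanSpace ℝ (Fin T) × ℝ)) :
    testError F lam θ p = biasError F lam θ ν (p.1.1, p.2.1) +
      ∑ j, p.1.2 j * labelWeight N lam (features F) j (p.1.1, p.2.1) - p.2.2 := by
  rw [testError, biasError, meanPrediction_eq hν hm, prediction_eq]
  ring

lemma memLp_biasError (hz : ∀ i, AllLp (fun u => features F u i) μ)
    (hμ : MemLp (fun u => u) 2 μ) (hlam : 0 < lam) (hν : MemLp (fun x => x) 2 ν)
    (hm : ∫ x, x ∂ν = 0) :
    MemLp (biasError (N := N) F lam θ ν) 2 ((Measure.pi fun _ => μ).prod μ) := by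
  have h : biasError (N := N) F lam θ ν = -ridgeError N lam (features F) (teacher θ) :=
    funext (biasError_eq hν hm)
  rw [h]
  exact (memLp_ridgeError hz (memLp_teacher hμ θ) (Nat.cast_nonneg N) hlam).neg

omit [IsProbabilityMeasure μ] in
lemma biasSq_eq (hν : MemLp (fun x => x) 2 ν) (hm : ∫ x, x ∂ν = 0) :
    biasSq N μ ν θ F lam = ∫ p : (Fin N → EuclideanSpace ℝ (Fin T)) × EuclideanSpace ℝ (Fin T),
      ridgeError N lam (features F) (teacher θ) p ^ 2 ∂((Measure.pi fun _ => μ).prod μ) := by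
  simp only [biasSq, biasError_eq hν hm, neg_sq]

lemma memLp_labelWeight (hz : ∀ i, AllLp (fun u => features F u i) μ) (hlam : 0 < lam)
    (j : Fin N) :
    MemLp (labelWeight N lam (features F) j) 2 ((Measure.pi fun _ => μ).prod μ) :=
  (allLp_labelWeight hz (Nat.cast_nonneg N) hlam j).memLp_two

lemma memLp_varError (hz : ∀ i, AllLp (fun u => features F u i) μ) (hlam : 0 < lam)
    (hν : MemLp (fun x => x) 2 ν) (hm : ∫ x, x ∂ν = 0) :
    MemLp (varError (N := N) F lam θ ν) 2 ((trainLaw N μ ν).prod μ) := by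
  have h := (memLp_noise (P := (Measure.pi fun _ : Fin N => μ).prod μ) hν
    (memLp_labelWeight hz hlam)).comp_measurePreserving measurePreserving_prod_right_comm
  exact h.ae_eq (.of_forall fun p => (varError_eq hν hm p).symm)

lemma memLp_testError (hz : ∀ i, AllLp (fun u => features F u i) μ)
    (hμ : MemLp (fun u => u) 2 μ) (hlam : 0 < lam) (hν : MemLp (fun x => x) 2 ν)
    (hm : ∫ x, x ∂ν = 0) :
    MemLp (testError (N := N) F lam θ) 2 ((trainLaw N μ ν).prod (μ.prod ν)) := by
  have h := (memLp_total (P := (Measure.pi fun _ : Fin N => μ).prod μ) hν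
    (memLp_labelWeight hz hlam) (memLp_biasError (θ := θ) hz hμ hlam hν hm)).comp_measurePreserving
      measurePreserving_prod_prod_prod_comm
  exact h.ae_eq (.of_forall fun p => (testError_eq hν hm p).symm)

/-- The variance depends on the law of the noise only through its second moment. -/
lemma variance_eq (hz : ∀ i, AllLp (fun u => features F u i) μ) (hlam : 0 < lam)
    (hν : MemLp (fun x => x) 2 ν) (hm : ∫ x, x ∂ν = 0)
    (hv : ProbabilityTheory.variance (fun x => x) ν = σ ^ 2) :
    variance N μ ν θ F lam = σ ^ 2 *
      ∫ p : (Fin N → EuclideanSpace ℝ (Fin T)) × EuclideanSpace ℝ (Fin T),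
        ∑ j, labelWeight N lam (features F) j p ^ 2 ∂((Measure.pi fun _ => μ).prod μ) := by
  have ha := memLp_labelWeight (N := N) hz hlam
  rw [← integral_noise_weight_sq hν hm hv ha]
  simp only [variance, varError_eq hν hm]
  exact integral_comp_of_measurePreserving measurePreserving_prod_right_comm
    (memLp_noise hν ha).integrable_sq.1

/-- The bias-variance decomposition. -/
lemma risk_eq (hz : ∀ i, AllLp (fun u => features F u i) μ)
    (hμ : MemLp (fun u => u) 2 μ) (hlam : 0 < lam) (hν : MemLp (fun x => x) 2 ν)
    (hm : ∫ x, x ∂ν = 0) (hv : ProbabilityTheory.variance (fun x => x) ν = σ ^ 2) :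
    risk N μ ν θ F lam = biasSq N μ ν θ F lam + variance N μ ν θ F lam + σ ^ 2 := by
  have ha := memLp_labelWeight (N := N) hz hlam
  have hf := memLp_biasError (N := N) (θ := θ) hz hμ hlam hν hm
  rw [variance_eq hz hlam hν hm hv, biasSq, ← integral_total_sq hν hm hv ha hf]
  simp only [risk, testError_eq hν hm]
  exact integral_comp_of_measurePreserving measurePreserving_prod_prod_prod_comm
    (memLp_total hν ha hf).integrable_sq.1

/-- A ridge predictor that is trained on pure noise and tested on pure noise has the noise level
plus the variance as its risk. -/
lemma integral_ridgeError_noise_sq (hz : ∀ i, AllLp (fun u => features F u i) μ) (hlam : 0 < lam)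
    (hν : MemLp (fun x => x) 2 ν) (hm : ∫ x, x ∂ν = 0)
    (hv : ProbabilityTheory.variance (fun x => x) ν = σ ^ 2) :
    ∫ q : (Fin N → EuclideanSpace ℝ (Fin T) × ℝ) × (EuclideanSpace ℝ (Fin T) × ℝ),
      ridgeError N lam (fun p => features F p.1) (fun p => p.2) q ^ 2
        ∂((Measure.pi fun _ => μ.prod ν).prod (μ.prod ν)) =
      variance N μ ν θ F lam + σ ^ 2 := by
  have ha := memLp_labelWeight (N := N) hz hlam
  have h0 : MemLp (fun _ : (Fin N → EuclideanSpace ℝ (Fin T)) × EuclideanSpace ℝ (Fin T) => (0 : ℝ))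
      2 ((Measure.pi fun _ => μ).prod μ) := MemLp.zero
  have hpt : ∀ q : (Fin N → EuclideanSpace ℝ (Fin T) × ℝ) × (EuclideanSpace ℝ (Fin T) × ℝ),
      ridgeError N lam (fun p => features F p.1) (fun p => p.2) q =
        -(0 + ∑ j, (q.1 j).2 * labelWeight N lam (features F) j
          (fun k => (q.1 k).1, q.2.1) - q.2.2) := fun q => by
    rw [ridgeError, ridgePrediction, sampleRidge,
      ridge_dotProduct (Nat.cast_nonneg N) (z := fun p : EuclideanSpace ℝ (Fin T) × ℝ =>
        features F p.1)]
    simp only [labelWeight]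
    ring
  have hT := (measurePreserving_prod_prod_prod_comm (P := Measure.pi fun _ : Fin N => μ)
    (Q := Measure.pi fun _ : Fin N => ν) (R := μ) (S := ν)).comp
    ((measurePreserving_arrowProdEquivProdArrow _ _ (Fin N) (fun _ => μ) (fun _ => ν)).prod
      (MeasurePreserving.id (μ.prod ν)))
  have h := integral_comp_of_measurePreserving hT (memLp_total hν ha h0).integrable_sq.1
  rw [integral_total_sq hν hm hv ha h0, ← variance_eq (θ := θ) hz hlam hν hm hv] at h
  simp only [hpt, neg_sq]
  refine Eq.trans ?_ (h.trans (by simp))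
  rfl

end Decomposition

/-! ### Noise with two values -/

section SignNoise

/-- The law of a noise that takes the values `σ` and `-σ` with equal probability. -/
def signLaw (σ : ℝ) : Measure ℝ :=
  (2⁻¹ : ENNReal) • Measure.dirac σ + (2⁻¹ : ENNReal) • Measure.dirac (-σ)

instance (σ : ℝ) : IsProbabilityMeasure (signLaw σ) :=
  ⟨by simp [signLaw, ENNReal.inv_two_add_inv_two]⟩

lemma integral_signLaw (σ : ℝ) (f : ℝ → ℝ) :
    ∫ x, f x ∂(signLaw σ) = 2⁻¹ * f σ + 2⁻¹ * f (-σ) := by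
  have h : ∀ a : ℝ, Integrable f ((2⁻¹ : ENNReal) • Measure.dirac a) := fun a =>
    (integrable_dirac (by simp)).smul_measure (by simp)
  rw [signLaw, integral_add_measure (h _) (h _), integral_smul_measure, integral_smul_measure]
  simp

lemma memLp_signLaw (σ : ℝ) : MemLp (fun x => x) 2 (signLaw σ) := by
  have hm : AEStronglyMeasurable (fun x : ℝ => x) (signLaw σ) := measurable_id.aestronglyMeasurable
  rw [memLp_two_iff_integrable_sq hm]
  exact ((integrable_dirac (by simp)).smul_measure (by simp)).add_measure
    ((integrable_dirac (by simp)).smul_measure (by simp))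

lemma integral_id_signLaw (σ : ℝ) : ∫ x, x ∂(signLaw σ) = 0 := by
  rw [integral_signLaw]; ring

lemma variance_signLaw (σ : ℝ) :
    ProbabilityTheory.variance (fun x => x) (signLaw σ) = σ ^ 2 := by
  have hm : AEMeasurable (fun x : ℝ => x) (signLaw σ) := measurable_id.aemeasurable
  rw [ProbabilityTheory.variance_of_integral_eq_zero hm (integral_id_signLaw σ),
    integral_signLaw σ fun x => x ^ 2]
  ring

lemma ae_abs_le_signLaw (σ : ℝ) : ∀ᵐ x ∂(signLaw σ), |x| ≤ |σ| := by
  rw [signLaw, ae_add_measure_iff]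
  constructor <;> refine Measure.ae_smul_measure ?_ _ <;> simp [ae_dirac_eq]

end SignNoise

/-! ### The deterministic equivalent of the bias -/

section Equivalents

variable {T n : ℕ} {μ : Measure (EuclideanSpace ℝ (Fin T))} [IsProbabilityMeasure μ]
  {F : EuclideanSpace ℝ (Fin T) → EuclideanSpace ℝ (Fin n)} {lam : ℝ}

lemma quad_mul_mul_transpose (θ : EuclideanSpace ℝ (Fin T)) (A : Matrix (Fin T) (Fin n) ℝ)
    (B : Matrix (Fin n) (Fin n) ℝ) :
    quad θ (A * B * Aᵀ) = (Aᵀ *ᵥ θ.ofLp) ⬝ᵥ (B *ᵥ (Aᵀ *ᵥ θ.ofLp)) := by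
  rw [quad, ← Matrix.mulVec_mulVec, ← Matrix.mulVec_mulVec, Matrix.dotProduct_mulVec,
    ← Matrix.mulVec_transpose]

omit [IsProbabilityMeasure μ] in
lemma memLp_coord (hμ : MemLp (fun u => u) 2 μ) (i : Fin T) : MemLp (fun u => u i) 2 μ :=
  hμ.mono (by fun_prop) (.of_forall fun u => PiLp.norm_apply_le u i)

lemma teacher_eq (θ u : EuclideanSpace ℝ (Fin T)) : teacher θ u = ∑ i, θ i * u i := by
  simp [teacher, PiLp.inner_apply, mul_comm]

lemma quad_sigmaU (hμ : MemLp (fun u => u) 2 μ) (θ : EuclideanSpace ℝ (Fin T)) :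
    quad θ (sigmaU μ) = ∫ u, teacher θ u ^ 2 ∂μ := by
  have hij : ∀ i j, Integrable (fun u : EuclideanSpace ℝ (Fin T) => u i * u j) μ := fun i j =>
    (memLp_coord hμ i).integrable_mul (memLp_coord hμ j)
  have h : ∀ u, teacher θ u ^ 2 = ∑ i, ∑ j, θ i * θ j * (u i * u j) := fun u => by
    rw [sq, teacher_eq, Finset.sum_mul_sum]
    exact Finset.sum_congr rfl fun i _ => Finset.sum_congr rfl fun j _ => by ring
  simp only [h]
  rw [integral_finsetSum _ fun i _ => integrable_finsetSum _ fun j _ => (hij i j).const_mul _]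
  simp only [quad, dotProduct, Matrix.mulVec, sigmaU, Matrix.of_apply]
  refine Finset.sum_congr rfl fun i _ => ?_
  rw [integral_finsetSum _ fun j _ => (hij i j).const_mul _, Finset.mul_sum]
  refine Finset.sum_congr rfl fun j _ => ?_
  rw [integral_const_mul]
  ring

lemma sigmaUZ_transpose_mulVec (hz : ∀ i, AllLp (fun u => features F u i) μ)
    (hμ : MemLp (fun u => u) 2 μ) (θ : EuclideanSpace ℝ (Fin T)) :
    (sigmaUZ μ F)ᵀ *ᵥ θ.ofLp = crossMoment μ (teacher θ) (features F) := by
  ext i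
  have hij : ∀ j, Integrable (fun u : EuclideanSpace ℝ (Fin T) => u j * features F u i) μ :=
    fun j => integrable_mul_apply hz (memLp_coord hμ j) i
  have h : ∀ u, teacher θ u * features F u i = ∑ j, θ j * (u j * features F u i) := fun u => by
    rw [teacher_eq, Finset.sum_mul]
    exact Finset.sum_congr rfl fun j _ => by ring
  simp only [crossMoment, h]
  rw [integral_finsetSum _ fun j _ => (hij j).const_mul _]
  simp only [Matrix.mulVec, dotProduct, Matrix.transpose_apply, sigmaUZ, Matrix.of_apply]
  refine Finset.sum_congr rfl fun j _ => ?_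
  rw [integral_const_mul, mul_comm]
  rfl

lemma biasEquiv_eq (hz : ∀ i, AllLp (fun u => features F u i) μ)
    (hμ : MemLp (fun u => u) 2 μ) (θ : EuclideanSpace ℝ (Fin T)) (hlam : 0 < lam) {N : ℕ} {δ : ℝ}
    (hδ : 0 ≤ δ) :
    biasEquiv N μ θ F lam δ = (1 - alpha N (secondMoment μ (features F)) lam δ)⁻¹ *
      equivRisk μ (features F) (teacher θ) lam δ := by
  have hS := secondMoment_posSemidef hz
  have hQ := (qBar_posSemidef hS hlam hδ).transpose_eq
  have hZ : sigmaZ μ F = secondMoment μ (features F) := rfl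
  have h3 : sigmaUZ μ F * qBar (sigmaZ μ F) lam δ * sigmaZ μ F * qBar (sigmaZ μ F) lam δ
      * (sigmaUZ μ F)ᵀ = sigmaUZ μ F * (qBar (sigmaZ μ F) lam δ * sigmaZ μ F *
        qBar (sigmaZ μ F) lam δ) * (sigmaUZ μ F)ᵀ := by
    simp only [Matrix.mul_assoc]
  rw [biasEquiv, h3, quad_mul_mul_transpose, quad_mul_mul_transpose,
    sigmaUZ_transpose_mulVec hz hμ, quad_sigmaU hμ, hZ, form_mul_mul hQ, equivRisk, one_div,
    dotProduct_comm (crossMoment μ (teacher θ) (features F))]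
  congr 1
  simp only [div_eq_mul_inv, inv_pow]
  ring

end Equivalents

/-! ### Features augmented with an independent label -/

section Augmented

variable {X : Type*} [MeasurableSpace X] {n : ℕ} {μ : Measure X} [IsProbabilityMeasure μ]
  {ρ : Measure ℝ} [IsProbabilityMeasure ρ] {z : X → Fin n → ℝ} {c : ℝ}

lemma secondMoment_prod_fst : secondMoment (μ.prod ρ) (fun p => z p.1) = secondMoment μ z := by
  ext i j
  simp only [secondMoment, Matrix.of_apply]
  rw [integral_fun_fst (fun x => z x i * z x j)]
  simp

lemma Concentrated.prod_fst (hz : Concentrated c μ z) :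
    Concentrated c (μ.prod ρ) (fun p => z p.1) where
  one_le := hz.one_le
  allLp i := (hz.allLp i).comp measurePreserving_fst
  moment φ hφ := by
    have h := hz.moment φ hφ
    rw [integral_fun_fst (fun x => φ (z x)),
      integral_fun_fst (fun x => (φ (z x) - (ρ.real Set.univ) • ∫ y, φ (z y) ∂μ) ^ 4)]
    simpa using h

/-- A centered label which is independent of the features is uncorrelated with them. -/
lemma crossMoment_prod_snd (hρ : ∫ x, x ∂ρ = 0) :
    crossMoment (μ.prod ρ) (fun p => p.2) (fun p => z p.1) = 0 := by
  ext i
  simp only [crossMoment, Pi.zero_apply]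
  have h := integral_prod_mul (μ := μ) (ν := ρ) (fun x => z x i) (fun e : ℝ => e)
  rw [hρ, mul_zero] at h
  rw [← h]
  exact integral_congr_ae (.of_forall fun p => mul_comm _ _)

/-- Labels which are pure noise, independent of the features, cannot be predicted. -/
lemma equivRisk_noise (hρ : ∫ x, x ∂ρ = 0) (lam δ : ℝ) :
    equivRisk (μ.prod ρ) (fun p => z p.1) (fun p => p.2) lam δ = ∫ x, x ^ 2 ∂ρ := by
  rw [equivRisk, crossMoment_prod_snd hρ, integral_fun_snd (fun x : ℝ => x ^ 2)]
  simp

end Augmented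

end

end RidgeFeatures

theorem theorem1
    (T n N : ℕ → ℕ)
    -- high-dimensional asymptotics (these two lines force `n k → ∞`)
    (γ : ℝ) (hγ : 0 < γ) (hN : Tendsto N atTop atTop)
    (hnN : Tendsto (fun k => (n k : ℝ) / (N k : ℝ)) atTop (𝓝 γ))
    -- the inputs
    (μ : (k : ℕ) → Measure (EuclideanSpace ℝ (Fin (T k)))) [∀ k, IsProbabilityMeasure (μ k)]
    (hμ : ∀ k, MemLp (fun u => u) 2 (μ k))
    -- the label noise
    (σ : ℝ) (ν : ℕ → Measure ℝ) [∀ k, IsProbabilityMeasure (ν k)]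
    (hν : ∀ k, MemLp (fun x => x) 2 (ν k))
    (hν_mean : ∀ k, ∫ x, x ∂(ν k) = 0)
    (hν_var : ∀ k, ProbabilityTheory.variance (fun x => x) (ν k) = σ ^ 2)
    -- the teacher, whose squared noiseless outputs are uniformly integrable
    (θ : (k : ℕ) → EuclideanSpace ℝ (Fin (T k)))
    (hθ : ∀ ε : ℝ, 0 < ε → ∃ K : ℝ, ∀ k,
      ∫ u in {u | K ≤ |inner ℝ (θ k) u|}, (inner ℝ (θ k) u) ^ 2 ∂(μ k) ≤ ε)
    -- the feature maps, with concentrated features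
    (F : (k : ℕ) → EuclideanSpace ℝ (Fin (T k)) → EuclideanSpace ℝ (Fin (n k)))
    (hF : ∀ k, Measurable (F k))
    (q C s : ℝ) (hq : 0 < q) (hC : 0 < C) (hs : 0 < s)
    (hconc : ∀ k, RidgeFeatures.ExpConcentrated q C s ((μ k).map (F k)))
    -- the regularization parameter
    (lam : ℝ) (hlam : 0 < lam) :
    -- the exact decomposition, with finite risk, bias and variance
    (∀ k,
      MemLp (RidgeFeatures.testError (N := N k) (F k) lam (θ k)) 2
        ((RidgeFeatures.trainLaw (N k) (μ k) (ν k)).prod ((μ k).prod (ν k))) ∧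
      MemLp (RidgeFeatures.biasError (N := N k) (F k) lam (θ k) (ν k)) 2
        ((Measure.pi fun _ : Fin (N k) => μ k).prod (μ k)) ∧
      MemLp (RidgeFeatures.varError (N := N k) (F k) lam (θ k) (ν k)) 2
        ((RidgeFeatures.trainLaw (N k) (μ k) (ν k)).prod (μ k)) ∧
      RidgeFeatures.risk (N k) (μ k) (ν k) (θ k) (F k) lam =
        RidgeFeatures.biasSq (N k) (μ k) (ν k) (θ k) (F k) lam +
        RidgeFeatures.variance (N k) (μ k) (ν k) (θ k) (F k) lam + σ ^ 2) ∧
    -- the fixed-point equation defines `δ`, which is positive unless it degenerates, and `α < 1`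
    ∃ δ : ℕ → ℝ,
      (∀ k,
        RidgeFeatures.IsDelta (N k) (RidgeFeatures.sigmaZ (μ k) (F k)) lam (δ k) ∧
        (∀ d, RidgeFeatures.IsDelta (N k) (RidgeFeatures.sigmaZ (μ k) (F k)) lam d → d = δ k) ∧
        (N k ≠ 0 → RidgeFeatures.sigmaZ (μ k) (F k) ≠ 0 → 0 < δ k) ∧
        RidgeFeatures.alpha (N k) (RidgeFeatures.sigmaZ (μ k) (F k)) lam (δ k) < 1) ∧
      -- the asymptotic bias and variance
      Tendsto (fun k => RidgeFeatures.biasSq (N k) (μ k) (ν k) (θ k) (F k) lam -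
        RidgeFeatures.biasEquiv (N k) (μ k) (θ k) (F k) lam (δ k)) atTop (𝓝 0) ∧
      Tendsto (fun k => RidgeFeatures.variance (N k) (μ k) (ν k) (θ k) (F k) lam -
        RidgeFeatures.varEquiv (N k) (μ k) (F k) lam σ (δ k)) atTop (𝓝 0) := by
  open RidgeFeatures in
  have hz : ∀ k, Concentrated (concentrationBound q C s) (μ k) (features (F k)) := fun k =>
    (hconc k).concentrated (hF k) hq hC hs
  have hS : ∀ k, (sigmaZ (μ k) (F k)).PosSemidef := fun k => secondMoment_posSemidef (hz k).allLp
  choose δ hδ using fun k => exists_isDelta (N k) (hS k) hlam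
  have hα : ∀ k, alpha (N k) (sigmaZ (μ k) (F k)) lam (δ k) < 1 := fun k =>
    alpha_lt_one (hS k) hlam (hδ k)
  have hn : ∀ᶠ k in atTop, (n k : ℝ) ≤ (γ + 1) * N k := by
    filter_upwards [hnN.eventually (ge_mem_nhds (lt_add_one γ)), hN.eventually_gt_atTop 0]
      with k h1 h2
    rwa [div_le_iff₀ (by exact_mod_cast h2)] at h1
  refine ⟨fun k => ⟨memLp_testError (hz k).allLp (hμ k) hlam (hν k) (hν_mean k),
    memLp_biasError (hz k).allLp (hμ k) hlam (hν k) (hν_mean k),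
    memLp_varError (hz k).allLp hlam (hν k) (hν_mean k),
    risk_eq (hz k).allLp (hμ k) hlam (hν k) (hν_mean k) (hν_var k)⟩, δ,
    fun k => ⟨hδ k, fun d hd => hd.eq (hS k) hlam (hδ k), (hδ k).pos (hS k) hlam, hα k⟩, ?_, ?_⟩
  · refine (tendsto_integral_ridgeError_sq (g := fun k => teacher (θ k)) hz
      (fun k => (innerSL ℝ (θ k)).continuous.measurable) (fun k => memLp_teacher (hμ k) (θ k)) hθ
      hlam hN (by positivity) hn hδ).congr fun k => ?_
    rw [biasSq_eq (hν k) (hν_mean k), biasEquiv_eq (hz k).allLp (hμ k) (θ k) hlam (hδ k).1]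
  · -- the variance is unchanged if the noise is replaced by signs; it is then the error of a ridge
    -- predictor with bounded labels, up to the noise of the test label
    have key := tendsto_integral_ridgeError_sq (μ := fun k => (μ k).prod (signLaw σ))
      (z := fun k p => features (F k) p.1) (g := fun k p => p.2) (N := N) (δ := δ)
      (fun k => (hz k).prod_fst) (fun k => measurable_snd)
      (fun k => (memLp_signLaw σ).comp_measurePreserving measurePreserving_snd)
      (fun ε hε => ⟨|σ| + 1, fun k => ?_⟩) hlam hN (by positivity) hn
      (fun k => by rw [secondMoment_prod_fst]; exact hδ k)
    · refine key.congr fun k => ?_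
      have h1 : 1 - alpha (N k) (sigmaZ (μ k) (F k)) lam (δ k) ≠ 0 := (sub_pos.2 (hα k)).ne'
      rw [integral_ridgeError_noise_sq (θ := θ k) (hz k).allLp hlam (memLp_signLaw σ)
        (integral_id_signLaw σ) (variance_signLaw σ), equivRisk_noise (integral_id_signLaw σ),
        secondMoment_prod_fst, integral_signLaw σ fun x => x ^ 2,
        variance_eq (hz k).allLp hlam (hν k) (hν_mean k) (hν_var k),
        variance_eq (hz k).allLp hlam (memLp_signLaw σ) (integral_id_signLaw σ)
          (variance_signLaw σ), varEquiv]
      change _ + _ - (1 - alpha (N k) (sigmaZ (μ k) (F k)) lam (δ k))⁻¹ * _ = _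
      field_simp
      ring
    · have h0 : ((μ k).prod (signLaw σ)) {p | |σ| + 1 ≤ |p.2|} = 0 := by
        have h := (measurePreserving_snd (μ := μ k) (ν := signLaw σ)).quasiMeasurePreserving.ae
          (ae_abs_le_signLaw σ)
        refine measure_mono_null (fun p hp => ?_) h
        simp only [Set.mem_ofPred_eq, Set.mem_compl_iff] at hp ⊢
        linarith
      rw [Measure.restrict_eq_zero.2 h0, integral_zero_measure]
      exact hε.le
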